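/- Let $\mathbb K=\mathbb R$ or $\mathbb K=\mathbb C$, and let $S^1=\mathbb R/\mathbb Z$ with coordinate $x$. For $\lambda\in\mathbb K$ let $\mathcal F_\lambda$ be the space of $\lambda$-densities $\varphi=\phi(x)(dx)^\lambda$, $\phi\in C^\infty(S^1,\mathbb K)$, on which an orientation-preserving diffeomorphism $f$ of $S^1$ acts by $\rho^\lambda_{f^{-1}}\colon\phi(x)(dx)^\lambda\mapsto (f'(x))^\lambda\,\phi(f(x))(dx)^\lambda$. For $\lambda,\mu\in\mathbb K$ let $\mathcal D^3_{\lambda,\mu}(S^1)$ be the space of linear differential operators $A=\sum_{i=0}^3a_i(x)\frac{d^i}{dx^i}\colon\mathcal F_\lambda\to\mathcal F_\mu$ with smooth coefficients, on which $f$ acts by $A\mapsto\rho^\mu_f\circ A\circ\rho^\lambda_{f^{-1}}$. Let $\mathcal I^3_{\lambda,\mu}(S^1)$ be the associative $\mathbb K$-algebra of all $\mathbb K$-linear maps $T\colon\mathcal D^3_{\lambda,\mu}(S^1)\to\mathcal D^3_{\lambda,\mu}(S^1)$ commuting with this action for every orientation-preserving diffeomorphism $f$ (neither continuity nor locality of $T$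 is assumed). Let $\mathbb K^n$ be the direct sum of $n$ copies of the algebra $\mathbb K$, let $\mathfrak t_2$ be the algebra of lower triangular $2\times2$ matrices, and let $$\mathfrak a=\left\{\begin{pmatrix}a&0\\b&a\end{pmatrix}\right\},\qquad \mathfrak b=\left\{\begin{pmatrix}a&0&0&d\\0&a&0&0\\0&c&b&0\\0&0&0&b\end{pmatrix}\right\},$$ all with entries in $\mathbb K$. Then $\mathcal I^3_{\lambda,\mu}(S^1)=\mathbb K\cdot\mathrm{Id}$ for all $(\lambda,\mu)$ which satisfy none of $\lambda+\mu=1$, $(3\lambda+1)(3\mu-4)=-1$, $\mu-\lambda=2$, $\lambda=0$, $\mu=1$. In the remaining cases there are the following isomorphisms of $\mathbb K$-algebras. 1. $\mathcal I^3_{\lambda,\mu}(S^1)\cong\mathbb K^2$ if $\lambda+\mu=1$ and $\lambda\ne0,-\frac12,-\frac23$, and also if $(3\lambda+1)(3\mu-4)=-1$, $\lambda\neq0,-\frac23$ and $\mu-\lambda\ne2$ (the last condition is automatic for $\mathbb K=\mathbb R$). 2. $\mathcal I^3_{\lambda,\mu}(S^1)\cong\mathfrak a$ if $\mu-\lambda=2$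 and $\lambda\neq0,-\frac12,-1$. 3. $\mathcal I^3_{\lambda,\mu}(S^1)\cong\mathbb K^3$ if $\lambda=0$ and $\mu\ne3,2,1$, and also if $\mu=1$ and $\lambda\neq0,-1,-2$. 4. $\mathcal I^3_{\lambda,\mu}(S^1)\cong\mathfrak a\oplus\mathbb K$ if $(\lambda,\mu)$ is $(0,3)$, $(0,2)$, $(-1,1)$ or $(-2,1)$. 5. $\mathcal I^3_{-\frac12,\frac32}(S^1)\cong\mathfrak t_2$. 6. $\mathcal I^3_{-\frac23,\frac53}(S^1)\cong\mathbb K^3$. 7. $\mathcal I^3_{0,1}(S^1)\cong\mathfrak b\oplus\mathbb K^2$. -/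

import Mathlib

open scoped ContDiff

namespace CircleSymm

/-- `C^∞(S¹; 𝕜)` for `S¹ = ℝ/ℤ` with its global coordinate `x`: the smooth `1`-periodic functions
`ℝ → 𝕜`. Through the trivialization `φ(x)(dx)^l ↔ φ(x)` this is the underlying vector space of the
space of densities `F_l(S¹)` for every weight `l`; the weight enters through the action of
diffeomorphisms, see `pullback`. -/
def CircleFun (𝕜 : Type*) [RCLike 𝕜] : Subalgebra 𝕜 (ℝ → 𝕜) where
  carrier := {φ | ContDiff ℝ ∞ φ ∧ Function.Periodic φ 1}
  mul_mem' := fun ha hb => ⟨ha.1.mul hb.1, ha.2.mul hb.2⟩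
  add_mem' := fun ha hb => ⟨ha.1.add hb.1, ha.2.add hb.2⟩
  algebraMap_mem' := fun _ => ⟨contDiff_const, fun _ => rfl⟩

/-- An orientation-preserving diffeomorphism of `S¹ = ℝ/ℤ`, given by a lift to `ℝ`. (Lifts which
differ by an integer induce the same diffeomorphism and act in the same way on densities.) -/
structure CircleDiffeo where
  lift : ℝ ≃ ℝ
  contDiff_lift : ContDiff ℝ ∞ lift
  contDiff_symm : ContDiff ℝ ∞ lift.symm
  lift_add_one : ∀ x, lift (x + 1) = lift x + 1
  deriv_pos : ∀ x, 0 < deriv lift x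

namespace CircleDiffeo

/-- The inverse diffeomorphism. -/
def symm (f : CircleDiffeo) : CircleDiffeo where
  lift := f.lift.symm
  contDiff_lift := f.contDiff_symm
  contDiff_symm := f.contDiff_lift
  lift_add_one := fun x => by
    rw [Equiv.symm_apply_eq, f.lift_add_one, Equiv.apply_symm_apply]
  deriv_pos := fun x => by
    have h1 : HasDerivAt f.lift (deriv f.lift (f.lift.symm x)) (f.lift.symm x) :=
      (f.contDiff_lift.differentiable (by simp) _).hasDerivAt
    have h2 : HasDerivAt f.lift.symm (deriv f.lift.symm x) x :=
      (f.contDiff_symm.differentiable (by simp) _).hasDerivAt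
    have h3 := h1.comp x h2
    have h4 : (f.lift ∘ f.lift.symm) = id := by ext y; simp
    rw [h4] at h3
    have h5 := h3.unique (hasDerivAt_id x)
    have h6 := f.deriv_pos (f.lift.symm x)
    by_contra h
    nlinarith

theorem deriv_add_one (f : CircleDiffeo) (x : ℝ) : deriv f.lift (x + 1) = deriv f.lift x := by
  have h : (fun y => f.lift (y + 1)) = fun y => f.lift y + 1 := by
    ext y; exact f.lift_add_one y
  rw [← deriv_comp_add_const, h, deriv_add_const]

end CircleDiffeo

variable {𝕜 : Type*} [RCLike 𝕜]

/-- The function `(f')^l = exp (l log f')`, for a weight `l : 𝕜`. -/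
noncomputable def derivPow (f : CircleDiffeo) (l : 𝕜) (x : ℝ) : 𝕜 :=
  NormedSpace.exp (l * ((Real.log (deriv f.lift x) : ℝ) : 𝕜))

theorem contDiff_derivPow (f : CircleDiffeo) (l : 𝕜) : ContDiff ℝ ∞ (derivPow f l) := by
  have h1 : ContDiff ℝ ∞ (deriv f.lift) :=
    (contDiff_infty_iff_deriv.1 f.contDiff_lift).2
  have h2 : ContDiff ℝ ∞ fun x => Real.log (deriv f.lift x) :=
    h1.log fun x => (f.deriv_pos x).ne'
  have h3 : ContDiff ℝ ∞ fun x => ((Real.log (deriv f.lift x) : ℝ) : 𝕜) :=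
    (RCLike.ofRealCLM (K := 𝕜)).contDiff.comp h2
  have h4 : ContDiff ℝ ∞ (NormedSpace.exp : 𝕜 → 𝕜) :=
    contDiff_iff_contDiffAt.2 fun x => (NormedSpace.exp_analytic (𝕂 := ℝ) x).contDiffAt
  exact h4.comp (contDiff_const.mul h3)

/-- The pull-back of `l`-densities by `f`, that is, the operator `ρ^l_{f⁻¹}`:
`φ(x)(dx)^l ↦ (f'(x))^l φ(f(x)) (dx)^l`. -/
noncomputable def pullback (f : CircleDiffeo) (l : 𝕜) : CircleFun 𝕜 →ₗ[𝕜] CircleFun 𝕜 where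
  toFun φ := ⟨fun x => derivPow f l x * φ.1 (f.lift x),
    (contDiff_derivPow f l).mul (φ.2.1.comp f.contDiff_lift), fun x => by
      simp only [derivPow, f.deriv_add_one, f.lift_add_one, φ.2.2 (f.lift x)]⟩
  map_add' φ ψ := by ext x; simp [mul_add]
  map_smul' c φ := by ext x; simp [mul_left_comm]

/-- The derivative `d/dx` on `C^∞(S¹; 𝕜)`. -/
noncomputable def circleDeriv : CircleFun 𝕜 →ₗ[𝕜] CircleFun 𝕜 where
  toFun φ := ⟨deriv φ.1, (contDiff_infty_iff_deriv.1 φ.2.1).2, fun x => by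
    have h : (fun y => φ.1 (y + 1)) = φ.1 := by ext y; exact φ.2.2 y
    rw [← deriv_comp_add_const, h]⟩
  map_add' φ ψ := by
    ext x
    exact deriv_add (φ.2.1.differentiable (by simp) x) (ψ.2.1.differentiable (by simp) x)
  map_smul' c φ := by
    ext x
    exact deriv_const_mul c (φ.2.1.differentiable (by simp) x)

/-- The differential operator `a_k d^k/dx^k + ⋯ + a_1 d/dx + a_0`. -/
noncomputable def diffOp (k : ℕ) (a : ℕ → CircleFun 𝕜) : CircleFun 𝕜 →ₗ[𝕜] CircleFun 𝕜 :=
  ∑ i ∈ Finset.range (k + 1), LinearMap.mulLeft 𝕜 (a i) ∘ₗ (circleDeriv ^ i)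

theorem diffOp_apply (k : ℕ) (a : ℕ → CircleFun 𝕜) (φ : CircleFun 𝕜) :
    diffOp k a φ = ∑ i ∈ Finset.range (k + 1), a i * (circleDeriv ^ i) φ := by
  simp [diffOp]

/-- The space `D^k(S¹)` of linear differential operators of order at most `k` with smooth
coefficients, as operators on coefficient functions of densities. It underlies all the modules
`D^k_{l,m}(S¹)`. -/
def diffOps (𝕜 : Type*) [RCLike 𝕜] (k : ℕ) : Submodule 𝕜 (CircleFun 𝕜 →ₗ[𝕜] CircleFun 𝕜) where
  carrier := {A | ∃ a : ℕ → CircleFun 𝕜, A = diffOp k a}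
  zero_mem' := ⟨0, by ext1 φ; simp [diffOp_apply]⟩
  add_mem' := by
    rintro _ _ ⟨a, rfl⟩ ⟨b, rfl⟩
    exact ⟨a + b, by ext1 φ; simp [diffOp_apply, add_mul, Finset.sum_add_distrib]⟩
  smul_mem' := by
    rintro c _ ⟨a, rfl⟩
    exact ⟨c • a, by ext1 φ; simp [diffOp_apply, Finset.smul_sum]⟩

/-- The action `A ↦ ρ^m_f ∘ A ∘ ρ^l_{f⁻¹}` of a diffeomorphism `f` on the linear maps
`F_l(S¹) → F_m(S¹)`. -/
noncomputable def conjAction (f : CircleDiffeo) (l m : 𝕜) :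
    (CircleFun 𝕜 →ₗ[𝕜] CircleFun 𝕜) →ₗ[𝕜] (CircleFun 𝕜 →ₗ[𝕜] CircleFun 𝕜) where
  toFun A := pullback f.symm m ∘ₗ A ∘ₗ pullback f l
  map_add' A B := by rw [LinearMap.add_comp, LinearMap.comp_add]
  map_smul' c A := by rw [LinearMap.smul_comp, LinearMap.comp_smul, RingHom.id_apply]

theorem derivPow_mul_neg (f : CircleDiffeo) (l : 𝕜) (x : ℝ) :
    derivPow f l x * derivPow f (-l) x = 1 := by
  unfold derivPow
  rw [← NormedSpace.exp_add_of_commute (Commute.all _ _)]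
  simp

theorem derivPow_one (f : CircleDiffeo) (x : ℝ) :
    derivPow f (1 : 𝕜) x = ((deriv f.lift x : ℝ) : 𝕜) := by
  have h := NormedSpace.algebraMap_exp_comm (𝕂 := ℝ) (𝔸 := 𝕜) (Real.log (deriv f.lift x))
  rw [← Real.exp_eq_exp_ℝ, Real.exp_log (f.deriv_pos x)] at h
  rw [derivPow, one_mul]
  exact h.symm

theorem circleDeriv_mul (a b : CircleFun 𝕜) :
    circleDeriv (a * b) = circleDeriv a * b + a * circleDeriv b := by
  ext x
  exact deriv_mul (a.2.1.differentiable (by simp) x) (b.2.1.differentiable (by simp) x)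

/-- The chain rule: `d/dx ∘ ρ^l_{f⁻¹}` is a combination of `ρ^l_{f⁻¹}` and `ρ^l_{f⁻¹} ∘ d/dx`. -/
theorem circleDeriv_pullback (f : CircleDiffeo) (l : 𝕜) (φ : CircleFun 𝕜) :
    circleDeriv (pullback f l φ) =
      (circleDeriv (pullback f l 1) * pullback f (-l) 1) * pullback f l φ +
        pullback f 1 1 * pullback f l (circleDeriv φ) := by
  have h1 : pullback f l φ = pullback f l 1 * pullback f 0 φ := by
    ext x
    simp [pullback, derivPow]
  have h2 : pullback f l (1 : CircleFun 𝕜) * pullback f (-l) 1 = 1 := by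
    ext x
    simp [pullback, derivPow_mul_neg]
  have h3 : circleDeriv (pullback f (0 : 𝕜) φ) = pullback f 1 1 * pullback f 0 (circleDeriv φ) := by
    ext x
    have e1 : HasDerivAt f.lift (deriv f.lift x) x :=
      (f.contDiff_lift.differentiable (by simp) _).hasDerivAt
    have e2 : HasDerivAt φ.1 (deriv φ.1 (f.lift x)) (f.lift x) :=
      (φ.2.1.differentiable (by simp) _).hasDerivAt
    have e3 := (e2.scomp x e1).deriv
    have e4 : ((pullback f (0 : 𝕜) φ : CircleFun 𝕜) : ℝ → 𝕜) = φ.1 ∘ f.lift := by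
      ext y
      simp [pullback, derivPow]
    change deriv ((pullback f (0 : 𝕜) φ : CircleFun 𝕜) : ℝ → 𝕜) x = _
    rw [e4, e3]
    simp only [pullback, MulMemClass.coe_mul, Pi.mul_apply, LinearMap.coe_mk, AddHom.coe_mk,
      derivPow_one, RCLike.real_smul_eq_coe_mul]
    simp [derivPow, circleDeriv]
  have h4 : pullback f l (circleDeriv φ) = pullback f l 1 * pullback f 0 (circleDeriv φ) := by
    ext x
    simp [pullback, derivPow]
  rw [h4, h1, circleDeriv_mul, h3]
  linear_combination (-(circleDeriv (pullback f l 1)) * pullback f 0 φ) * h2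

theorem circleDeriv_pow_pullback (f : CircleDiffeo) (l : 𝕜) (i : ℕ) :
    ∃ b : ℕ → CircleFun 𝕜, ∀ φ, (circleDeriv ^ i) (pullback f l φ) =
      ∑ j ∈ Finset.range (i + 1), b j * pullback f l ((circleDeriv ^ j) φ) := by
  induction i with
  | zero => exact ⟨1, fun φ => by simp⟩
  | succ i ih =>
    obtain ⟨b, hb⟩ := ih
    refine ⟨fun j => (if j ≤ i then circleDeriv (b j) +
      b j * (circleDeriv (pullback f l 1) * pullback f (-l) 1) else 0) +
      (if j = 0 then 0 else b (j - 1) * pullback f 1 1), fun φ => ?_⟩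
    rw [pow_succ', Module.End.mul_apply, hb, map_sum]
    simp only [add_mul, Finset.sum_add_distrib]
    rw [Finset.sum_range_succ _ (i + 1), Finset.sum_range_succ' _ (i + 1)]
    have h1 : ∀ j ∈ Finset.range (i + 1), j ≤ i := fun j hj =>
      Nat.lt_succ_iff.1 (Finset.mem_range.1 hj)
    simp only [Nat.not_succ_le_self, if_false, if_true, zero_mul, add_zero, Nat.succ_ne_zero,
      Nat.add_sub_cancel]
    rw [← Finset.sum_add_distrib]
    refine Finset.sum_congr rfl fun j hj => ?_
    rw [if_pos (h1 j hj), circleDeriv_mul, circleDeriv_pullback, pow_succ', Module.End.mul_apply]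
    ring

theorem pullback_symm_mul (f : CircleDiffeo) (l m : 𝕜) (b φ : CircleFun 𝕜) :
    pullback f.symm m (b * pullback f l φ) = pullback f.symm m (b * pullback f l 1) * φ := by
  ext x
  simp [pullback, CircleDiffeo.symm, mul_assoc]

/-- Diffeomorphisms preserve the space of differential operators of order at most `k`. -/
theorem conjAction_mem_diffOps (f : CircleDiffeo) (l m : 𝕜) (k : ℕ) :
    ∀ A ∈ diffOps 𝕜 k, conjAction f l m A ∈ diffOps 𝕜 k := by
  rintro _ ⟨a, rfl⟩
  choose b hb using circleDeriv_pow_pullback f l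
  refine ⟨fun j => ∑ i ∈ Finset.range (k + 1), if j ≤ i then
    pullback f.symm m (a i * b i j * pullback f l 1) else 0, ?_⟩
  ext1 φ
  simp only [conjAction, LinearMap.coe_mk, AddHom.coe_mk, LinearMap.comp_apply, diffOp_apply,
    map_sum, hb, Finset.mul_sum, Finset.sum_mul, ite_mul, zero_mul]
  rw [Finset.sum_comm]
  refine Finset.sum_congr rfl fun i hi => ?_
  rw [← Finset.sum_filter]
  have h : (Finset.range (k + 1)).filter (fun j => j ≤ i) = Finset.range (i + 1) := by
    ext j
    simp only [Finset.mem_filter, Finset.mem_range] at *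
    omega
  rw [h]
  exact Finset.sum_congr rfl fun j _ => by rw [← mul_assoc, pullback_symm_mul]

/-- The action of a diffeomorphism `f` on the module `D^k_{l,m}(S¹)`. -/
noncomputable def diffOpsAction (k : ℕ) (l m : 𝕜) (f : CircleDiffeo) :
    Module.End 𝕜 (diffOps 𝕜 k) :=
  (conjAction f l m).restrict (conjAction_mem_diffOps f l m k)

/-- The algebra of symmetries `I^k_{l,m}(S¹)`: the commutant of the action of the group of
diffeomorphisms in the algebra of all `𝕜`-linear endomorphisms of `D^k_{l,m}(S¹)`. No continuity
or locality is required. -/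
noncomputable def symmetryAlgebra (k : ℕ) (l m : 𝕜) :
    Subalgebra 𝕜 (Module.End 𝕜 (diffOps 𝕜 k)) :=
  Subalgebra.centralizer 𝕜 (Set.range (diffOpsAction k l m))

/-- The algebra `𝔱_n` of lower triangular `n × n` matrices. -/
def algT (𝕜 : Type*) [RCLike 𝕜] (n : ℕ) : Subalgebra 𝕜 (Matrix (Fin n) (Fin n) 𝕜) where
  carrier := {M | ∀ i j, i < j → M i j = 0}
  mul_mem' := by
    intro M N hM hN i j hij
    rw [Matrix.mul_apply]
    refine Finset.sum_eq_zero fun r _ => ?_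
    rcases lt_or_ge i r with h | h
    · rw [hM i r h, zero_mul]
    · rw [hN r j (lt_of_le_of_lt h hij), mul_zero]
  add_mem' := fun hM hN i j hij => by simp [hM i j hij, hN i j hij]
  algebraMap_mem' := fun c i j hij => by simp [Matrix.algebraMap_matrix_apply, hij.ne]

/-- The algebra `𝔞` of matrices with rows `(a, 0)` and `(b, a)`. -/
def algA (𝕜 : Type*) [RCLike 𝕜] : Subalgebra 𝕜 (Matrix (Fin 2) (Fin 2) 𝕜) where
  carrier := {M | ∃ a b : 𝕜, M = !![a, 0; b, a]}
  mul_mem' := by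
    rintro _ _ ⟨a, b, rfl⟩ ⟨a', b', rfl⟩
    exact ⟨a * a', b * a' + a * b', by simp⟩
  add_mem' := by
    rintro _ _ ⟨a, b, rfl⟩ ⟨a', b', rfl⟩
    exact ⟨a + a', b + b', by simp⟩
  algebraMap_mem' := fun c => ⟨c, 0, by
    ext i j; fin_cases i <;> fin_cases j <;> simp [Matrix.algebraMap_matrix_apply]⟩

/-- The algebra `𝔟` of matrices with rows `(a, 0, 0, d)`, `(0, a, 0, 0)`, `(0, c, b, 0)` and
`(0, 0, 0, b)`. -/
def algB (𝕜 : Type*) [RCLike 𝕜] : Subalgebra 𝕜 (Matrix (Fin 4) (Fin 4) 𝕜) where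
  carrier := {M | ∃ a b c d : 𝕜, M = !![a, 0, 0, d; 0, a, 0, 0; 0, c, b, 0; 0, 0, 0, b]}
  mul_mem' := by
    rintro _ _ ⟨a, b, c, d, rfl⟩ ⟨a', b', c', d', rfl⟩
    refine ⟨a * a', b * b', c * a' + b * c', a * d' + d * b', ?_⟩
    ext i j
    fin_cases i <;> fin_cases j <;> simp [Matrix.mul_apply, Fin.sum_univ_four]
  add_mem' := by
    rintro _ _ ⟨a, b, c, d, rfl⟩ ⟨a', b', c', d', rfl⟩
    refine ⟨a + a', b + b', c + c', d + d', ?_⟩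
    ext i j
    fin_cases i <;> fin_cases j <;> simp
  algebraMap_mem' := fun c => ⟨c, c, 0, 0, by
    ext i j; fin_cases i <;> fin_cases j <;> simp [Matrix.algebraMap_matrix_apply]⟩

end CircleSymm

open scoped ContDiff
open Filter Topology

namespace CircleSymm

variable {𝕜 : Type*} [RCLike 𝕜]

/-! ### Diffeomorphisms of the circle and periodic functions with prescribed germs. -/

section

namespace CircleDiffeo

/-! A third-order operator A is the quadruple (a_0, ..., a_3) of its coefficients, on which f acts
by powers of f' and by terms polynomial in the jets of f''/f' (`transport`, `compLift_coeffAction`).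
The heart of the matter is that a symmetry T, assumed only linear, is a triangular differential
operator with constant coefficients, up to one nonlocal exception.

Locality. If a vanishes near 0, the diffeomorphisms supported close to 0 fix a, hence they fix T a.
Dilations near 0 and the germs x + εx², x + εx³ then force T a to vanish at 0, except in a component
carrying an invariant operator: the identity for l = m, or d/dx for (l, m) = (0, 1)
(`LocallyInvariant.apply_zero`). In that component the derivative still vanishes at 0.

No continuity is needed. A component of T a (or its derivative) at 0 is therefore a functional of
the germ of a, homogeneous under a contraction by c. Germs flat to high order are coboundaries q(x)
- c^(-w) q(c x) (`exists_cohomological`) and are killed by such a functional, so a single Taylor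
coefficient survives (`homogeneous_apply`). Rotations carry the result to every point. Thus T =
`triOp t` with t upper triangular, plus, in the two exceptional cases, L(a) times the invariant
operator.

The functional L. It is invariant under diffeomorphisms. Graded by the order i of the operator, it
yields invariant functionals on densities of weight m - l - i. These are zero for weight 0 and for
negative real weights, and multiples of the integral for weight 1. Hence L = 0 if l = m, while (0,
1) has the additional symmetry A ↦ (∫ A(1)) d/dx.

Algebra. Equivariance of `triOp t` amounts to ten linear equations on the entries of t (`SymmRel`),
and `triOp` turns matrix products into compositions. The list of cases comes from solving these
equations. On l + m = 1 there is the formal adjoint; on l = 0 the part A(1) = a_0 splits off, and m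
= 1 is the mirror image under the adjoint; on the hyperbola and on m - l = 2 there are maps that
build a first-order operator out of an invariant density. Where such curves meet, the algebra grows
or acquires nilpotents. -/

theorem surjective_of_lift {F : ℝ → ℝ} (hF : Continuous F) (h1 : ∀ x, F (x + 1) = F x + 1) :
    Function.Surjective F := by
  have hn : ∀ n : ℕ, F n = F 0 + n ∧ F (-n) = F 0 - n := by
    intro n
    induction n with
    | zero => simp
    | succ n ih =>
      have h2 := h1 (-(n + 1 : ℝ))
      rw [show -(n + 1 : ℝ) + 1 = -n by ring, ih.2] at h2
      push_cast
      exact ⟨by rw [h1, ih.1]; ring, by linarith⟩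
  intro y
  obtain ⟨n, h⟩ := exists_nat_ge |y - F 0|
  have h3 := abs_le.1 h
  obtain ⟨x, -, hx⟩ := intermediate_value_Icc (a := -(n : ℝ)) (b := n)
    (by have : (0 : ℝ) ≤ n := Nat.cast_nonneg n
        linarith) hF.continuousOn
    (show y ∈ Set.Icc (F (-n)) (F n) by
      rw [(hn n).1, (hn n).2]
      constructor <;> linarith)
  exact ⟨x, hx⟩

/-- The diffeomorphism of the circle with a given lift. -/
noncomputable def ofLift (F : ℝ → ℝ) (hF : ContDiff ℝ ∞ F) (h1 : ∀ x, F (x + 1) = F x + 1)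
    (hpos : ∀ x, 0 < deriv F x) : CircleDiffeo where
  lift := Equiv.ofBijective F
    ⟨(strictMono_of_deriv_pos hpos).injective, surjective_of_lift hF.continuous h1⟩
  contDiff_lift := hF
  contDiff_symm := by
    let e := ((strictMono_of_deriv_pos hpos).orderIsoOfSurjective F
      (surjective_of_lift hF.continuous h1)).toHomeomorph
    have h2 : ContDiff ℝ ∞ e.symm := e.contDiff_symm_deriv (f' := deriv F)
      (fun x => (hpos x).ne') (fun x => (hF.differentiable (by simp) x).hasDerivAt) hF
    convert h2 using 1
    ext y
    rw [Equiv.symm_apply_eq]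
    exact (e.apply_symm_apply y).symm
  lift_add_one := h1
  deriv_pos := hpos

/-- The rotation by the angle `s`. -/
noncomputable def rotation (s : ℝ) : CircleDiffeo :=
  ofLift (fun x => x + s) (contDiff_id.add contDiff_const) (fun x => by ring) (fun x => by simp)

@[simp]
theorem rotation_lift (s x : ℝ) : (rotation s).lift x = x + s := rfl

/-- The diffeomorphism `x ↦ x + u x`, for a periodic function `u` with `u' > -1`. -/
noncomputable def perturb (u : CircleFun ℝ) (hu : ∀ x, -1 < deriv u.1 x) : CircleDiffeo :=
  ofLift (fun x => x + u.1 x) (contDiff_id.add u.2.1)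
    (fun x => by rw [u.2.2 x]; ring)
    (fun x => by
      have h : HasDerivAt (fun x => x + u.1 x) (1 + deriv u.1 x) x :=
        (hasDerivAt_id x).add (u.2.1.differentiable (by simp) x).hasDerivAt
      rw [h.deriv]
      linarith [hu x])

end CircleDiffeo

namespace CircleFun

variable {𝕜 : Type*} [RCLike 𝕜]

theorem exists_bound (φ : CircleFun 𝕜) : ∃ M : ℝ, 0 < M ∧ ∀ x, ‖φ.1 x‖ ≤ M := by
  obtain ⟨M, hM⟩ := isCompact_Icc.exists_bound_of_continuousOn (s := Set.Icc (0 : ℝ) 1)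
    φ.2.1.continuous.continuousOn
  refine ⟨max M 1, by positivity, fun x => ?_⟩
  obtain ⟨y, hy, hxy⟩ := φ.2.2.exists_mem_Ico₀ (by norm_num) x
  rw [hxy]
  exact (hM y ⟨hy.1, hy.2.le⟩).trans (le_max_left _ _)

theorem eventually_smul_deriv_gt (u : CircleFun ℝ) :
    ∀ᶠ ε : ℝ in 𝓝 0, ∀ x, -1 < deriv (ε • u).1 x := by
  obtain ⟨M, hM, h⟩ := exists_bound (circleDeriv u)
  have h1 : ∀ᶠ ε : ℝ in 𝓝 0, |ε| < 1 / M :=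
    (continuous_abs.tendsto' (0 : ℝ) 0 abs_zero).eventually (gt_mem_nhds (by positivity))
  filter_upwards [h1] with ε hε x
  have h2 : deriv (ε • u).1 x = ε * deriv u.1 x :=
    deriv_const_mul ε (u.2.1.differentiable (by simp) x)
  have h3 : |deriv u.1 x| ≤ M := h x
  have h4 : |ε * deriv u.1 x| < 1 := by
    rw [abs_mul]
    calc |ε| * |deriv u.1 x| ≤ |ε| * M := by gcongr
      _ < 1 / M * M := by gcongr
      _ = 1 := by field_simp
  rw [h2]
  exact (abs_lt.1 h4).1

theorem apply_sub_round (φ : CircleFun 𝕜) (x : ℝ) : φ.1 (x - round x) = φ.1 x := by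
  simpa using φ.2.2.sub_int_mul_eq (x := x) (round x)

/-- The periodization of a smooth function with support in an interval shorter than `1`. -/
theorem exists_periodization {g : ℝ → 𝕜} (hg : ContDiff ℝ ∞ g) {r : ℝ} (hr : r < 1 / 2)
    (h0 : ∀ x, r < |x| → g x = 0) : ∃ φ : CircleFun 𝕜, ∀ x, |x| ≤ 1 / 2 → φ.1 x = g x := by
  refine ⟨⟨fun x => g (x - round x), contDiff_iff_contDiffAt.2 fun x => ?_, fun x => ?_⟩, ?_⟩
  · rcases (abs_sub_round x).lt_or_eq with h | h
    · have h1 : (fun y => g (y - round y)) =ᶠ[𝓝 x] fun y => g (y - round x) := by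
        have h2 : ∀ᶠ y : ℝ in 𝓝 x, |y - round x| < 1 / 2 :=
          (Continuous.tendsto (f := fun y : ℝ => |y - round x|) (by fun_prop) x).eventually (gt_mem_nhds h)
        filter_upwards [h2] with y hy
        rw [abs_lt] at hy
        rw [(round_eq_iff (n := round x)).2 ⟨by linarith, by linarith⟩]
      exact (hg.contDiffAt.comp x (contDiffAt_id.sub contDiffAt_const)).congr_of_eventuallyEq h1
    -- Near a seam, where `round` jumps, the representative stays farther than r from 0 on both
    -- sides, and g vanishes there.
    · have h1 : (fun y => g (y - round y)) =ᶠ[𝓝 x] fun _ => 0 := by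
        have h2 : ∀ᶠ y in 𝓝 x, |x - y| < 1 / 2 - r :=
          (Continuous.tendsto' (by fun_prop) x 0 (by simp)).eventually (gt_mem_nhds (by linarith))
        filter_upwards [h2] with y hy
        apply h0
        have h3 := round_le x (round y)
        have h4 := abs_sub_le x y (round y)
        linarith
      exact contDiffAt_const.congr_of_eventuallyEq h1
  · simp only [round_add_one]
    push_cast
    ring_nf
  · intro x hx
    rw [abs_le] at hx
    rcases hx.2.lt_or_eq with h | h
    · have : round x = 0 := round_eq_zero_iff.2 ⟨by linarith, by linarith⟩
      simp [this]
    -- Halves are rounded up, so 1/2 is represented by -1/2; g vanishes at both.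
    · have h1 : round x = 1 := by
        rw [round_eq_iff]; push_cast; constructor <;> linarith
      simp only [h1]
      rw [h0 x (by rw [abs_of_pos] <;> linarith), h0]
      push_cast
      rw [h]
      norm_num
      linarith

theorem exists_bump {r : ℝ} (hr : 0 < r) (hr2 : r < 1 / 2) : ∃ χ : CircleFun ℝ,
    (∀ x, |x| ≤ r / 2 → χ.1 x = 1) ∧ ∀ x, |x| ≤ 1 / 2 → r ≤ |x| → χ.1 x = 0 := by
  let g : ContDiffBump (0 : ℝ) := ⟨r / 2, r, by linarith, by linarith⟩
  obtain ⟨χ, hχ⟩ := exists_periodization (g := g) g.contDiff hr2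
    (fun x hx => g.zero_of_le_dist (by simpa using hx.le))
  refine ⟨χ, fun x hx => ?_, fun x hx hx2 => ?_⟩
  · rw [hχ x (by linarith)]
    exact g.one_of_mem_closedBall (by simpa using hx)
  · rw [hχ x hx]
    exact g.zero_of_le_dist (by simpa using hx2)

theorem exists_localCoord : ∃ h : CircleFun ℝ, ∀ x, |x| ≤ 2 / 5 → h.1 x = x := by
  let g : ContDiffBump (0 : ℝ) := ⟨2 / 5, 9 / 20, by norm_num, by norm_num⟩
  obtain ⟨χ, hχ⟩ := exists_periodization (g := fun x => g x * x)
    (g.contDiff.mul contDiff_id) (show (9 / 20 : ℝ) < 1 / 2 by norm_num)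
    (fun x hx => by
      rw [g.zero_of_le_dist (by simpa using hx.le), zero_mul])
  refine ⟨χ, fun x hx => ?_⟩
  rw [hχ x (by linarith), g.one_of_mem_closedBall (by simpa using hx), one_mul]

/-- A smooth periodic function which is the coordinate on `[-2/5, 2/5]`. -/
noncomputable def localCoord : CircleFun ℝ := exists_localCoord.choose

theorem localCoord_apply {x : ℝ} (hx : |x| ≤ 2 / 5) : localCoord.1 x = x :=
  exists_localCoord.choose_spec x hx

theorem localCoord_eventuallyEq : (localCoord.1 : ℝ → ℝ) =ᶠ[𝓝 0] id := by
  have h2 : ∀ᶠ y : ℝ in 𝓝 0, |y| < 2 / 5 :=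
    (Continuous.tendsto' (by fun_prop) (0 : ℝ) 0 (by simp)).eventually (gt_mem_nhds (by norm_num))
  filter_upwards [h2] with y hy
  exact localCoord_apply hy.le

/-- The composition of a smooth function with the local coordinate: a periodic function with a
given germ at `0`. -/
noncomputable def ofGerm (q : ℝ → 𝕜) (hq : ContDiff ℝ ∞ q) : CircleFun 𝕜 :=
  ⟨fun x => q (localCoord.1 x), hq.comp localCoord.2.1, fun x => by
    simp only [localCoord.2.2 x]⟩

theorem ofGerm_eventuallyEq (q : ℝ → 𝕜) (hq : ContDiff ℝ ∞ q) :
    ((ofGerm q hq).1 : ℝ → 𝕜) =ᶠ[𝓝 0] q := by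
  filter_upwards [localCoord_eventuallyEq] with y hy
  simp only [ofGerm, hy, id]

/-- Real functions as `𝕜`-valued functions. -/
noncomputable def ofReal : CircleFun ℝ →ₗ[ℝ] CircleFun 𝕜 where
  toFun φ := ⟨fun x => ((φ.1 x : ℝ) : 𝕜), (RCLike.ofRealCLM (K := 𝕜)).contDiff.comp φ.2.1,
    fun x => by simp only [φ.2.2 x]⟩
  map_add' φ ψ := by ext x; simp
  map_smul' c φ := by ext x; simp [Algebra.smul_def]

@[simp]
theorem ofReal_apply (φ : CircleFun ℝ) (x : ℝ) :
    (ofReal φ : CircleFun 𝕜).1 x = ((φ.1 x : ℝ) : 𝕜) := rfl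

theorem circleDeriv_ofReal (φ : CircleFun ℝ) :
    circleDeriv (ofReal φ : CircleFun 𝕜) = ofReal (circleDeriv φ) := by
  ext x
  exact ((RCLike.ofRealCLM (K := 𝕜)).hasFDerivAt.comp_hasDerivAt x
    (φ.2.1.differentiable (by simp) x).hasDerivAt).deriv

/-- The real part of a periodic function. -/
noncomputable def rePart (φ : CircleFun 𝕜) : CircleFun ℝ :=
  ⟨fun x => RCLike.re (φ.1 x), (RCLike.reCLM (K := 𝕜)).contDiff.comp φ.2.1,
    fun x => by simp only [φ.2.2 x]⟩

/-- The imaginary part of a periodic function. -/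
noncomputable def imPart (φ : CircleFun 𝕜) : CircleFun ℝ :=
  ⟨fun x => RCLike.im (φ.1 x), (RCLike.imCLM (K := 𝕜)).contDiff.comp φ.2.1,
    fun x => by simp only [φ.2.2 x]⟩

theorem ofReal_rePart_add (φ : CircleFun 𝕜) :
    ofReal (rePart φ) + (RCLike.I : 𝕜) • ofReal (imPart φ) = φ := by
  ext x
  have := RCLike.re_add_im (φ.1 x)
  simp only [rePart, imPart, ofReal, AddMemClass.coe_add, Pi.add_apply, LinearMap.coe_mk,
    AddHom.coe_mk, SetLike.val_smul, Pi.smul_apply, smul_eq_mul]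
  rw [mul_comm]
  exact this

end CircleFun

end

/-! ### Coefficients of third-order operators and the action of diffeomorphisms on them. -/

section

/-- The function `(f')^s` on the circle. -/
noncomputable def jac (f : CircleDiffeo) (s : 𝕜) : CircleFun 𝕜 := pullback f s 1

/-- The composition with a diffeomorphism. -/
noncomputable def compLift (f : CircleDiffeo) : CircleFun 𝕜 →ₗ[𝕜] CircleFun 𝕜 := pullback f 0

/-- The function `f'' / f'`. -/
noncomputable def nonlin (f : CircleDiffeo) : CircleFun 𝕜 :=
  circleDeriv ⟨fun x => ((Real.log (deriv f.lift x) : ℝ) : 𝕜),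
    (RCLike.ofRealCLM (K := 𝕜)).contDiff.comp
      (((contDiff_infty_iff_deriv.1 f.contDiff_lift).2).log fun x => (f.deriv_pos x).ne'),
    fun x => by simp only [f.deriv_add_one x]⟩

section

variable (f : CircleDiffeo)

@[simp]
theorem jac_apply (s : 𝕜) (x : ℝ) : (jac f s).1 x = derivPow f s x := by
  simp [jac, pullback]

@[simp]
theorem compLift_apply (φ : CircleFun 𝕜) (x : ℝ) : (compLift f φ).1 x = φ.1 (f.lift x) := by
  simp [compLift, pullback, derivPow]

theorem pullback_eq (s : 𝕜) (φ : CircleFun 𝕜) : pullback f s φ = jac f s * compLift f φ := by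
  ext x
  change _ = (jac f s).1 x * (compLift f φ).1 x
  simp [pullback]

theorem derivPow_add (s t : 𝕜) (x : ℝ) :
    derivPow f (s + t) x = derivPow f s x * derivPow f t x := by
  simp only [derivPow, add_mul]
  exact NormedSpace.exp_add_of_commute (Commute.all _ _)

theorem jac_add (s t : 𝕜) : jac f (s + t) = jac f s * jac f t := by
  ext x
  change (jac f (s + t)).1 x = (jac f s).1 x * (jac f t).1 x
  simp [derivPow_add]

@[simp]
theorem jac_zero : jac f (0 : 𝕜) = 1 := by
  ext x
  change (jac f (0 : 𝕜)).1 x = 1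
  simp [derivPow]

theorem jac_neg_mul (s : 𝕜) : jac f (-s) * jac f s = 1 := by
  rw [← jac_add, neg_add_cancel, jac_zero]

theorem compLift_mul (φ ψ : CircleFun 𝕜) :
    compLift f (φ * ψ) = compLift f φ * compLift f ψ := by
  ext x
  change (compLift f (φ * ψ)).1 x = (compLift f φ).1 x * (compLift f ψ).1 x
  simp

@[simp]
theorem compLift_symm_compLift (φ : CircleFun 𝕜) : compLift f.symm (compLift f φ) = φ := by
  ext x
  simp [CircleDiffeo.symm]

@[simp]
theorem compLift_compLift_symm (φ : CircleFun 𝕜) : compLift f (compLift f.symm φ) = φ := by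
  ext x
  simp [CircleDiffeo.symm]

theorem compLift_injective : Function.Injective (compLift f : CircleFun 𝕜 →ₗ[𝕜] CircleFun 𝕜) :=
  fun a b h => by rw [← compLift_symm_compLift f a, h, compLift_symm_compLift]

theorem circleDeriv_jac (s : 𝕜) : circleDeriv (jac f s) = s • (nonlin f * jac f s) := by
  ext x
  have h1 : ContDiff ℝ ∞ fun x => ((Real.log (deriv f.lift x) : ℝ) : 𝕜) :=
    (RCLike.ofRealCLM (K := 𝕜)).contDiff.comp
      (((contDiff_infty_iff_deriv.1 f.contDiff_lift).2).log fun x => (f.deriv_pos x).ne')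
  have h2 := ((h1.differentiable (by simp) x).hasDerivAt).const_mul s
  have h3 : HasDerivAt (NormedSpace.exp : 𝕜 → 𝕜)
      (NormedSpace.exp (s * ((Real.log (deriv f.lift x) : ℝ) : 𝕜)))
      (s * ((Real.log (deriv f.lift x) : ℝ) : 𝕜)) := hasDerivAt_exp
  have h4 := (h3.comp x h2).deriv
  have h5 : ((jac f s).1 : ℝ → 𝕜) =
      NormedSpace.exp ∘ fun x => s * ((Real.log (deriv f.lift x) : ℝ) : 𝕜) := by
    ext y
    simp [derivPow]
  change deriv (jac f s).1 x = s * ((nonlin f).1 x * (jac f s).1 x)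
  rw [h5, h4]
  simp only [nonlin, circleDeriv, LinearMap.coe_mk, AddHom.coe_mk, Function.comp_apply]
  ring

theorem circleDeriv_one : circleDeriv (1 : CircleFun 𝕜) = 0 := by
  ext x
  exact deriv_const x 1

theorem circleDeriv_compLift (φ : CircleFun 𝕜) :
    circleDeriv (compLift f φ) = jac f 1 * compLift f (circleDeriv φ) := by
  have h : pullback f (0 : 𝕜) 1 = 1 := jac_zero f
  have h2 := circleDeriv_pullback f 0 φ
  rw [h, circleDeriv_one, zero_mul, zero_mul, zero_add] at h2
  exact h2

end

/-- The linear map from quadruples of coefficients to differential operators. -/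
noncomputable def coeffOp : (Fin 4 → CircleFun 𝕜) →ₗ[𝕜] (CircleFun 𝕜 →ₗ[𝕜] CircleFun 𝕜) where
  toFun a := ∑ i : Fin 4, LinearMap.mulLeft 𝕜 (a i) ∘ₗ (circleDeriv ^ (i : ℕ))
  map_add' a b := by
    rw [← Finset.sum_add_distrib]
    refine Finset.sum_congr rfl fun i _ => ?_
    ext1 φ
    simp [add_mul]
  map_smul' c a := by
    rw [RingHom.id_apply, Finset.smul_sum]
    refine Finset.sum_congr rfl fun i _ => ?_
    ext1 φ
    simp

theorem coeffOp_apply (a : Fin 4 → CircleFun 𝕜) (φ : CircleFun 𝕜) :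
    coeffOp a φ = a 0 * φ + a 1 * circleDeriv φ + a 2 * circleDeriv (circleDeriv φ) +
      a 3 * circleDeriv (circleDeriv (circleDeriv φ)) := by
  simp [coeffOp, Fin.sum_univ_four, pow_succ]

theorem diffOp_three_eq_coeffOp (a : ℕ → CircleFun 𝕜) :
    diffOp 3 a = coeffOp fun i : Fin 4 => a i := by
  simp only [diffOp, coeffOp, LinearMap.coe_mk, AddHom.coe_mk]
  exact Finset.sum_range fun i => LinearMap.mulLeft 𝕜 (a i) ∘ₗ (circleDeriv ^ i)

theorem coeffOp_mem (a : Fin 4 → CircleFun 𝕜) : coeffOp a ∈ diffOps 𝕜 3 := by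
  refine ⟨fun i => if h : i < 4 then a ⟨i, h⟩ else 0, ?_⟩
  rw [diffOp_three_eq_coeffOp]
  congr 1
  ext1 i
  simp [i.2]

namespace CircleFun

theorem circleDeriv_eventuallyEq {φ : CircleFun 𝕜} {q : ℝ → 𝕜} {x : ℝ} (h : φ.1 =ᶠ[𝓝 x] q) :
    (circleDeriv φ).1 =ᶠ[𝓝 x] deriv q := h.deriv

theorem circleDeriv_compLift_rotation (s : ℝ) (φ : CircleFun 𝕜) :
    circleDeriv (compLift (CircleDiffeo.rotation s) φ) =
      compLift (CircleDiffeo.rotation s) (circleDeriv φ) := by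
  rw [circleDeriv_compLift]
  have : jac (CircleDiffeo.rotation s) (1 : 𝕜) = 1 := by
    ext x
    change (jac (CircleDiffeo.rotation s) (1 : 𝕜)).1 x = 1
    have : deriv (CircleDiffeo.rotation s).lift x = 1 := by
      have : ((CircleDiffeo.rotation s).lift : ℝ → ℝ) = fun x => x + s := rfl
      rw [this]; simp
    simp [derivPow, this]
  rw [this, one_mul]

end CircleFun

theorem iteratedDeriv_ofReal_pow (n k : ℕ) : iteratedDeriv k (fun y : ℝ => (y : 𝕜) ^ n) =
    fun y : ℝ => (n.descFactorial k : 𝕜) * (y : 𝕜) ^ (n - k) := by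
  induction k with
  | zero => simp
  | succ k ih =>
    rw [iteratedDeriv_succ, ih]
    ext y
    have h1 : HasDerivAt (fun y : ℝ => (y : 𝕜)) 1 y := by
      simpa using (RCLike.ofRealCLM (K := 𝕜)).hasDerivAt (x := y)
    rw [((h1.fun_pow (n - k)).const_mul _).deriv, Nat.descFactorial_succ]
    push_cast
    rw [Nat.sub_sub]
    ring

theorem iteratedDeriv_ofReal_pow_zero (n k : ℕ) : iteratedDeriv k (fun y : ℝ => (y : 𝕜) ^ n) 0 =
    if k = n then (n.factorial : 𝕜) else 0 := by
  rw [iteratedDeriv_ofReal_pow]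
  rcases lt_trichotomy k n with h | rfl | h
  · simp [h.ne, Nat.sub_ne_zero_of_lt h]
  · simp [Nat.descFactorial_self]
  · simp [h.ne', Nat.descFactorial_of_lt h]

theorem derivPow_symm_mul (f : CircleDiffeo) (s : 𝕜) (x : ℝ) :
    derivPow f.symm s x * derivPow f s (f.symm.lift x) = 1 := by
  have h1 : HasDerivAt f.lift (deriv f.lift (f.lift.symm x)) (f.lift.symm x) :=
    (f.contDiff_lift.differentiable (by simp) _).hasDerivAt
  have h2 : HasDerivAt f.lift.symm (deriv f.lift.symm x) x :=
    (f.contDiff_symm.differentiable (by simp) _).hasDerivAt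
  have h3 := h1.comp x h2
  have h4 : (f.lift ∘ f.lift.symm) = id := by ext y; simp
  rw [h4] at h3
  have h5 := h3.unique (hasDerivAt_id x)
  simp only [derivPow, CircleDiffeo.symm]
  rw [← NormedSpace.exp_add_of_commute (Commute.all _ _), ← mul_add, ← RCLike.ofReal_add,
    ← Real.log_mul (show deriv f.lift.symm x ≠ 0 from (f.symm.deriv_pos x).ne')
      (f.deriv_pos _).ne', mul_comm (deriv _ _), h5]
  simp

theorem pullback_symm_pullback (f : CircleDiffeo) (s : 𝕜) (φ : CircleFun 𝕜) :
    pullback f.symm s (pullback f s φ) = φ := by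
  ext x
  change derivPow f.symm s x * (derivPow f s (f.symm.lift x) * φ.1 (f.lift (f.symm.lift x))) = _
  rw [← mul_assoc, derivPow_symm_mul, one_mul]
  simp [CircleDiffeo.symm]

/-- A test function with the germ (y - x)^i at x has only its i-th derivative nonzero at x, so it
isolates the i-th coefficient there. -/
theorem coeffOp_injective : Function.Injective (coeffOp (𝕜 := 𝕜)) := by
  rw [injective_iff_map_eq_zero]
  intro a ha
  have key : ∀ (n : ℕ) (x : ℝ), ∃ φ : CircleFun 𝕜, ∀ k, ((circleDeriv ^ k) φ).1 x =
      iteratedDeriv k (fun y : ℝ => (y : 𝕜) ^ n) 0 := by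
    intro n x
    have hq : ContDiff ℝ ∞ fun y : ℝ => (y : 𝕜) ^ n := RCLike.ofRealCLM.contDiff.pow n
    have h1 : ∀ k, ((circleDeriv ^ k) (CircleFun.ofGerm _ hq)).1 =ᶠ[𝓝 0]
        iteratedDeriv k (fun y : ℝ => (y : 𝕜) ^ n) := by
      intro k
      induction k with
      | zero => simpa using CircleFun.ofGerm_eventuallyEq _ hq
      | succ k ih =>
        rw [pow_succ', Module.End.mul_apply, iteratedDeriv_succ]
        exact CircleFun.circleDeriv_eventuallyEq ih
    refine ⟨compLift (CircleDiffeo.rotation (-x)) (CircleFun.ofGerm _ hq), fun k => ?_⟩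
    have h2 : (circleDeriv ^ k) (compLift (CircleDiffeo.rotation (-x)) (CircleFun.ofGerm _ hq)) =
        compLift (CircleDiffeo.rotation (-x)) ((circleDeriv ^ k) (CircleFun.ofGerm _ hq)) := by
      induction k with
      | zero => simp
      | succ k ih =>
        rw [pow_succ', Module.End.mul_apply, ih, CircleFun.circleDeriv_compLift_rotation]
        rfl
    rw [h2, compLift_apply, CircleDiffeo.rotation_lift, add_neg_cancel]
    exact (h1 k).self_of_nhds
  have h0 : ∀ (φ : CircleFun 𝕜) x, (a 0).1 x * φ.1 x + (a 1).1 x * ((circleDeriv ^ 1) φ).1 x +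
      (a 2).1 x * ((circleDeriv ^ 2) φ).1 x + (a 3).1 x * ((circleDeriv ^ 3) φ).1 x = 0 := by
    intro φ x
    have := congrArg (fun ψ : CircleFun 𝕜 => ψ.1 x) (LinearMap.congr_fun ha φ)
    rw [coeffOp_apply] at this
    exact this
  ext1 i
  ext x
  change (a i).1 x = 0
  obtain ⟨φ, hφ⟩ := key i x
  have h1 := h0 φ x
  have h2 := hφ 0
  rw [pow_zero, Module.End.one_apply] at h2
  rw [h2, hφ, hφ, hφ] at h1
  simp only [iteratedDeriv_ofReal_pow_zero] at h1
  fin_cases i <;> simpa [Nat.factorial] using h1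

/-- A third-order differential operator is the same as a quadruple of coefficients. -/
noncomputable def coeffEquiv : (Fin 4 → CircleFun 𝕜) ≃ₗ[𝕜] diffOps 𝕜 3 :=
  LinearEquiv.ofBijective (coeffOp.codRestrict _ coeffOp_mem)
    ⟨fun _ _ h => coeffOp_injective (congrArg Subtype.val h), by
      rintro ⟨_, a, rfl⟩
      exact ⟨fun i => a i, Subtype.ext (diffOp_three_eq_coeffOp a).symm⟩⟩

/-- The action of a diffeomorphism on quadruples of coefficients. -/
noncomputable def coeffAction (l m : 𝕜) (f : CircleDiffeo) : Module.End 𝕜 (Fin 4 → CircleFun 𝕜) :=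
  coeffEquiv.symm.toLinearMap ∘ₗ diffOpsAction 3 l m f ∘ₗ coeffEquiv.toLinearMap

/-- The coefficients of the operator `(f')^(-l) A (f')^l`, expressed through `d/dy` for `y = f(x)`;
powers of `f'` are left out. -/
noncomputable def transport (l : 𝕜) (f : CircleDiffeo) (a : Fin 4 → CircleFun 𝕜) :
    Fin 4 → CircleFun 𝕜 :=
  ![a 0 + l • (nonlin f * a 1) +
      l • ((circleDeriv (nonlin f) + l • (nonlin f * nonlin f)) * a 2) +
      l • ((circleDeriv (circleDeriv (nonlin f)) + (3 * l) • (nonlin f * circleDeriv (nonlin f)) +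
        (l * l) • (nonlin f * nonlin f * nonlin f)) * a 3),
    a 1 + (2 * l + 1) • (nonlin f * a 2) + ((3 * l + 1) • circleDeriv (nonlin f) +
      (3 * l * l + 3 * l + 1) • (nonlin f * nonlin f)) * a 3,
    a 2 + (3 * l + 3) • (nonlin f * a 3),
    a 3]

theorem coeffAction_eq (l m : 𝕜) (f : CircleDiffeo) (a b : Fin 4 → CircleFun 𝕜)
    (h : ∀ i : Fin 4, compLift f (b i) = jac f (l - m) * jac f 1 ^ (i : ℕ) * transport l f a i) :
    coeffAction l m f a = b := by
  have h1 : diffOpsAction 3 l m f (coeffEquiv a) = coeffEquiv b := by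
    apply Subtype.ext
    ext1 φ
    change pullback f.symm m (coeffOp a (pullback f l φ)) = coeffOp b φ
    -- Removing the outer pull-back leaves an identity between two Leibniz and chain rule
    -- expansions, polynomial in the jets of φ, of the coefficients and of f.
    rw [← pullback_symm_pullback f m (coeffOp b φ)]
    congr 1
    have hj : jac f m * jac f (l - m) = jac f l := by rw [← jac_add]; congr 1; ring
    simp only [coeffOp_apply, pullback_eq, map_add, compLift_mul, h, circleDeriv_mul,
      circleDeriv_jac, circleDeriv_compLift, map_smul]
    simp only [transport, Matrix.cons_val, Algebra.smul_def, map_add, map_mul, map_ofNat, map_one,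
      Fin.val_zero, Fin.val_one, Fin.val_two, one_mul,
      show ((3 : Fin 4) : ℕ) = 3 from rfl]
    simp only [← hj]
    ring
  change coeffEquiv.symm (diffOpsAction 3 l m f (coeffEquiv a)) = b
  rw [h1, LinearEquiv.symm_apply_apply]

end

/-! ### Constant-coefficient symmetries and the linear relations on their matrices. -/

section

theorem transport_zero (l : 𝕜) (f : CircleDiffeo) (a : Fin 4 → CircleFun 𝕜) :
    transport l f a 0 = a 0 + l • (nonlin f * a 1) +
      l • ((circleDeriv (nonlin f) + l • (nonlin f * nonlin f)) * a 2) +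
      l • ((circleDeriv (circleDeriv (nonlin f)) + (3 * l) • (nonlin f * circleDeriv (nonlin f)) +
        (l * l) • (nonlin f * nonlin f * nonlin f)) * a 3) := rfl

theorem transport_one (l : 𝕜) (f : CircleDiffeo) (a : Fin 4 → CircleFun 𝕜) :
    transport l f a 1 = a 1 + (2 * l + 1) • (nonlin f * a 2) +
      ((3 * l + 1) • circleDeriv (nonlin f) +
        (3 * l * l + 3 * l + 1) • (nonlin f * nonlin f)) * a 3 := rfl

theorem transport_two (l : 𝕜) (f : CircleDiffeo) (a : Fin 4 → CircleFun 𝕜) :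
    transport l f a 2 = a 2 + (3 * l + 3) • (nonlin f * a 3) := rfl

theorem transport_three (l : 𝕜) (f : CircleDiffeo) (a : Fin 4 → CircleFun 𝕜) :
    transport l f a 3 = a 3 := rfl

theorem compLift_coeffAction (l m : 𝕜) (f : CircleDiffeo) (a : Fin 4 → CircleFun 𝕜) (i : Fin 4) :
    compLift f (coeffAction l m f a i) =
      jac f (l - m) * jac f 1 ^ (i : ℕ) * transport l f a i := by
  rw [coeffAction_eq l m f a (fun i => compLift f.symm
    (jac f (l - m) * jac f 1 ^ (i : ℕ) * transport l f a i))]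
  · simp
  · simp

variable (𝕜) in
/-- The algebra of upper triangular `4 × 4` matrices. -/
def upperTri : Subalgebra 𝕜 (Matrix (Fin 4) (Fin 4) 𝕜) where
  carrier := {M | ∀ i j, j < i → M i j = 0}
  mul_mem' := by
    intro M N hM hN i j hij
    rw [Matrix.mul_apply]
    refine Finset.sum_eq_zero fun r _ => ?_
    rcases lt_or_ge r i with h | h
    · rw [hM i r h, zero_mul]
    · rw [hN r j (lt_of_lt_of_le hij h), mul_zero]
  add_mem' := fun hM hN i j hij => by simp [hM i j hij, hN i j hij]
  algebraMap_mem' := fun c i j hij => by simp [Matrix.algebraMap_matrix_apply, hij.ne']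

/-- The operator `a ↦ b` on quadruples of functions with `b i = ∑ j, t i j • a j ^ (j - i)`. -/
noncomputable def triOp : Matrix (Fin 4) (Fin 4) 𝕜 →ₗ[𝕜] Module.End 𝕜 (Fin 4 → CircleFun 𝕜) where
  toFun t :=
    { toFun := fun a i => ∑ j : Fin 4, t i j • (circleDeriv ^ ((j : ℕ) - i)) (a j)
      map_add' := fun a b => by
        ext1 i
        simp [Finset.sum_add_distrib]
      map_smul' := fun c a => by
        ext1 i
        simp [Finset.smul_sum, smul_comm c] }
  map_add' s t := by
    refine LinearMap.ext fun a => funext fun i => ?_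
    simp [add_smul, Finset.sum_add_distrib]
  map_smul' c t := by
    refine LinearMap.ext fun a => funext fun i => ?_
    simp [Finset.smul_sum, mul_smul]

theorem triOp_apply (t : Matrix (Fin 4) (Fin 4) 𝕜) (a : Fin 4 → CircleFun 𝕜) (i : Fin 4) :
    triOp t a i = ∑ j : Fin 4, t i j • (circleDeriv ^ ((j : ℕ) - i)) (a j) := rfl

/-- The orders of derivation add up: (j - i) + (k - j) = k - i. With truncated subtraction this
needs i ≤ j ≤ k, which triangularity provides. -/
theorem triOp_mul {s t : Matrix (Fin 4) (Fin 4) 𝕜} (hs : s ∈ upperTri 𝕜) (ht : t ∈ upperTri 𝕜) :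
    triOp (s * t) = triOp s * triOp t := by
  refine LinearMap.ext fun a => funext fun i => ?_
  simp only [Module.End.mul_apply, triOp_apply, Matrix.mul_apply, Finset.sum_smul, map_sum,
    map_smul, Finset.smul_sum]
  rw [Finset.sum_comm]
  refine Finset.sum_congr rfl fun j _ => Finset.sum_congr rfl fun k _ => ?_
  rcases lt_or_ge j i with h | h
  · simp [hs i j h]
  rcases lt_or_ge k j with h2 | h2
  · simp [ht j k h2]
  rw [← Module.End.mul_apply, ← pow_add, mul_smul]
  congr 4
  have : (i : ℕ) ≤ j := h
  have : (j : ℕ) ≤ k := h2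
  omega

theorem triOp_one : triOp (1 : Matrix (Fin 4) (Fin 4) 𝕜) = 1 := by
  refine LinearMap.ext fun a => funext fun i => ?_
  rw [triOp_apply, Finset.sum_eq_single i]
  · simp
  · intro j _ hj
    simp [Matrix.one_apply_ne' hj]
  · simp

/-- The action of upper triangular matrices on quadruples of functions. -/
noncomputable def triHom : upperTri 𝕜 →ₐ[𝕜] Module.End 𝕜 (Fin 4 → CircleFun 𝕜) :=
  AlgHom.ofLinearMap (triOp ∘ₗ (upperTri 𝕜).val.toLinearMap) triOp_one
    (fun s t => triOp_mul s.2 t.2)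

theorem triOp_apply_zero (t : Matrix (Fin 4) (Fin 4) 𝕜) (a : Fin 4 → CircleFun 𝕜) :
    triOp t a 0 = t 0 0 • a 0 + t 0 1 • circleDeriv (a 1) +
      t 0 2 • circleDeriv (circleDeriv (a 2)) +
      t 0 3 • circleDeriv (circleDeriv (circleDeriv (a 3))) := by
  simp [triOp_apply, Fin.sum_univ_four, pow_succ]

theorem triOp_apply_one {t : Matrix (Fin 4) (Fin 4) 𝕜} (ht : t ∈ upperTri 𝕜)
    (a : Fin 4 → CircleFun 𝕜) :
    triOp t a 1 = t 1 1 • a 1 + t 1 2 • circleDeriv (a 2) +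
      t 1 3 • circleDeriv (circleDeriv (a 3)) := by
  simp [triOp_apply, Fin.sum_univ_four, pow_succ, ht 1 0 (by decide)]

theorem triOp_apply_two {t : Matrix (Fin 4) (Fin 4) 𝕜} (ht : t ∈ upperTri 𝕜)
    (a : Fin 4 → CircleFun 𝕜) :
    triOp t a 2 = t 2 2 • a 2 + t 2 3 • circleDeriv (a 3) := by
  simp [triOp_apply, Fin.sum_univ_four, ht 2 0 (by decide), ht 2 1 (by decide)]

theorem triOp_apply_three {t : Matrix (Fin 4) (Fin 4) 𝕜} (ht : t ∈ upperTri 𝕜)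
    (a : Fin 4 → CircleFun 𝕜) : triOp t a 3 = t 3 3 • a 3 := by
  simp [triOp_apply, Fin.sum_univ_four, ht 3 0 (by decide), ht 3 1 (by decide),
    ht 3 2 (by decide)]

/-- The linear relations which characterize the matrices of the local symmetries. -/
structure SymmRel (l m : 𝕜) (t : Matrix (Fin 4) (Fin 4) 𝕜) : Prop where
  rel23 : 3 * (l + 1) * (t 2 2 - t 3 3) + (3 - (m - l)) * t 2 3 = 0
  rel12 : (2 * l + 1) * (t 1 1 - t 2 2) + (2 - (m - l)) * t 1 2 = 0
  rel13 : 3 * (l + 1) * t 1 2 + (5 - 2 * (m - l)) * t 1 3 - (2 * l + 1) * t 2 3 = 0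
  rel13' : (3 * l + 1) * (t 1 1 - t 3 3) + 3 * (l + 1) * t 1 2 + (3 - (m - l)) * t 1 3 = 0
  rel01 : l * (t 0 0 - t 1 1) + (1 - (m - l)) * t 0 1 = 0
  rel02 : (2 * l + 1) * t 0 1 + (3 - 2 * (m - l)) * t 0 2 - l * t 1 2 = 0
  rel02' : l * (t 0 0 - t 2 2) + (2 * l + 1) * t 0 1 + (2 - (m - l)) * t 0 2 = 0
  rel03 : 3 * (l + 1) * t 0 2 + (6 - 3 * (m - l)) * t 0 3 - l * t 1 3 = 0
  rel03' : (3 * l + 1) * t 0 1 + 6 * (l + 1) * t 0 2 + (8 - 3 * (m - l)) * t 0 3 - l * t 2 3 = 0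
  rel03'' : l * (t 0 0 - t 3 3) + (3 * l + 1) * t 0 1 + 3 * (l + 1) * t 0 2 +
    (3 - (m - l)) * t 0 3 = 0

theorem circleDeriv_jac_one_pow (f : CircleDiffeo) (k : ℕ) :
    circleDeriv (jac f (1 : 𝕜) ^ k) = (k : 𝕜) • (nonlin f * jac f 1 ^ k) := by
  induction k with
  | zero => simp [circleDeriv_one]
  | succ k ih =>
    rw [pow_succ, circleDeriv_mul, ih, circleDeriv_jac]
    push_cast
    simp only [Algebra.smul_def, map_add, map_one]
    ring

/-- The chain rule costs one factor f', so the power of `jac f 1` drops by one, and differentiating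
the factors of total weight s + k + 1 produces the term in `nonlin`. Iteration covers all
derivatives occurring in `triOp`. -/
theorem compLift_circleDeriv (f : CircleDiffeo) (s : 𝕜) (k : ℕ) {b c : CircleFun 𝕜}
    (h : compLift f b = jac f s * jac f 1 ^ (k + 1) * c) :
    compLift f (circleDeriv b) =
      jac f s * jac f 1 ^ k * (circleDeriv c + (s + (k + 1 : ℕ)) • (nonlin f * c)) := by
  have h1 : jac f (-1 : 𝕜) * jac f 1 = 1 := jac_neg_mul f 1
  have h3 := congrArg circleDeriv h
  rw [circleDeriv_compLift, circleDeriv_mul, circleDeriv_mul, circleDeriv_jac_one_pow,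
    circleDeriv_jac] at h3
  calc compLift f (circleDeriv b)
      = jac f (-1 : 𝕜) * (jac f 1 * compLift f (circleDeriv b)) := by rw [← mul_assoc, h1, one_mul]
    _ = _ := by
      rw [h3]
      simp only [Algebra.smul_def, map_add]
      linear_combination (jac f s * jac f 1 ^ k * (circleDeriv c +
        (algebraMap 𝕜 (CircleFun 𝕜) s + algebraMap 𝕜 (CircleFun 𝕜) (k + 1 : ℕ)) *
          (nonlin f * c))) * h1

namespace SymmRel

variable {l m : 𝕜} {t : Matrix (Fin 4) (Fin 4) 𝕜}

/-- This and the next four identities are the coefficients of the terms of degree two and three in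
`nonlin` in the equivariance defect. That they follow from the ten relations is natural: the terms
linear in `nonlin` express invariance under vector fields, and infinitesimal invariance integrates.
-/
theorem sq02 (h : SymmRel l m t) : l * l * (t 0 0 - t 2 2) + (2 * l + 1) * (1 - (m - l)) * t 0 1 +
    (1 - (m - l)) * (2 - (m - l)) * t 0 2 = 0 := by
  linear_combination (l / 2) * h.rel12 + (1 / 2 + l) * h.rel01 + (1 - (m - l) / 2) * h.rel02 -
    (1 / 2) * h.rel02'

theorem mul03 (h : SymmRel l m t) : 3 * l * l * (t 0 0 - t 3 3) +
    (6 * l * l + 9 * l + 3 - 3 * l * (m - l) - (m - l)) * t 0 1 +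
    (l + 1) * (15 - 9 * (m - l)) * t 0 2 +
    (15 - 14 * (m - l) + 3 * (m - l) * (m - l)) * t 0 3 = 0 := by
  linear_combination (-l / 2) * h.rel23 + (3 / 2 * l) * h.rel13' + (3 / 2 + 9 / 2 * l) * h.rel01 +
    (9 / 2 + 9 / 2 * l) * h.rel02 - (3 / 2 + 3 / 2 * l) * h.rel02' +
    (9 / 2 - 3 / 2 * (m - l)) * h.rel03 - (3 / 2 - 1 / 2 * (m - l)) * h.rel03'

theorem cube03 (h : SymmRel l m t) : l * l * l * (t 0 0 - t 3 3) +
    (3 * l * l + 3 * l + 1) * (1 - (m - l)) * t 0 1 +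
    3 * (l + 1) * (1 - (m - l)) * (2 - (m - l)) * t 0 2 +
    (1 - (m - l)) * (2 - (m - l)) * (3 - (m - l)) * t 0 3 = 0 := by
  linear_combination (1 / 6 * l + 1 / 3 * l * l) * h.rel23 + (1 / 2 * l + 1 / 2 * l * l) * h.rel12 +
    (1 / 2 * l - 1 / 6 * l * (m - l)) * h.rel13 - (1 / 2 * l) * h.rel13' + (l * l) * h.rel01 +
    (1 - (m - l) + l - l * (m - l)) * h.rel02 +
    (1 - 4 / 3 * (m - l) + 1 / 3 * (m - l) * (m - l)) * h.rel03

theorem sq03 (h : SymmRel l m t) : (3 * l * l + 3 * l + 1) * t 0 1 + (l + 1) * (9 - 6 * (m - l)) * t 0 2 +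
    (11 - 12 * (m - l) + 3 * (m - l) * (m - l)) * t 0 3 - l * l * t 2 3 = 0 := by
  linear_combination (l / 2) * h.rel13 + (3 / 2 + 3 / 2 * l) * h.rel02 +
    (5 / 2 - (m - l)) * h.rel03 - (1 / 2) * h.rel03'

theorem sq13 (h : SymmRel l m t) : (3 * l * l + 3 * l + 1) * (t 1 1 - t 3 3) + 3 * (l + 1) * (2 - (m - l)) * t 1 2 +
    (2 - (m - l)) * (3 - (m - l)) * t 1 3 = 0 := by
  linear_combination (1 / 2 + l) * h.rel23 + (3 / 2 + 3 / 2 * l) * h.rel12 +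
    (3 / 2 - (m - l) / 2) * h.rel13 - (1 / 2) * h.rel13'

end SymmRel

section

variable (l m : 𝕜) (t : Matrix (Fin 4) (Fin 4) 𝕜)

/-- The obstructions to the equivariance of `triOp t`, component `0`. -/
noncomputable def defectZero (f : CircleDiffeo) (a : Fin 4 → CircleFun 𝕜) : CircleFun 𝕜 :=
  (l * (t 0 0 - t 1 1) + (1 - (m - l)) * t 0 1) • (nonlin f * a 1) +
  ((2 * l + 1) * t 0 1 + (3 - 2 * (m - l)) * t 0 2 - l * t 1 2) • (nonlin f * circleDeriv (a 2)) +
  (l * (t 0 0 - t 2 2) + (2 * l + 1) * t 0 1 + (2 - (m - l)) * t 0 2) •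
    (circleDeriv (nonlin f) * a 2) +
  (3 * (l + 1) * t 0 2 + (6 - 3 * (m - l)) * t 0 3 - l * t 1 3) •
    (nonlin f * circleDeriv (circleDeriv (a 3))) +
  ((3 * l + 1) * t 0 1 + 6 * (l + 1) * t 0 2 + (8 - 3 * (m - l)) * t 0 3 - l * t 2 3) •
    (circleDeriv (nonlin f) * circleDeriv (a 3)) +
  (l * (t 0 0 - t 3 3) + (3 * l + 1) * t 0 1 + 3 * (l + 1) * t 0 2 + (3 - (m - l)) * t 0 3) •
    (circleDeriv (circleDeriv (nonlin f)) * a 3) +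
  (l * l * (t 0 0 - t 2 2) + (2 * l + 1) * (1 - (m - l)) * t 0 1 +
    (1 - (m - l)) * (2 - (m - l)) * t 0 2) • (nonlin f * nonlin f * a 2) +
  (3 * l * l * (t 0 0 - t 3 3) + (6 * l * l + 9 * l + 3 - 3 * l * (m - l) - (m - l)) * t 0 1 +
    (l + 1) * (15 - 9 * (m - l)) * t 0 2 + (15 - 14 * (m - l) + 3 * (m - l) * (m - l)) * t 0 3) •
    (nonlin f * circleDeriv (nonlin f) * a 3) +
  (l * l * l * (t 0 0 - t 3 3) + (3 * l * l + 3 * l + 1) * (1 - (m - l)) * t 0 1 +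
    3 * (l + 1) * (1 - (m - l)) * (2 - (m - l)) * t 0 2 +
    (1 - (m - l)) * (2 - (m - l)) * (3 - (m - l)) * t 0 3) •
    (nonlin f * nonlin f * nonlin f * a 3) +
  ((3 * l * l + 3 * l + 1) * t 0 1 + (l + 1) * (9 - 6 * (m - l)) * t 0 2 +
    (11 - 12 * (m - l) + 3 * (m - l) * (m - l)) * t 0 3 - l * l * t 2 3) •
    (nonlin f * nonlin f * circleDeriv (a 3))

/-- The obstructions to the equivariance of `triOp t`, component `1`. -/
noncomputable def defectOne (f : CircleDiffeo) (a : Fin 4 → CircleFun 𝕜) : CircleFun 𝕜 :=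
  ((2 * l + 1) * (t 1 1 - t 2 2) + (2 - (m - l)) * t 1 2) • (nonlin f * a 2) +
  (3 * (l + 1) * t 1 2 + (5 - 2 * (m - l)) * t 1 3 - (2 * l + 1) * t 2 3) •
    (nonlin f * circleDeriv (a 3)) +
  ((3 * l + 1) * (t 1 1 - t 3 3) + 3 * (l + 1) * t 1 2 + (3 - (m - l)) * t 1 3) •
    (circleDeriv (nonlin f) * a 3) +
  ((3 * l * l + 3 * l + 1) * (t 1 1 - t 3 3) + 3 * (l + 1) * (2 - (m - l)) * t 1 2 +
    (2 - (m - l)) * (3 - (m - l)) * t 1 3) • (nonlin f * nonlin f * a 3)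

/-- The obstruction to the equivariance of `triOp t`, component `2`. -/
noncomputable def defectTwo (f : CircleDiffeo) (a : Fin 4 → CircleFun 𝕜) : CircleFun 𝕜 :=
  (3 * (l + 1) * (t 2 2 - t 3 3) + (3 - (m - l)) * t 2 3) • (nonlin f * a 3)

/-- The obstructions to the equivariance of `triOp t`. -/
noncomputable def defect (f : CircleDiffeo) (a : Fin 4 → CircleFun 𝕜) : Fin 4 → CircleFun 𝕜 :=
  ![defectZero l m t f a, defectOne l m t f a, defectTwo l m t f a, 0]

end

/-- Valid for every upper triangular t, with the failure of equivariance collected in `defect`; it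
therefore serves for the sufficiency as well as for the necessity of the relations. -/
theorem compLift_triOp_coeffAction {l m : 𝕜} {t : Matrix (Fin 4) (Fin 4) 𝕜} (ht : t ∈ upperTri 𝕜)
    (f : CircleDiffeo) (a : Fin 4 → CircleFun 𝕜) (i : Fin 4) :
    compLift f (triOp t (coeffAction l m f a) i) = jac f (l - m) * jac f 1 ^ (i : ℕ) *
      (transport l f (triOp t a) i + defect l m t f a i) := by
  have hb1 := compLift_circleDeriv f (l - m) 0 (compLift_coeffAction l m f a 1)
  have hb2 := compLift_circleDeriv f (l - m) 1 (compLift_coeffAction l m f a 2)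
  have hb3 := compLift_circleDeriv f (l - m) 2 (compLift_coeffAction l m f a 3)
  have hb22 := compLift_circleDeriv f (l - m) 0 hb2
  have hb32 := compLift_circleDeriv f (l - m) 1 hb3
  have hb33 := compLift_circleDeriv f (l - m) 0 hb32
  obtain rfl | rfl | rfl | rfl : i = 0 ∨ i = 1 ∨ i = 2 ∨ i = 3 := by fin_cases i <;> simp
  · rw [triOp_apply_zero, map_add, map_add, map_add, map_smul, map_smul, map_smul, map_smul,
      hb1, hb22, hb33, compLift_coeffAction]
    simp only [transport_zero, transport_one, transport_two, transport_three,
      triOp_apply_zero, triOp_apply_one ht, triOp_apply_two ht, triOp_apply_three ht, map_add,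
      map_smul, circleDeriv_mul, zero_add, Nat.cast_ofNat, Nat.cast_one, Nat.reduceAdd]
    simp only [defect, defectZero, Matrix.cons_val, Algebra.smul_def, map_add, map_mul, map_ofNat,
      map_one, map_sub, Fin.val_zero]
    ring
  · rw [triOp_apply_one ht, map_add, map_add, map_smul, map_smul, map_smul,
      hb2, hb32, compLift_coeffAction]
    simp only [transport_one, transport_two, transport_three, triOp_apply_one ht,
      triOp_apply_two ht, triOp_apply_three ht, map_add, map_smul, circleDeriv_mul,
      Nat.cast_ofNat, Nat.reduceAdd]
    simp only [defect, defectOne, Matrix.cons_val, Algebra.smul_def, map_add, map_mul, map_ofNat,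
      map_one, map_sub, Fin.val_one]
    ring
  · rw [triOp_apply_two ht, map_add, map_smul, map_smul, hb3, compLift_coeffAction]
    simp only [transport_two, transport_three, triOp_apply_two ht, triOp_apply_three ht,
      Nat.cast_ofNat, Nat.reduceAdd]
    simp only [defect, defectTwo, Matrix.cons_val, Algebra.smul_def, map_add, map_mul, map_ofNat,
      map_one, map_sub, Fin.val_two]
    ring
  · rw [triOp_apply_three ht, map_smul, compLift_coeffAction]
    simp only [transport_three, triOp_apply_three ht, mul_smul_comm, defect, Matrix.cons_val,
      add_zero]

theorem triOp_coeffAction {l m : 𝕜} {t : Matrix (Fin 4) (Fin 4) 𝕜} (ht : t ∈ upperTri 𝕜)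
    (h : SymmRel l m t) (f : CircleDiffeo) (a : Fin 4 → CircleFun 𝕜) :
    triOp t (coeffAction l m f a) = coeffAction l m f (triOp t a) := by
  ext1 i
  apply compLift_injective f
  rw [compLift_coeffAction, compLift_triOp_coeffAction ht]
  have : defect l m t f a = 0 := by
    ext1 i
    fin_cases i
    · simp [defect, defectZero, h.rel01, h.rel02, h.rel02', h.rel03, h.rel03', h.rel03'', h.sq02,
        h.mul03, h.cube03, h.sq03]
    · simp [defect, defectOne, h.rel12, h.rel13, h.rel13', h.sq13]
    · simp [defect, defectTwo, h.rel23]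
    · rfl
  rw [this, Pi.zero_apply, add_zero]

end

/-! ### Diffeomorphisms supported near a point. -/

section

/-- The distance of a real number to the integers. -/
noncomputable def distInt (x : ℝ) : ℝ := |x - round x|

theorem distInt_le (x : ℝ) (n : ℤ) : distInt x ≤ |x - n| := round_le x n

theorem distInt_le_half (x : ℝ) : distInt x ≤ 1 / 2 := abs_sub_round x

theorem distInt_le_abs (x : ℝ) : distInt x ≤ |x| := by simpa using distInt_le x 0

theorem distInt_eq_abs {x : ℝ} (hx : |x| ≤ 1 / 2) : distInt x = |x| := by
  refine le_antisymm (distInt_le_abs x) ?_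
  unfold distInt
  by_cases h : round x = 0
  · simp [h]
  have h1 : (1 : ℝ) ≤ |(round x : ℝ)| := by exact_mod_cast Int.one_le_abs h
  have h2 := abs_sub_abs_le_abs_sub (round x : ℝ) x
  rw [abs_sub_comm] at h2
  linarith

theorem distInt_le_add (x y : ℝ) : distInt x ≤ distInt y + |x - y| := by
  refine (distInt_le x (round y)).trans ?_
  have := abs_sub_le x y (round y)
  unfold distInt
  linarith

theorem continuous_distInt : Continuous distInt := by
  refine (LipschitzWith.of_dist_le_mul (K := 1) fun x y => ?_).continuous
  rw [Real.dist_eq, Real.dist_eq, abs_le]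
  have h1 := distInt_le_add x y
  have h2 := distInt_le_add y x
  rw [abs_sub_comm] at h2
  simp only [NNReal.coe_one, one_mul]
  constructor <;> linarith

namespace CircleFun

theorem apply_eq_of_abs (φ : CircleFun 𝕜) {p : ℝ → Prop} {q : 𝕜 → Prop}
    (h : ∀ x, |x| ≤ 1 / 2 → p |x| → q (φ.1 x)) (x : ℝ) (hx : p (distInt x)) : q (φ.1 x) := by
  rw [← apply_sub_round]
  exact h _ (distInt_le_half x) hx

theorem exists_bump_distInt {r : ℝ} (hr : 0 < r) (hr2 : r < 1 / 2) : ∃ χ : CircleFun ℝ,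
    (∀ x, distInt x ≤ r / 2 → χ.1 x = 1) ∧ ∀ x, r ≤ distInt x → χ.1 x = 0 := by
  obtain ⟨χ, h1, h2⟩ := exists_bump hr hr2
  exact ⟨χ, apply_eq_of_abs χ (p := fun d => d ≤ r / 2) (q := fun y => y = 1)
      fun x _ h => h1 x h,
    apply_eq_of_abs χ (p := fun d => r ≤ d) (q := fun y => y = 0) h2⟩

end CircleFun

namespace CircleDiffeo

theorem exists_local (n : ℕ) {r : ℝ} (hr : 0 < r) (hr2 : r < 1 / 2) :
    ∀ᶠ ε : ℝ in 𝓝 0, ∃ f : CircleDiffeo, (f.lift =ᶠ[𝓝 0] fun x => x + ε * x ^ n) ∧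
      (∀ x, r / 2 < distInt x → f.lift =ᶠ[𝓝 x] id) ∧ ∀ x, |f.lift x - x| < r / 2 := by
  -- The cutoff vanishes once `distInt` reaches r/2. Later n = 1 supplies dilations, and n = 2, 3, 4
  -- a single prescribed jet at 0.
  obtain ⟨χ, h1, h2⟩ := CircleFun.exists_bump_distInt (half_pos hr) (by linarith)
  set u := χ * CircleFun.localCoord ^ n with hu
  have hu' : ∀ x, u.1 x = χ.1 x * CircleFun.localCoord.1 x ^ n := fun x => rfl
  obtain ⟨M, hM, hM2⟩ := CircleFun.exists_bound u
  have h3 : ∀ᶠ ε : ℝ in 𝓝 0, |ε| < r / 2 / M :=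
    (continuous_abs.tendsto' (0 : ℝ) 0 abs_zero).eventually (gt_mem_nhds (by positivity))
  filter_upwards [h3, CircleFun.eventually_smul_deriv_gt u] with ε hε hε2
  have hl : ∀ x, (perturb (ε • u) hε2).lift x = x + ε * u.1 x := fun x => rfl
  refine ⟨perturb (ε • u) hε2, ?_, fun x hx => ?_, fun x => ?_⟩
  · have h4 : ∀ᶠ x : ℝ in 𝓝 0, |x| < r / 2 / 2 :=
      (continuous_abs.tendsto' (0 : ℝ) 0 abs_zero).eventually (gt_mem_nhds (by positivity))
    filter_upwards [h4, CircleFun.localCoord_eventuallyEq] with x hx hx2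
    rw [hl, hu', hx2, h1 x ((distInt_le_abs x).trans hx.le), one_mul, id]
  · filter_upwards [(continuous_distInt.tendsto x).eventually (lt_mem_nhds hx)] with y hy
    rw [hl, hu', h2 y hy.le]
    simp
  · have h5 : |u.1 x| ≤ M := hM2 x
    rw [hl, add_sub_cancel_left, abs_mul]
    calc |ε| * |u.1 x| ≤ |ε| * M := by gcongr
      _ < r / 2 / M * M := by gcongr
      _ = r / 2 := by field_simp

variable (f : CircleDiffeo)

theorem nonlin_mul_jac : nonlin f * jac f (1 : 𝕜) = circleDeriv (jac f 1) := by
  rw [circleDeriv_jac, one_smul]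

theorem circleDeriv_pow_jac_apply (k : ℕ) (x : ℝ) : ((circleDeriv ^ k) (jac f (1 : 𝕜))).1 x =
    ((iteratedDeriv (k + 1) f.lift x : ℝ) : 𝕜) := by
  have h : ∃ ψ : CircleFun ℝ, jac f (1 : 𝕜) = CircleFun.ofReal ψ ∧ ψ.1 = deriv f.lift :=
    ⟨⟨deriv f.lift, (contDiff_infty_iff_deriv.1 f.contDiff_lift).2, f.deriv_add_one⟩, by
      ext x
      rw [jac_apply, derivPow_one]
      rfl, rfl⟩
  obtain ⟨ψ, h1, h2⟩ := h
  have h3 : (circleDeriv ^ k) (jac f (1 : 𝕜)) = CircleFun.ofReal ((circleDeriv ^ k) ψ) := by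
    induction k with
    | zero => simpa using h1
    | succ k ih =>
      rw [pow_succ', pow_succ', Module.End.mul_apply, ih, CircleFun.circleDeriv_ofReal]
      rfl
  have h4 : ((circleDeriv ^ k) ψ).1 = iteratedDeriv (k + 1) f.lift := by
    rw [iteratedDeriv_succ', ← h2]
    clear h3
    induction k with
    | zero => simp
    | succ k ih =>
      rw [pow_succ', Module.End.mul_apply, iteratedDeriv_succ, ← ih]
      rfl
  rw [h3, CircleFun.ofReal_apply, h4]

theorem derivPow_of_eventuallyEq {c s x : ℝ} (h : f.lift =ᶠ[𝓝 x] fun y => c * y + s) (w : 𝕜) :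
    ∀ᶠ y in 𝓝 x, derivPow f w y = NormedSpace.exp (w * ((Real.log c : ℝ) : 𝕜)) := by
  filter_upwards [h.deriv] with y hy
  have : deriv (fun y => c * y + s) y = c := by
    simp [deriv_const_mul_id']
  rw [derivPow, hy, this]

theorem nonlin_eventuallyEq {c s x : ℝ} (h : f.lift =ᶠ[𝓝 x] fun y => c * y + s) :
    (nonlin f : CircleFun 𝕜).1 =ᶠ[𝓝 x] 0 := by
  have h1 : (fun x => ((Real.log (deriv f.lift x) : ℝ) : 𝕜)) =ᶠ[𝓝 x]
      fun _ => ((Real.log c : ℝ) : 𝕜) := by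
    filter_upwards [h.deriv] with y hy
    rw [hy]
    simp [deriv_const_mul_id']
  have h2 := h1.deriv
  refine EventuallyEq.trans (f := deriv (fun x => ((Real.log (deriv f.lift x) : ℝ) : 𝕜))) h2 ?_
  filter_upwards with y
  simp

end CircleDiffeo

theorem circleDeriv_eventuallyEq_zero {φ : CircleFun 𝕜} {x : ℝ} (h : φ.1 =ᶠ[𝓝 x] 0) :
    (circleDeriv φ).1 =ᶠ[𝓝 x] 0 := by
  refine (CircleFun.circleDeriv_eventuallyEq h).trans ?_
  filter_upwards with y
  simp

theorem transport_apply_zero_eq (l : 𝕜) (f : CircleDiffeo) (a : Fin 4 → CircleFun 𝕜) (x : ℝ) :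
    (transport l f a 0).1 x = (a 0).1 x + l * ((nonlin f).1 x * (a 1).1 x) +
      l * (((circleDeriv (nonlin f)).1 x + l * ((nonlin f).1 x * (nonlin f).1 x)) * (a 2).1 x) +
      l * (((circleDeriv (circleDeriv (nonlin f))).1 x +
        (3 * l) * ((nonlin f).1 x * (circleDeriv (nonlin f)).1 x) +
        (l * l) * ((nonlin f).1 x * (nonlin f).1 x * (nonlin f).1 x)) * (a 3).1 x) := rfl

theorem transport_apply_one_eq (l : 𝕜) (f : CircleDiffeo) (a : Fin 4 → CircleFun 𝕜) (x : ℝ) :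
    (transport l f a 1).1 x = (a 1).1 x + (2 * l + 1) * ((nonlin f).1 x * (a 2).1 x) +
      ((3 * l + 1) * (circleDeriv (nonlin f)).1 x +
        (3 * l * l + 3 * l + 1) * ((nonlin f).1 x * (nonlin f).1 x)) * (a 3).1 x := rfl

theorem transport_apply_two_eq (l : 𝕜) (f : CircleDiffeo) (a : Fin 4 → CircleFun 𝕜) (x : ℝ) :
    (transport l f a 2).1 x = (a 2).1 x + (3 * l + 3) * ((nonlin f).1 x * (a 3).1 x) := rfl

theorem transport_apply_three_eq (l : 𝕜) (f : CircleDiffeo) (a : Fin 4 → CircleFun 𝕜) (x : ℝ) :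
    (transport l f a 3).1 x = (a 3).1 x := rfl

theorem transport_apply_of_affine {f : CircleDiffeo} {c s x : ℝ}
    (h : f.lift =ᶠ[𝓝 x] fun y => c * y + s) (l : 𝕜) (a : Fin 4 → CircleFun 𝕜) (i : Fin 4) :
    ∀ᶠ y in 𝓝 x, (transport l f a i).1 y = (a i).1 y := by
  have h1 := f.nonlin_eventuallyEq (𝕜 := 𝕜) h
  have h2 := circleDeriv_eventuallyEq_zero h1
  filter_upwards [h1, h2, circleDeriv_eventuallyEq_zero h2] with y h1 h2 h3
  fin_cases i
  · simp [transport_apply_zero_eq, h1, h2, h3]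
  · simp [transport_apply_one_eq, h1, h2]
  · simp [transport_apply_two_eq, h1]
  · simp [transport_apply_three_eq]

theorem coeffAction_apply (l m : 𝕜) (f : CircleDiffeo) (a : Fin 4 → CircleFun 𝕜) (i : Fin 4)
    (x : ℝ) : (coeffAction l m f a i).1 (f.lift x) =
      derivPow f (l - m) x * ((deriv f.lift x : ℝ) : 𝕜) ^ (i : ℕ) * (transport l f a i).1 x := by
  have h := congrArg (fun ψ : CircleFun 𝕜 => ψ.1 x) (compLift_coeffAction l m f a i)
  have h2 : (jac f (l - m) * jac f 1 ^ (i : ℕ) * transport l f a i).1 x =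
    (jac f (l - m)).1 x * (jac f 1).1 x ^ (i : ℕ) * (transport l f a i).1 x := rfl
  simp only [compLift_apply] at h
  rw [h, h2, jac_apply, jac_apply, derivPow_one]

theorem transport_apply_of_zero {f : CircleDiffeo} {x : ℝ} (l : 𝕜) {a : Fin 4 → CircleFun 𝕜}
    (h : ∀ i, (a i).1 x = 0) (i : Fin 4) : (transport l f a i).1 x = 0 := by
  fin_cases i
  · simp [transport_apply_zero_eq, h]
  · simp [transport_apply_one_eq, h]
  · simp [transport_apply_two_eq, h]
  · simp [transport_apply_three_eq, h]

/-- A diffeomorphism with support in a small interval fixes the operators vanishing there. -/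
theorem coeffAction_eq_self (l m : 𝕜) {f : CircleDiffeo} {a : Fin 4 → CircleFun 𝕜} {r : ℝ}
    (ha : ∀ i x, distInt x < r → (a i).1 x = 0)
    (h1 : ∀ x, r / 2 < distInt x → f.lift =ᶠ[𝓝 x] id) (h2 : ∀ x, |f.lift x - x| < r / 2) :
    coeffAction l m f a = a := by
  ext1 i
  ext y
  obtain ⟨x, rfl⟩ := f.lift.surjective y
  rw [coeffAction_apply]
  -- A point within r/2 of the integers moves by less than r/2, so both it and its image lie where a
  -- vanishes. Elsewhere f is the identity near x.
  rcases le_or_gt (distInt x) (r / 2) with h | h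
  · have h3 := distInt_le_add (f.lift x) x
    have h4 := h2 x
    have h5 : 0 ≤ |f.lift x - x| := abs_nonneg _
    rw [transport_apply_of_zero l (fun i => ha i x (by linarith)), ha i _ (by linarith), mul_zero]
  · have h3 : f.lift =ᶠ[𝓝 x] fun y => 1 * y + 0 := by simpa using! h1 x h
    have h4 : deriv f.lift x = 1 := by simpa using (h1 x h).deriv_eq
    have h5 : f.lift x = x := (h1 x h).self_of_nhds
    rw [(transport_apply_of_affine h3 l a i).self_of_nhds, h4, h5, derivPow, h4]
    simp

end

/-! ### Values at 0 of quadruples invariant under local diffeomorphisms. -/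

section

namespace CircleDiffeo

variable {f : CircleDiffeo}

theorem iteratedDeriv_lift_of_local {ε : ℝ} {n : ℕ} (h : f.lift =ᶠ[𝓝 0] fun x => x + ε * x ^ n)
    (k : ℕ) : iteratedDeriv k f.lift 0 =
      (if k = 1 then 1 else 0) + ε * if k = n then (n.factorial : ℝ) else 0 := by
  have h1 := iteratedDeriv_ofReal_pow_zero (𝕜 := ℝ) 1 k
  have h2 := iteratedDeriv_ofReal_pow_zero (𝕜 := ℝ) n k
  simp only [pow_one, Nat.factorial_one, Nat.cast_one, RCLike.ofReal_real_eq_id, id] at h1 h2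
  rw [h.iteratedDeriv_eq, iteratedDeriv_fun_add (by fun_prop) (by fun_prop), h1,
    iteratedDeriv_const_mul_field, h2]

/-- Differentiate the identity `nonlin f` · f' = f'' twice and evaluate at 0, where f' = 1. -/
theorem nonlin_jets (hf : deriv f.lift 0 = 1) :
    (nonlin f : CircleFun 𝕜).1 0 = ((iteratedDeriv 2 f.lift 0 : ℝ) : 𝕜) ∧
    (circleDeriv (nonlin f) : CircleFun 𝕜).1 0 = ((iteratedDeriv 3 f.lift 0 : ℝ) : 𝕜) -
      (nonlin f : CircleFun 𝕜).1 0 * ((iteratedDeriv 2 f.lift 0 : ℝ) : 𝕜) ∧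
    (circleDeriv (circleDeriv (nonlin f)) : CircleFun 𝕜).1 0 =
      ((iteratedDeriv 4 f.lift 0 : ℝ) : 𝕜) -
      2 * (circleDeriv (nonlin f) : CircleFun 𝕜).1 0 * ((iteratedDeriv 2 f.lift 0 : ℝ) : 𝕜) -
      (nonlin f : CircleFun 𝕜).1 0 * ((iteratedDeriv 3 f.lift 0 : ℝ) : 𝕜) := by
  have h0 := circleDeriv_pow_jac_apply (𝕜 := 𝕜) f 0 0
  have h1 := circleDeriv_pow_jac_apply (𝕜 := 𝕜) f 1 0
  have h2 := circleDeriv_pow_jac_apply (𝕜 := 𝕜) f 2 0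
  have h3 := circleDeriv_pow_jac_apply (𝕜 := 𝕜) f 3 0
  simp only [pow_succ, pow_zero, one_mul, Module.End.mul_apply, Module.End.one_apply, zero_add,
    iteratedDeriv_one, hf, RCLike.ofReal_one, Nat.reduceAdd] at h0 h1 h2 h3
  have e1 := nonlin_mul_jac (𝕜 := 𝕜) f
  have e2 := congrArg circleDeriv e1
  rw [circleDeriv_mul] at e2
  have e3 := congrArg circleDeriv e2
  rw [map_add, circleDeriv_mul, circleDeriv_mul] at e3
  have k1 : (nonlin f : CircleFun 𝕜).1 0 * (jac f (1 : 𝕜)).1 0 = (circleDeriv (jac f 1)).1 0 :=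
    congrArg (fun ψ : CircleFun 𝕜 => ψ.1 0) e1
  have k2 : (circleDeriv (nonlin f) : CircleFun 𝕜).1 0 * (jac f (1 : 𝕜)).1 0 +
      (nonlin f : CircleFun 𝕜).1 0 * (circleDeriv (jac f (1 : 𝕜))).1 0 =
      (circleDeriv (circleDeriv (jac f 1))).1 0 :=
    congrArg (fun ψ : CircleFun 𝕜 => ψ.1 0) e2
  have k3 : (circleDeriv (circleDeriv (nonlin f)) : CircleFun 𝕜).1 0 * (jac f (1 : 𝕜)).1 0 +
      (circleDeriv (nonlin f) : CircleFun 𝕜).1 0 * (circleDeriv (jac f (1 : 𝕜))).1 0 +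
      ((circleDeriv (nonlin f) : CircleFun 𝕜).1 0 * (circleDeriv (jac f (1 : 𝕜))).1 0 +
      (nonlin f : CircleFun 𝕜).1 0 * (circleDeriv (circleDeriv (jac f (1 : 𝕜)))).1 0) =
      (circleDeriv (circleDeriv (circleDeriv (jac f 1)))).1 0 :=
    congrArg (fun ψ : CircleFun 𝕜 => ψ.1 0) e3
  rw [h0, h1] at k1
  rw [h0, h1, h2] at k2
  rw [h0, h1, h2, h3] at k3
  exact ⟨by linear_combination k1, by linear_combination k2, by linear_combination k3⟩

theorem lift_zero_of_local {ε : ℝ} {n : ℕ} (hn : n ≠ 0)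
    (h : f.lift =ᶠ[𝓝 0] fun x => x + ε * x ^ n) : f.lift 0 = 0 := by
  rw [h.self_of_nhds]
  simp [hn]

theorem deriv_lift_of_local {ε : ℝ} {n : ℕ} (hn : 2 ≤ n)
    (h : f.lift =ᶠ[𝓝 0] fun x => x + ε * x ^ n) : deriv f.lift 0 = 1 := by
  rw [← iteratedDeriv_one, iteratedDeriv_lift_of_local h]
  simp [show 1 ≠ n by omega]

theorem nonlin_two {ε : ℝ} (h : f.lift =ᶠ[𝓝 0] fun x => x + ε * x ^ 2) :
    (nonlin f : CircleFun 𝕜).1 0 = 2 * (ε : 𝕜) := by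
  rw [(nonlin_jets (deriv_lift_of_local le_rfl h)).1, iteratedDeriv_lift_of_local h,
    if_neg (by norm_num), if_pos rfl, zero_add, RCLike.ofReal_mul, mul_comm]
  norm_num
  exact Or.inl (RCLike.ofReal_ofNat 2)

theorem nonlin_three {ε : ℝ} (h : f.lift =ᶠ[𝓝 0] fun x => x + ε * x ^ 3) :
    (nonlin f : CircleFun 𝕜).1 0 = 0 ∧ (circleDeriv (nonlin f) : CircleFun 𝕜).1 0 = 6 * (ε : 𝕜) := by
  obtain ⟨h1, h2, -⟩ := nonlin_jets (𝕜 := 𝕜) (deriv_lift_of_local (by norm_num) h)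
  rw [iteratedDeriv_lift_of_local h] at h1 h2
  norm_num at h1
  rw [h2, h1, if_neg (by norm_num), if_pos rfl, zero_add, RCLike.ofReal_mul, mul_comm]
  norm_num [Nat.factorial]
  exact Or.inl (RCLike.ofReal_ofNat 6)

theorem nonlin_four {ε : ℝ} (h : f.lift =ᶠ[𝓝 0] fun x => x + ε * x ^ 4) :
    (nonlin f : CircleFun 𝕜).1 0 = 0 ∧ (circleDeriv (nonlin f) : CircleFun 𝕜).1 0 = 0 ∧
      (circleDeriv (circleDeriv (nonlin f)) : CircleFun 𝕜).1 0 = 24 * (ε : 𝕜) := by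
  obtain ⟨h1, h2, h3⟩ := nonlin_jets (𝕜 := 𝕜) (deriv_lift_of_local (by norm_num) h)
  simp only [iteratedDeriv_lift_of_local h] at h1 h2 h3
  norm_num at h1
  rw [h1] at h2 h3
  norm_num at h2
  rw [h2] at h3
  refine ⟨h1, h2, ?_⟩
  rw [h3, if_neg (by norm_num), if_pos trivial, zero_add, RCLike.ofReal_mul, mul_comm (ε : 𝕜)]
  norm_num [Nat.factorial]
  exact Or.inl (RCLike.ofReal_ofNat 24)

end CircleDiffeo

/-- Invariance under the diffeomorphisms with support in a small neighbourhood of `0`. -/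
def LocallyInvariant (l m : 𝕜) (b : Fin 4 → CircleFun 𝕜) : Prop :=
  ∃ r, 0 < r ∧ r < 1 / 2 ∧ ∀ f : CircleDiffeo, (∀ x, r / 2 < distInt x → f.lift =ᶠ[𝓝 x] id) →
    (∀ x, |f.lift x - x| < r / 2) → coeffAction l m f b = b

/-- The function (1 + ε)^z takes the value 1 at ε = 0 with derivative z ≠ 0 there, so it does not
return to 1 nearby. This also covers imaginary z. -/
theorem exp_log_one_add_ne {z : 𝕜} (hz : z ≠ 0) :
    ∀ᶠ ε : ℝ in 𝓝[≠] 0, NormedSpace.exp (z * ((Real.log (1 + ε) : ℝ) : 𝕜)) ≠ 1 := by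
  have h1 : HasDerivAt (fun ε : ℝ => Real.log (1 + ε)) 1 0 := by
    simpa using ((hasDerivAt_id (0 : ℝ)).const_add 1).log (by simp)
  have h2 : HasDerivAt (fun ε : ℝ => z * ((Real.log (1 + ε) : ℝ) : 𝕜)) z 0 := by
    simpa using ((RCLike.ofRealCLM (K := 𝕜)).hasFDerivAt.comp_hasDerivAt (0 : ℝ) h1).const_mul z
  have h3 : HasDerivAt (NormedSpace.exp : 𝕜 → 𝕜) 1 (z * ((Real.log (1 + 0) : ℝ) : 𝕜)) := by
    simpa using hasDerivAt_exp_zero (𝕂 := 𝕜)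
  have h4 := HasDerivAt.comp (0 : ℝ) (h := fun ε : ℝ => z * ((Real.log (1 + ε) : ℝ) : 𝕜)) h3 h2
  exact h4.eventually_ne (by simpa using hz)

theorem exp_add_natCast_mul_log (z : 𝕜) (n : ℕ) {c : ℝ} (hc : 0 < c) :
    NormedSpace.exp ((z + n) * ((Real.log c : ℝ) : 𝕜)) =
      NormedSpace.exp (z * ((Real.log c : ℝ) : 𝕜)) * (c : 𝕜) ^ n := by
  rw [add_mul, NormedSpace.exp_add_of_commute (Commute.all _ _), ← nsmul_eq_mul,
    NormedSpace.exp_nsmul]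
  have h := NormedSpace.algebraMap_exp_comm (𝕂 := ℝ) (𝔸 := 𝕜) (Real.log c)
  rw [← Real.exp_eq_exp_ℝ, Real.exp_log hc] at h
  exact congrArg (fun y => _ * y ^ n) h.symm

theorem coeffAction_apply_of_scaling (l m : 𝕜) {f : CircleDiffeo} {c : ℝ} (hc : 0 < c)
    (h : f.lift =ᶠ[𝓝 0] fun x => c * x) (a : Fin 4 → CircleFun 𝕜) (i : Fin 4) :
    ∀ᶠ x in 𝓝 0, (coeffAction l m f a i).1 (c * x) =
      NormedSpace.exp ((l - m + i) * ((Real.log c : ℝ) : 𝕜)) * (a i).1 x := by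
  have h' : f.lift =ᶠ[𝓝 0] fun x => c * x + 0 := by simpa using h
  filter_upwards [h, h.deriv, f.derivPow_of_eventuallyEq h' (l - m),
    transport_apply_of_affine h' l a i] with x h1 h2 h3 h4
  have h5 : deriv (fun x => c * x) x = c := by simp [deriv_const_mul_id']
  rw [← h1, coeffAction_apply, h2, h5, h3, h4, exp_add_natCast_mul_log _ _ hc]

namespace LocallyInvariant

variable {l m : 𝕜} {b : Fin 4 → CircleFun 𝕜} (h : LocallyInvariant l m b)

include h in
theorem exists_diffeo (n : ℕ) : ∀ᶠ ε : ℝ in 𝓝 0, ∃ f : CircleDiffeo,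
    (f.lift =ᶠ[𝓝 0] fun x => x + ε * x ^ n) ∧ coeffAction l m f b = b := by
  obtain ⟨r, hr, hr2, H⟩ := h
  filter_upwards [CircleDiffeo.exists_local n hr hr2] with ε ⟨f, h1, h2, h3⟩
  exact ⟨f, h1, H f h2 h3⟩

include h in
theorem exists_scaling : ∀ᶠ ε : ℝ in 𝓝 0, ∀ i : Fin 4, ∀ᶠ x in 𝓝 0, (b i).1 ((1 + ε) * x) =
      NormedSpace.exp ((l - m + i) * ((Real.log (1 + ε) : ℝ) : 𝕜)) * (b i).1 x := by
  filter_upwards [h.exists_diffeo 1, eventually_gt_nhds (show (-1 : ℝ) < 0 by norm_num)]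
    with ε ⟨f, h1, h2⟩ h3 i
  have h4 : f.lift =ᶠ[𝓝 0] fun x => (1 + ε) * x := by
    filter_upwards [h1] with x hx
    rw [hx]; ring
  have h5 := coeffAction_apply_of_scaling l m (by linarith) h4 b i
  rwa [h2] at h5

include h in
-- A dilation by c fixes 0 and multiplies the value of the i-th component there by c^(l - m + i), a
-- nontrivial factor for suitable c close to 1.
theorem apply_zero_of_ne (i : Fin 4) (hi : m - l ≠ i) : (b i).1 0 = 0 := by
  have hz : l - m + i ≠ 0 := fun h0 => hi (by linear_combination -h0)
  have h1 := (h.exists_scaling.filter_mono nhdsWithin_le_nhds).and (exp_log_one_add_ne hz)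
  obtain ⟨ε, h2, h3⟩ := h1.exists
  have h4 := (h2 i).self_of_nhds
  rw [mul_zero] at h4
  by_contra h5
  exact h3 (mul_right_cancel₀ h5 (by rw [one_mul, ← h4]))

include h in
-- Here the scaling exponent is zero, so the component is invariant under a dilation near 0, while
-- its derivative at 0 gets multiplied by 1 + ε ≠ 1.
theorem circleDeriv_apply_zero (i : Fin 4) (hi : m - l = i) : (circleDeriv (b i)).1 0 = 0 := by
  have hz : l - m + i = 0 := by rw [← hi]; ring
  obtain ⟨ε, h2, h3⟩ := ((h.exists_scaling.filter_mono nhdsWithin_le_nhds).and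
    (self_mem_nhdsWithin (a := (0 : ℝ)) (s := {0}ᶜ))).exists
  have h4 : (fun x => (b i).1 ((1 + ε) * x)) =ᶠ[𝓝 0] (b i).1 := by
    filter_upwards [h2 i] with x hx
    rw [hx, hz]
    simp
  have h5 := h4.deriv_eq
  have h6 : deriv (fun x => (b i).1 ((1 + ε) * x)) 0 = (1 + ε) • deriv (b i).1 0 := by
    rw [deriv_comp_mul_left, mul_zero]
  rw [h6, add_smul, one_smul, add_eq_left] at h5
  exact (smul_eq_zero.1 h5).resolve_left h3

include h in
theorem transport_apply_zero (n : ℕ) (hn : 2 ≤ n) : ∃ ε : ℝ, (ε : 𝕜) ≠ 0 ∧ ∃ f : CircleDiffeo,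
    (f.lift =ᶠ[𝓝 0] fun x => x + ε * x ^ n) ∧
      ∀ i : Fin 4, (transport l f b i).1 0 = (b i).1 0 := by
  obtain ⟨ε, ⟨f, h1, h2⟩, h3⟩ := (((h.exists_diffeo n).filter_mono nhdsWithin_le_nhds).and
    (self_mem_nhdsWithin (a := (0 : ℝ)) (s := {0}ᶜ))).exists
  refine ⟨ε, by exact_mod_cast h3, f, h1, fun i => ?_⟩
  have h4 := coeffAction_apply l m f b i 0
  have h5 := CircleDiffeo.deriv_lift_of_local hn h1
  rw [h2, CircleDiffeo.lift_zero_of_local (by omega) h1, derivPow, h5] at h4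
  simpa using h4.symm

include h in
-- By weights at most one component survives at 0. The germs x + εx² and x + εx³ would move it to
-- lower components, with coefficients proportional to l for i = 1, to 2l + 1 and l for i = 2, and
-- to 3l + 3 and 3l + 1 for i = 3. All of them must vanish, which is possible only for i = 1, l = 0.
theorem apply_zero (i : Fin 4) (h0 : ¬(i = 0 ∧ l = m)) (h1 : ¬(i = 1 ∧ l = 0 ∧ m = 1)) :
    (b i).1 0 = 0 := by
  by_cases hi : m - l = i
  swap
  · exact h.apply_zero_of_ne i hi
  have hj : ∀ j : Fin 4, j ≠ i → (b j).1 0 = 0 := by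
    intro j hj
    apply h.apply_zero_of_ne
    rw [hi]
    intro h2
    exact hj (Fin.ext (by exact_mod_cast h2.symm))
  obtain ⟨ε, hε, f, hf, H⟩ := h.transport_apply_zero 2 le_rfl
  obtain ⟨ε', hε', f', hf', H'⟩ := h.transport_apply_zero 3 (by norm_num)
  have n2 := CircleDiffeo.nonlin_two (𝕜 := 𝕜) hf
  have n3 := CircleDiffeo.nonlin_three (𝕜 := 𝕜) hf'
  by_contra hb
  obtain rfl | rfl | rfl | rfl : i = 0 ∨ i = 1 ∨ i = 2 ∨ i = 3 := by fin_cases i <;> simp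
  · exact h0 ⟨rfl, by simpa [sub_eq_zero, eq_comm] using hi⟩
  · have H0 := H 0
    rw [transport_apply_zero_eq, n2, hj 0 (by decide), hj 2 (by decide), hj 3 (by decide)] at H0
    have : l = 0 := by simpa [hε, hb] using H0
    subst this
    exact h1 ⟨rfl, rfl, by simpa using hi⟩
  · have H0 := H 1
    have H1 := H' 0
    rw [transport_apply_one_eq, n2, hj 1 (by decide), hj 3 (by decide)] at H0
    rw [transport_apply_zero_eq, n3.1, n3.2, hj 0 (by decide), hj 1 (by decide),
      hj 3 (by decide)] at H1
    have e1 : 2 * l + 1 = 0 := by simpa [hε, hb] using H0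
    have e2 : l = 0 := by simpa [hε', hb] using H1
    rw [e2] at e1
    norm_num at e1
  · have H0 := H 2
    have H1 := H' 1
    rw [transport_apply_two_eq, n2, hj 2 (by decide)] at H0
    rw [transport_apply_one_eq, n3.1, n3.2, hj 1 (by decide), hj 2 (by decide)] at H1
    have e1 : 3 * l + 3 = 0 := by simpa [hε, hb] using H0
    have e2 : 3 * l + 1 = 0 := by simpa [hε', hb] using H1
    have : (2 : 𝕜) = 0 := by linear_combination e1 - e2
    norm_num at this

end LocallyInvariant

end

/-! ### Functionals of germs that are homogeneous under a contraction. -/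

section

theorem circleDeriv_pow_eventuallyEq {φ : CircleFun 𝕜} {q : ℝ → 𝕜} {x : ℝ}
    (h : φ.1 =ᶠ[𝓝 x] q) (k : ℕ) : ((circleDeriv ^ k) φ).1 =ᶠ[𝓝 x] iteratedDeriv k q := by
  induction k with
  | zero => simpa using h
  | succ k ih =>
    rw [pow_succ', Module.End.mul_apply, iteratedDeriv_succ]
    exact CircleFun.circleDeriv_eventuallyEq ih

theorem iteratedDeriv_coe (φ : CircleFun 𝕜) (k : ℕ) :
    iteratedDeriv k φ.1 = ((circleDeriv ^ k) φ).1 := by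
  ext x
  exact ((circleDeriv_pow_eventuallyEq (EventuallyEq.refl (𝓝 x) φ.1) k).self_of_nhds).symm

/-- The solution is the series of r^k p(c^k x). Periodicity bounds each derivative of p on the whole
line, so all derived series are dominated by geometric ones. -/
theorem exists_scaling_series {r c : ℝ} (hr : 0 < r) (hr1 : r < 1) (hc : 0 < c) (hc1 : c < 1)
    (p : CircleFun 𝕜) : ∃ q : ℝ → 𝕜, ContDiff ℝ ∞ q ∧ ∀ x, q x - r • q (c * x) = p.1 x := by
  have hsum := summable_geometric_of_lt_one hr.le hr1
  choose M hM0 hM using fun n => CircleFun.exists_bound ((circleDeriv ^ n) p)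
  have hb : ∀ n k x, ‖iteratedDeriv n (fun x => r ^ k • p.1 (c ^ k * x)) x‖ ≤
      r ^ k * M n := by
    intro n k x
    have h1 : iteratedDeriv n (fun x => r ^ k • p.1 (c ^ k * x)) x =
        r ^ k • (c ^ k) ^ n • iteratedDeriv n p.1 (c ^ k * x) := by
      rw [iteratedDeriv_fun_const_smul_field]
      rw [iteratedDeriv_comp_const_smul (p.2.1.of_le (by exact_mod_cast le_top)) (c ^ k)]
    rw [h1, iteratedDeriv_coe, norm_smul, norm_smul, Real.norm_of_nonneg (by positivity),
      Real.norm_of_nonneg (by positivity)]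
    gcongr
    calc (c ^ k) ^ n * ‖((circleDeriv ^ n) p).1 (c ^ k * x)‖
        ≤ 1 * M n := by
          gcongr
          · exact pow_le_one₀ (by positivity) (pow_le_one₀ hc.le hc1.le)
          · exact hM n _
      _ = _ := one_mul _
  have hs : ∀ x, Summable fun k => r ^ k • p.1 (c ^ k * x) := fun x =>
    Summable.of_norm_bounded (hsum.mul_right (M 0)) fun k => by
      simpa using! hb 0 k x
  refine ⟨fun x => ∑' k, r ^ k • p.1 (c ^ k * x), ?_, fun x => ?_⟩
  · refine contDiff_tsum (v := fun n k => r ^ k * M n)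
      (fun k => (p.2.1.comp (contDiff_const.mul contDiff_id)).const_smul _)
      (fun n _ => hsum.mul_right _) fun n k x _ => ?_
    rw [norm_iteratedFDeriv_eq_norm_iteratedDeriv]
    exact hb n k x
  · change (∑' k, r ^ k • p.1 (c ^ k * x)) - r • (∑' k, r ^ k • p.1 (c ^ k * (c * x))) = p.1 x
    rw [(hs x).tsum_eq_zero_add, ← (hs _).tsum_const_smul]
    simp [pow_succ', mul_smul, mul_assoc, mul_left_comm]

/-- The cohomological equation of a contraction is solvable for flat data. -/
theorem exists_cohomological {c : ℝ} (hc : 0 < c) (hc1 : c < 1) (N : ℕ) :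
    ∀ (w : ℤ) (_ : w < N) (p : CircleFun 𝕜) (_ : ∀ k < N, ((circleDeriv ^ k) p).1 0 = 0),
    ∃ q : ℝ → 𝕜, ContDiff ℝ ∞ q ∧ ∀ x, q x - c ^ (-w) • q (c * x) = p.1 x := by
  induction N with
  | zero =>
    intro w hw p _
    -- For N = 0 the weight w is negative, and the geometric series converges without any flatness.
    have h1 : c ^ (-w) < 1 := by
      obtain ⟨n, hn⟩ := Int.eq_ofNat_of_zero_le (show 0 ≤ -w by push_cast at hw; linarith)
      rw [hn, zpow_natCast]
      exact pow_lt_one₀ hc.le hc1 (by rintro rfl; push_cast at hw hn; omega)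
    exact exists_scaling_series (zpow_pos hc _) h1 hc hc1 p
  | succ N ih =>
    intro w hw p hp
    -- Differentiating the equation multiplies the second term by c, which lowers the weight by one.
    -- The equation is solved for p' and integrated from 0; no constant is left over because p(0) =
    -- 0.
    obtain ⟨q, hq, h⟩ := ih (w - 1) (by push_cast at hw; linarith) (circleDeriv p) (fun k hk => by
      rw [← Module.End.mul_apply, ← pow_succ]
      exact hp (k + 1) (by omega))
    have hd : ∀ x, HasDerivAt (fun x => ∫ y in (0 : ℝ)..x, q y) (q x) x := fun x =>
      hq.continuous.integral_hasStrictDerivAt 0 x |>.hasDerivAt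
    refine ⟨fun x => ∫ y in (0 : ℝ)..x, q y, ?_, fun x => ?_⟩
    · rw [contDiff_infty_iff_deriv]
      refine ⟨fun x => (hd x).differentiableAt, ?_⟩
      rwa [funext fun x => (hd x).deriv]
    · have h1 : ∀ x, HasDerivAt (fun x => (∫ y in (0 : ℝ)..x, q y) -
          c ^ (-w) • (∫ y in (0 : ℝ)..(c * x), q y) - p.1 x) 0 x := by
        intro x
        have h2 : HasDerivAt (fun x => c * x) c x := by simpa using (hasDerivAt_id x).const_mul c
        have h3 := ((hd x).sub (((hd (c * x)).scomp x h2).const_smul (c ^ (-w)))).sub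
          (p.2.1.differentiable (by simp) x).hasDerivAt
        refine h3.congr_deriv ?_
        rw [smul_smul, ← zpow_add_one₀ hc.ne', show -w + 1 = -(w - 1) by ring, h x]
        exact sub_self _
      have h5 := is_const_of_deriv_eq_zero (fun x => (h1 x).differentiableAt)
        (fun x => (h1 x).deriv) x 0
      have h6 : p.1 0 = 0 := hp 0 (by omega)
      simp only [mul_zero, intervalIntegral.integral_same, smul_zero, h6, sub_zero] at h5
      exact sub_eq_zero.1 h5

/-- The functions with the germ `x ^ n` at `0`. -/
noncomputable def monomialGerm (n : ℕ) : CircleFun 𝕜 :=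
  CircleFun.ofGerm (fun y : ℝ => (y : 𝕜) ^ n) ((RCLike.ofRealCLM (K := 𝕜)).contDiff.pow n)

theorem monomialGerm_eventuallyEq (n : ℕ) :
    (monomialGerm n : CircleFun 𝕜).1 =ᶠ[𝓝 0] fun y : ℝ => (y : 𝕜) ^ n :=
  CircleFun.ofGerm_eventuallyEq _ _

theorem circleDeriv_pow_monomialGerm (n k : ℕ) :
    ((circleDeriv ^ k) (monomialGerm n : CircleFun 𝕜)).1 0 =
      if k = n then (n.factorial : 𝕜) else 0 := by
  rw [(circleDeriv_pow_eventuallyEq (monomialGerm_eventuallyEq n) k).self_of_nhds,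
    iteratedDeriv_ofReal_pow_zero]

section homogeneous

variable {Λ : CircleFun 𝕜 →ₗ[𝕜] 𝕜} {c : ℝ} {w : ℤ} (hc : 0 < c) (hc1 : c < 1)
  (hloc : ∀ p : CircleFun 𝕜, p.1 =ᶠ[𝓝 0] 0 → Λ p = 0)
  (hscal : ∀ p p' : CircleFun 𝕜, (∀ᶠ x in 𝓝 0, p'.1 x = p.1 (c * x)) →
    Λ p' = ((c ^ w : ℝ) : 𝕜) * Λ p)

include hc hc1 hscal

/-- The monomial is an eigenvector of the contraction with eigenvalue c^k, whereas the functional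
scales by c^w ≠ c^k. -/
theorem homogeneous_apply_monomial {k : ℕ} (hk : w ≠ k) : Λ (monomialGerm k) = 0 := by
  have h1 := monomialGerm_eventuallyEq (𝕜 := 𝕜) k
  have h2 := hscal (monomialGerm k) (((c ^ k : ℝ) : 𝕜) • monomialGerm k) (by
    have h4 : Tendsto (fun x => c * x) (𝓝 0) (𝓝 0) :=
      Continuous.tendsto' (by fun_prop) _ _ (by simp)
    filter_upwards [h4.eventually h1, h1] with x h5 h6
    change ((c ^ k : ℝ) : 𝕜) * (monomialGerm k : CircleFun 𝕜).1 x = _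
    rw [h5, h6]
    push_cast
    ring)
  rw [map_smul, smul_eq_mul] at h2
  by_contra h3
  have h4 := RCLike.ofReal_injective (mul_right_cancel₀ h3 h2)
  rw [← zpow_natCast] at h4
  exact hk ((zpow_right_injective₀ hc hc1.ne h4).symm)

include hloc

/-- Near 0 the function is a coboundary q(x) - c^(-w) q(c x), and homogeneity makes the two
contributions cancel. This replaces any continuity assumption on the functional. -/
theorem homogeneous_apply_flat {N : ℕ} (hN : w < N) {p : CircleFun 𝕜}
    (hp : ∀ k < N, ((circleDeriv ^ k) p).1 0 = 0) : Λ p = 0 := by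
  obtain ⟨q, hq, h⟩ := exists_cohomological hc hc1 N w hN p hp
  have hq' : ContDiff ℝ ∞ fun x => q (c * x) := hq.comp (contDiff_const.mul contDiff_id)
  have h1 := CircleFun.ofGerm_eventuallyEq q hq
  have h2 := CircleFun.ofGerm_eventuallyEq _ hq'
  have h3 := hscal (CircleFun.ofGerm q hq) (CircleFun.ofGerm _ hq') (by
    have h4 : Tendsto (fun x => c * x) (𝓝 0) (𝓝 0) :=
      Continuous.tendsto' (by fun_prop) _ _ (by simp)
    filter_upwards [h4.eventually h1, h2] with x h5 h6
    rw [h5, h6])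
  have h7 := hloc (p - (CircleFun.ofGerm q hq - ((c ^ (-w) : ℝ) : 𝕜) • CircleFun.ofGerm _ hq')) (by
    filter_upwards [h1, h2] with x h5 h6
    have h8 := h x
    rw [Algebra.smul_def] at h8
    change p.1 x - ((CircleFun.ofGerm q hq).1 x - ((c ^ (-w) : ℝ) : 𝕜) *
      (CircleFun.ofGerm _ hq').1 x) = 0
    rw [h5, h6, ← h8]
    exact sub_self _)
  have h9 : ((c ^ (-w) : ℝ) : 𝕜) * ((c ^ w : ℝ) : 𝕜) = 1 := by
    rw [← RCLike.ofReal_mul, ← zpow_add₀ hc.ne']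
    simp
  rw [map_sub, map_sub, map_smul, h3, smul_eq_mul, ← mul_assoc, h9, one_mul, sub_self,
    sub_zero] at h7
  exact h7

theorem homogeneous_of_neg (hw : w < 0) : Λ = 0 := by
  ext p
  exact homogeneous_apply_flat hc hc1 hloc hscal (N := 0) (by simpa using hw) (by simp)

/-- Subtracting the Taylor polynomial of degree n leaves a flat function, which is killed; among the
monomials only the one of degree n contributes. -/
theorem homogeneous_apply {n : ℕ} (hw : w = n) (p : CircleFun 𝕜) :
    Λ p = Λ (monomialGerm n) / n.factorial * ((circleDeriv ^ n) p).1 0 := by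
  have h1 := homogeneous_apply_flat hc hc1 hloc hscal (N := n + 1) (by rw [hw]; simp)
    (p := p - ∑ k ∈ Finset.range (n + 1),
      (((circleDeriv ^ k) p).1 0 / k.factorial) • monomialGerm k) (by
    intro k hk
    rw [map_sub, map_sum]
    change ((circleDeriv ^ k) p).1 0 - (∑ j ∈ Finset.range (n + 1), _ : CircleFun 𝕜).1 0 = 0
    rw [AddSubmonoidClass.coe_finsetSum, Finset.sum_apply, Finset.sum_eq_single k]
    · rw [map_smul]
      change _ - _ * ((circleDeriv ^ k) (monomialGerm k : CircleFun 𝕜)).1 0 = 0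
      rw [circleDeriv_pow_monomialGerm, if_pos rfl,
        div_mul_cancel₀ _ (by exact_mod_cast k.factorial_ne_zero), sub_self]
    · intro j _ hj
      rw [map_smul]
      change _ * ((circleDeriv ^ k) (monomialGerm j : CircleFun 𝕜)).1 0 = 0
      rw [circleDeriv_pow_monomialGerm, if_neg hj.symm, mul_zero]
    · intro hk'
      exact absurd (Finset.mem_range.2 hk) hk')
  rw [map_sub, map_sum, Finset.sum_eq_single n, sub_eq_zero] at h1
  · rw [h1, map_smul, smul_eq_mul]
    ring
  · intro k _ hk
    rw [map_smul, homogeneous_apply_monomial hc hc1 hscal (by rw [hw]; exact_mod_cast hk.symm),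
      smul_zero]
  · simp

end homogeneous

end

/-! ### From locality to differential operators with constant coefficients. -/

section

theorem coeffAction_rotation (l m : 𝕜) (s : ℝ) (a : Fin 4 → CircleFun 𝕜) (i : Fin 4) :
    coeffAction l m (CircleDiffeo.rotation s) a i = compLift (CircleDiffeo.rotation (-s)) (a i) := by
  ext y
  obtain ⟨x, rfl⟩ := (CircleDiffeo.rotation s).lift.surjective y
  have h1 : (CircleDiffeo.rotation s).lift =ᶠ[𝓝 x] fun y => 1 * y + s := by
    filter_upwards with y
    simp
  have h2 : deriv (CircleDiffeo.rotation s).lift x = 1 := by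
    rw [h1.deriv_eq]
    simp
  rw [coeffAction_apply, (transport_apply_of_affine h1 l a i).self_of_nhds, h2, derivPow, h2,
    compLift_apply]
  simp

theorem circleDeriv_pow_compLift_rotation (s : ℝ) (k : ℕ) (φ : CircleFun 𝕜) :
    (circleDeriv ^ k) (compLift (CircleDiffeo.rotation s) φ) =
      compLift (CircleDiffeo.rotation s) ((circleDeriv ^ k) φ) := by
  induction k with
  | zero => simp
  | succ k ih =>
    rw [pow_succ', Module.End.mul_apply, ih, CircleFun.circleDeriv_compLift_rotation]
    rfl

theorem exists_scaling : ∃ c : ℝ, 0 < c ∧ c < 1 ∧ ∃ f : CircleDiffeo,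
    f.lift =ᶠ[𝓝 0] fun x => c * x := by
  have h1 := (CircleDiffeo.exists_local 1 (show (0 : ℝ) < 1 / 4 by norm_num)
    (by norm_num)).filter_mono (nhdsWithin_le_nhds (s := Set.Iio 0))
  have h2 : ∀ᶠ ε : ℝ in 𝓝[<] 0, -1 < ε :=
    (eventually_gt_nhds (show (-1 : ℝ) < 0 by norm_num)).filter_mono nhdsWithin_le_nhds
  obtain ⟨ε, ⟨⟨f, hf, -, -⟩, h3⟩, h4⟩ := ((h1.and h2).and self_mem_nhdsWithin).exists
  refine ⟨1 + ε, by linarith, by simpa using h4, f, ?_⟩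
  filter_upwards [hf] with x hx
  rw [hx]
  ring

theorem exists_distInt_of_eventuallyEq {a : Fin 4 → CircleFun 𝕜}
    (ha : ∀ i, (a i).1 =ᶠ[𝓝 0] 0) :
    ∃ r, 0 < r ∧ r < 1 / 2 ∧ ∀ i x, distInt x < r → (a i).1 x = 0 := by
  have h1 : ∀ᶠ x in 𝓝 (0 : ℝ), ∀ i, (a i).1 x = 0 := eventually_all.2 ha
  obtain ⟨r, hr, h2⟩ := Metric.eventually_nhds_iff.1 h1
  refine ⟨min r (1 / 4), by positivity, (min_le_right _ _).trans_lt (by norm_num), fun i => ?_⟩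
  refine CircleFun.apply_eq_of_abs (a i) (p := fun d => d < min r (1 / 4)) (q := fun y => y = 0)
    fun x _ hx => h2 ?_ i
  rw [Real.dist_eq, sub_zero]
  exact hx.trans_le (min_le_left _ _)

variable {l m : 𝕜} {T : Module.End 𝕜 (Fin 4 → CircleFun 𝕜)}
  (hT : ∀ f a, T (coeffAction l m f a) = coeffAction l m f (T a))

include hT

theorem locallyInvariant_of_commute {a : Fin 4 → CircleFun 𝕜} (ha : ∀ i, (a i).1 =ᶠ[𝓝 0] 0) :
    LocallyInvariant l m (T a) := by
  obtain ⟨r, hr, hr2, h⟩ := exists_distInt_of_eventuallyEq ha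
  refine ⟨r, hr, hr2, fun f h1 h2 => ?_⟩
  rw [← hT, coeffAction_eq_self l m h h1 h2]

/-- A symmetry which is local, in the component `i` after `k` derivations, is homogeneous. -/
theorem exists_coeff_of_local {i : Fin 4} {k : ℕ} (hL : ∀ b : Fin 4 → CircleFun 𝕜,
    LocallyInvariant l m b → ((circleDeriv ^ k) (b i)).1 0 = 0) (j : Fin 4) :
    ∃ τ : 𝕜, ((j : ℕ) + k < i → τ = 0) ∧ ∀ p, (circleDeriv ^ k) (T (Pi.single j p) i) =
      τ • (circleDeriv ^ ((j : ℕ) + k - i)) p := by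
  obtain ⟨c, hc, hc1, f, hf⟩ := exists_scaling
  let Λ : CircleFun 𝕜 →ₗ[𝕜] 𝕜 :=
    { toFun := fun p => ((circleDeriv ^ k) (T (Pi.single j p) i)).1 0
      map_add' := fun p q => by
        rw [Pi.single_add, map_add, Pi.add_apply, map_add]
        rfl
      map_smul' := fun s p => by
        rw [Pi.single_smul, map_smul, Pi.smul_apply, map_smul]
        rfl }
  have hΛ : ∀ a : Fin 4 → CircleFun 𝕜, (∀ i, (a i).1 =ᶠ[𝓝 0] 0) →
      ((circleDeriv ^ k) (T a i)).1 0 = 0 := fun a ha =>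
    hL _ (locallyInvariant_of_commute hT ha)
  have hloc : ∀ p : CircleFun 𝕜, p.1 =ᶠ[𝓝 0] 0 → Λ p = 0 := by
    intro p hp
    refine hΛ _ fun i => ?_
    by_cases hi : i = j
    · subst hi; simpa using hp
    · rw [Pi.single_eq_of_ne hi]; rfl
  -- Acting by the contraction sends p' in slot j to A c^j p near 0, with A = c^(l - m). On the
  -- image side component i gains A c^i, and k derivations at 0 cost c^k. The factor A cancels,
  -- which leaves the integer weight j + k - i.
  have hscal : ∀ p p' : CircleFun 𝕜, (∀ᶠ x in 𝓝 0, p'.1 x = p.1 (c * x)) →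
      Λ p' = ((c ^ ((j : ℤ) + k - i) : ℝ) : 𝕜) * Λ p := by
    intro p p' hp
    have hev : ∀ P : ℝ → Prop, (∀ᶠ x in 𝓝 0, P (c * x)) → ∀ᶠ y in 𝓝 0, P y := by
      intro P hP
      have h1 : Tendsto (fun y => y / c) (𝓝 0) (𝓝 0) :=
        Continuous.tendsto' (by fun_prop) _ _ (by simp)
      filter_upwards [h1.eventually hP] with y hy
      rwa [mul_div_cancel₀ _ hc.ne'] at hy
    set A := NormedSpace.exp ((l - m) * ((Real.log c : ℝ) : 𝕜)) with hA
    set b := coeffAction l m f (Pi.single j p') with hb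
    have h1 : ((circleDeriv ^ k) (T b i)).1 0 = A * (c : 𝕜) ^ (j : ℕ) * Λ p := by
      have h2 := hΛ (b - (A * (c : 𝕜) ^ (j : ℕ)) • (Pi.single j p : Fin 4 → CircleFun 𝕜)) fun i' => by
        refine hev (fun y => (b i' - (A * (c : 𝕜) ^ (j : ℕ)) •
          (Pi.single j p : Fin 4 → CircleFun 𝕜) i').1 y = 0) ?_
        filter_upwards [coeffAction_apply_of_scaling l m hc hf (Pi.single j p') i', hp] with x h1 h2
        change (b i').1 (c * x) - (A * (c : 𝕜) ^ (j : ℕ)) *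
          ((Pi.single j p : Fin 4 → CircleFun 𝕜) i').1 (c * x) = 0
        rw [hb, h1, exp_add_natCast_mul_log _ _ hc]
        by_cases hi : i' = j
        · subst hi
          rw [Pi.single_eq_same, Pi.single_eq_same, h2, sub_self]
        · rw [Pi.single_eq_of_ne hi, Pi.single_eq_of_ne hi]
          simp
      rw [map_sub, map_smul, Pi.sub_apply, Pi.smul_apply, map_sub, map_smul] at h2
      exact sub_eq_zero.1 h2
    have h2 : (c : 𝕜) ^ k * ((circleDeriv ^ k) (T b i)).1 0 = A * (c : 𝕜) ^ (i : ℕ) * Λ p' := by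
      have h3 : (fun x => (T b i).1 (c * x)) =ᶠ[𝓝 0]
          fun x => A * (c : 𝕜) ^ (i : ℕ) * (T (Pi.single j p') i).1 x := by
        filter_upwards [coeffAction_apply_of_scaling l m hc hf (T (Pi.single j p')) i] with x h1
        rw [hb, hT, h1, exp_add_natCast_mul_log _ _ hc]
      have h4 := h3.iteratedDeriv_eq k
      rw [iteratedDeriv_comp_const_smul ((T b i).2.1.of_le (by exact_mod_cast le_top)),
        iteratedDeriv_const_mul_field, iteratedDeriv_coe, iteratedDeriv_coe] at h4
      simp only [mul_zero] at h4
      rw [Algebra.smul_def, map_pow] at h4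
      exact h4
    rw [h1] at h2
    have h3 : A ≠ 0 := (NormedSpace.isUnit_exp _).ne_zero
    have h4 : (c : 𝕜) ≠ 0 := by exact_mod_cast hc.ne'
    rw [zpow_sub₀ hc.ne', zpow_add₀ hc.ne', zpow_natCast, zpow_natCast, zpow_natCast]
    push_cast
    field_simp
    refine mul_left_cancel₀ h3 ?_
    linear_combination -h2
  -- Rotations commute with T and with d/dx, so the formula at 0 holds at every point with the same
  -- constant.
  have hrot : ∀ τ : 𝕜, (∀ p, Λ p = τ * ((circleDeriv ^ ((j : ℕ) + k - i)) p).1 0) → ∀ p,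
      (circleDeriv ^ k) (T (Pi.single j p) i) = τ • (circleDeriv ^ ((j : ℕ) + k - i)) p := by
    intro τ h p
    ext x
    have h1 := h (compLift (CircleDiffeo.rotation x) p)
    have h2 : Pi.single j (compLift (CircleDiffeo.rotation x) p) =
        coeffAction l m (CircleDiffeo.rotation (-x)) (Pi.single j p) := by
      ext1 i
      rw [coeffAction_rotation, neg_neg]
      by_cases hi : i = j
      · subst hi; simp
      · simp [hi]
    simp only [Λ, LinearMap.coe_mk, AddHom.coe_mk] at h1
    rw [h2, hT, coeffAction_rotation, neg_neg, circleDeriv_pow_compLift_rotation,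
      circleDeriv_pow_compLift_rotation, compLift_apply, compLift_apply,
      CircleDiffeo.rotation_lift, zero_add] at h1
    exact h1
  by_cases hw : (j : ℕ) + k < i
  · refine ⟨0, fun _ => rfl, hrot 0 fun p => ?_⟩
    rw [homogeneous_of_neg hc hc1 hloc hscal (by omega)]
    simp
  · exact ⟨_, fun h => absurd h hw, hrot _ fun p =>
      homogeneous_apply hc hc1 hloc hscal (n := (j : ℕ) + k - i) (by omega) p⟩

end

/-! ### The matrix of a symmetry and its residual functional. -/

section

theorem exists_local_ne_zero (n : ℕ) : ∃ ε : ℝ, (ε : 𝕜) ≠ 0 ∧ ∃ f : CircleDiffeo,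
    f.lift =ᶠ[𝓝 0] fun x => x + ε * x ^ n := by
  obtain ⟨ε, ⟨f, h1, -, -⟩, h3⟩ := (((CircleDiffeo.exists_local n
    (show (0 : ℝ) < 1 / 4 by norm_num) (by norm_num)).filter_mono nhdsWithin_le_nhds).and
    (self_mem_nhdsWithin (a := (0 : ℝ)) (s := {0}ᶜ))).exists
  exact ⟨ε, by exact_mod_cast h3, f, h1⟩

theorem monomialGerm_jets (n : ℕ) :
    (monomialGerm n : CircleFun 𝕜).1 0 = (if 0 = n then (n.factorial : 𝕜) else 0) ∧
    (circleDeriv (monomialGerm n : CircleFun 𝕜)).1 0 =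
      (if 1 = n then (n.factorial : 𝕜) else 0) ∧
    (circleDeriv (circleDeriv (monomialGerm n : CircleFun 𝕜))).1 0 =
      if 2 = n then (n.factorial : 𝕜) else 0 := by
  have h0 := circleDeriv_pow_monomialGerm (𝕜 := 𝕜) n 0
  have h1 := circleDeriv_pow_monomialGerm (𝕜 := 𝕜) n 1
  have h2 := circleDeriv_pow_monomialGerm (𝕜 := 𝕜) n 2
  exact ⟨h0, h1, h2⟩

section defect

variable {l m : 𝕜} {t : Matrix (Fin 4) (Fin 4) 𝕜}

theorem defect_apply_eq_zero {f : CircleDiffeo} {a : Fin 4 → CircleFun 𝕜} {x : ℝ}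
    (ha : ∀ i, (a i).1 =ᶠ[𝓝 x] 0) (i : Fin 4) : (defect l m t f a i).1 x = 0 := by
  have h0 : ∀ i, (a i).1 x = 0 := fun i => (ha i).self_of_nhds
  have h1 : ∀ i, (circleDeriv (a i)).1 x = 0 := fun i =>
    (circleDeriv_eventuallyEq_zero (ha i)).self_of_nhds
  have h2 : ∀ i, (circleDeriv (circleDeriv (a i))).1 x = 0 := fun i =>
    (circleDeriv_eventuallyEq_zero (circleDeriv_eventuallyEq_zero (ha i))).self_of_nhds
  fin_cases i
  · simp [defect, defectZero, h0, h1, h2]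
  · simp [defect, defectOne, h0, h1]
  · simp [defect, defectTwo, h0]
  · rfl

/-- The germs x + εx², x + εx³, x + εx⁴ make exactly one of `nonlin`, its first and its second
derivative the leading nonzero jet at 0. Combined with a monomial germ in a single slot, each choice
leaves one term of the defect. -/
theorem symmRel_of_defect_eq_zero (h : ∀ f a, defect l m t f a = 0) : SymmRel l m t := by
  obtain ⟨ε, hε, f, hf⟩ := exists_local_ne_zero (𝕜 := 𝕜) 2
  obtain ⟨ε3, hε3, f3, hf3⟩ := exists_local_ne_zero (𝕜 := 𝕜) 3
  obtain ⟨ε4, hε4, f4, hf4⟩ := exists_local_ne_zero (𝕜 := 𝕜) 4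
  have n2 := CircleDiffeo.nonlin_two (𝕜 := 𝕜) hf
  obtain ⟨n3, n3'⟩ := CircleDiffeo.nonlin_three (𝕜 := 𝕜) hf3
  obtain ⟨n4, n4', n4''⟩ := CircleDiffeo.nonlin_four (𝕜 := 𝕜) hf4
  obtain ⟨p0, p0', p0''⟩ := monomialGerm_jets (𝕜 := 𝕜) 0
  obtain ⟨p1, p1', p1''⟩ := monomialGerm_jets (𝕜 := 𝕜) 1
  obtain ⟨p2, p2', p2''⟩ := monomialGerm_jets (𝕜 := 𝕜) 2
  simp only [Nat.factorial] at p0 p0' p0'' p1 p1' p1'' p2 p2' p2''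
  have H : ∀ f a i, (defect l m t f a i).1 0 = 0 := fun f a i => by rw [h]; rfl
  have a1 := H f (Pi.single 1 (monomialGerm 0)) 0
  have a2 := H f (Pi.single 2 (monomialGerm 1)) 0
  have a3 := H f3 (Pi.single 2 (monomialGerm 0)) 0
  have a4 := H f (Pi.single 3 (monomialGerm 2)) 0
  have a5 := H f3 (Pi.single 3 (monomialGerm 1)) 0
  have a6 := H f4 (Pi.single 3 (monomialGerm 0)) 0
  have b1 := H f (Pi.single 2 (monomialGerm 0)) 1
  have b2 := H f (Pi.single 3 (monomialGerm 1)) 1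
  have b3 := H f3 (Pi.single 3 (monomialGerm 0)) 1
  have b4 := H f (Pi.single 3 (monomialGerm 0)) 2
  simp [defect, defectZero, n2, n3, n3', n4, n4', n4'', p0, p0', p0'', p1, p1', p1'', p2,
    p2', p2'', hε, hε3, hε4] at a1 a2 a3 a4 a5 a6
  simp [defect, defectOne, defectTwo, n2, n3, n3', p0, p0', p1, p1', hε, hε3] at b1 b2 b3 b4
  exact ⟨b4, b1, b2, b3, a1, a2, a3, a4, a5, a6⟩

end defect

theorem eq_triOp_add {T : Module.End 𝕜 (Fin 4 → CircleFun 𝕜)} {t : Matrix (Fin 4) (Fin 4) 𝕜}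
    (i : Fin 4) (h : ∀ j p, T (Pi.single j p) i = t i j • (circleDeriv ^ ((j : ℕ) - i)) p)
    (a : Fin 4 → CircleFun 𝕜) : T a i = triOp t a i := by
  conv_lhs => rw [← Finset.univ_sum_single a]
  rw [map_sum, Finset.sum_apply, triOp_apply]
  exact Finset.sum_congr rfl fun j _ => h j (a j)

theorem eq_smul_one_of_circleDeriv_eq_zero {φ : CircleFun 𝕜} (h : circleDeriv φ = 0) :
    φ = φ.1 0 • 1 := by
  ext x
  have h1 : ∀ x, deriv φ.1 x = 0 := fun x => congrArg (fun ψ : CircleFun 𝕜 => ψ.1 x) h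
  have h2 := is_const_of_deriv_eq_zero (φ.2.1.differentiable (by simp)) h1 x 0
  change φ.1 x = φ.1 0 * 1
  rw [h2, mul_one]

/-- The function φ(x) - τx is constant; comparing its values at 0 and 1 gives τ = 0 by periodicity.
-/
theorem eq_zero_of_circleDeriv_eq_smul_one {φ : CircleFun 𝕜} {τ : 𝕜}
    (h : circleDeriv φ = τ • 1) : τ = 0 := by
  have h1 : ∀ x, deriv φ.1 x = τ := fun x => by
    have := congrArg (fun ψ : CircleFun 𝕜 => ψ.1 x) h
    exact this.trans (mul_one τ)
  have h2 : ∀ x : ℝ, HasDerivAt (fun x : ℝ => φ.1 x - (x : 𝕜) * τ) 0 x := fun x => by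
    have h3 : HasDerivAt (fun y : ℝ => (y : 𝕜)) 1 x := by
      simpa using (RCLike.ofRealCLM (K := 𝕜)).hasDerivAt (x := x)
    have h4 := (φ.2.1.differentiable (by simp) x).hasDerivAt.sub (h3.mul_const τ)
    refine h4.congr_deriv ?_
    rw [h1, one_mul, sub_self]
  have h5 := is_const_of_deriv_eq_zero (fun x => (h2 x).differentiableAt)
    (fun x => (h2 x).deriv) (0 + 1) 0
  have h6 := φ.2.2 0
  simp only [h6] at h5
  simpa using h5

variable {l m : 𝕜} {T : Module.End 𝕜 (Fin 4 → CircleFun 𝕜)}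
  (hT : ∀ f a, T (coeffAction l m f a) = coeffAction l m f (T a))

theorem jac_mul_cancel (f : CircleDiffeo) (i : ℕ) (w : 𝕜) {φ ψ : CircleFun 𝕜}
    (h : jac f w * jac f 1 ^ i * φ = jac f w * jac f 1 ^ i * ψ) : φ = ψ := by
  have h1 := jac_neg_mul f w
  have h2 : jac f (-1 : 𝕜) ^ i * jac f 1 ^ i = 1 := by rw [← mul_pow, jac_neg_mul, one_pow]
  calc φ = (jac f (-w) * jac f w) * (jac f (-1) ^ i * jac f 1 ^ i) * φ := by
        rw [h1, h2, one_mul, one_mul]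
    _ = jac f (-w) * jac f (-1) ^ i * (jac f w * jac f 1 ^ i * φ) := by ring
    _ = (jac f (-w) * jac f w) * (jac f (-1) ^ i * jac f 1 ^ i) * ψ := by rw [h]; ring
    _ = ψ := by rw [h1, h2, one_mul, one_mul]

theorem defect_eq_zero_of_commute {t : Matrix (Fin 4) (Fin 4) 𝕜} (ht : t ∈ upperTri 𝕜)
    {f : CircleDiffeo} {a : Fin 4 → CircleFun 𝕜} (i : Fin 4)
    (h : triOp t (coeffAction l m f a) i = coeffAction l m f (triOp t a) i) :
    defect l m t f a i = 0 := by
  have h1 := compLift_triOp_coeffAction ht f a i (l := l) (m := m)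
  rw [h, compLift_coeffAction] at h1
  simpa using jac_mul_cancel f i _ h1

include hT

theorem exists_triOp_of_generic (hlm : l ≠ m) (h01 : ¬(l = 0 ∧ m = 1)) :
    ∃ t ∈ upperTri 𝕜, SymmRel l m t ∧ T = triOp t := by
  have h : ∀ i j : Fin 4, ∃ τ : 𝕜, ((j : ℕ) + 0 < i → τ = 0) ∧ ∀ p,
      (circleDeriv ^ 0) (T (Pi.single j p) i) = τ • (circleDeriv ^ ((j : ℕ) + 0 - i)) p :=
    fun i j => exists_coeff_of_local hT (fun b hb =>
      hb.apply_zero i (fun h => hlm h.2) (fun h => h01 h.2)) j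
  choose t ht0 ht using h
  have hup : (Matrix.of t) ∈ upperTri 𝕜 := fun i j hij => ht0 i j hij
  have hTt : T = triOp (Matrix.of t) := LinearMap.ext fun a => funext fun i =>
    eq_triOp_add i (ht i) a
  refine ⟨_, hup, symmRel_of_defect_eq_zero fun f a => funext fun i => ?_, hTt⟩
  apply defect_eq_zero_of_commute hup
  rw [← hTt, hT]

/-- The coefficients of the operator `d^i/dx^i`. -/
abbrev unitCoeff (i : Fin 4) : Fin 4 → CircleFun 𝕜 := Pi.single i 1

omit hT in
theorem unitCoeff_same (i : Fin 4) : (unitCoeff i : Fin 4 → CircleFun 𝕜) i = 1 :=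
  Pi.single_eq_same i 1

omit hT in
theorem unitCoeff_of_ne {i j : Fin 4} (h : j ≠ i) :
    (unitCoeff i : Fin 4 → CircleFun 𝕜) j = 0 :=
  Pi.single_eq_of_ne h 1

/-- The two cases with an invariant operator: the identity and `d/dx`. -/
def HasInvariant (l m : 𝕜) (i : Fin 4) : Prop := (i = 0 ∧ l = m) ∨ (i = 1 ∧ l = 0 ∧ m = 1)

omit hT in
theorem HasInvariant.coeffAction_single {i : Fin 4} (hi : HasInvariant l m i) (f : CircleDiffeo) :
    coeffAction l m f (unitCoeff i) = unitCoeff i := by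
  have h1 : compLift f (1 : CircleFun 𝕜) = 1 := jac_zero f
  apply coeffAction_eq
  intro j
  rcases hi with ⟨rfl, rfl⟩ | ⟨rfl, rfl, rfl⟩
  · obtain rfl | rfl | rfl | rfl : j = 0 ∨ j = 1 ∨ j = 2 ∨ j = 3 := by fin_cases j <;> simp
    · simp [transport_zero, h1]
    · simp [transport_one]
    · simp [transport_two]
    · simp [transport_three]
  · obtain rfl | rfl | rfl | rfl : j = 0 ∨ j = 1 ∨ j = 2 ∨ j = 3 := by fin_cases j <;> simp
    · simp [transport_zero]
    · simp [transport_one, h1, jac_neg_mul]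
    · simp [transport_two]
    · simp [transport_three]

/-- In the component of the invariant operator only the derivative of T a is known to be local.
Hence T is a differential operator there up to a constant function, and this constant is L(a). -/
theorem exists_triOp_add_of_hasInvariant {i : Fin 4} (hi : HasInvariant l m i) :
    ∃ t ∈ upperTri 𝕜, ∃ L : (Fin 4 → CircleFun 𝕜) →ₗ[𝕜] 𝕜, ∀ a,
      T a = triOp t a + L a • unitCoeff i := by
  have h1 : ∀ i' j : Fin 4, i' ≠ i → ∃ τ : 𝕜, ((j : ℕ) + 0 < i' → τ = 0) ∧ ∀ p,
      (circleDeriv ^ 0) (T (Pi.single j p) i') = τ • (circleDeriv ^ ((j : ℕ) + 0 - i')) p := by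
    intro i' j hi'
    refine exists_coeff_of_local hT (fun b hb => ?_) j
    have hlm : (0 : 𝕜) ≠ 1 := zero_ne_one
    refine hb.apply_zero i' ?_ ?_
    · rintro ⟨rfl, rfl⟩
      rcases hi with ⟨rfl, -⟩ | ⟨-, rfl, h⟩
      · exact hi' rfl
      · exact hlm h
    · rintro ⟨rfl, rfl, rfl⟩
      rcases hi with ⟨-, h⟩ | ⟨rfl, -⟩
      · exact hlm h
      · exact hi' rfl
  have h2 : ∀ j : Fin 4, ∃ τ : 𝕜, ((j : ℕ) < i → τ = 0) ∧ ∀ p,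
      circleDeriv (T (Pi.single j p) i) =
        τ • circleDeriv ((circleDeriv ^ ((j : ℕ) - i)) p) := by
    intro j
    have hmi : m - l = i := by
      rcases hi with ⟨rfl, rfl⟩ | ⟨rfl, rfl, rfl⟩ <;> simp
    obtain ⟨τ, -, h⟩ := exists_coeff_of_local (i := i) (k := 1) hT
      (fun b hb => hb.circleDeriv_apply_zero i hmi) j
    rw [pow_one] at h
    -- This means j = 0, i = 1. The derivative of the component is then τ p, and p = 1 gives τ = 0
    -- because a constant with a periodic primitive is zero.
    by_cases hj : (j : ℕ) < i
    · have hj2 : (j : ℕ) + 1 - i = 0 := by omega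
      rw [hj2, pow_zero] at h
      have hτ : τ = 0 := eq_zero_of_circleDeriv_eq_smul_one (h 1)
      exact ⟨0, fun _ => rfl, fun p => by rw [h, hτ, zero_smul, zero_smul]⟩
    · refine ⟨τ, fun hj2 => absurd hj2 hj, fun p => ?_⟩
      rw [h, show (j : ℕ) + 1 - i = (j - i) + 1 by omega, pow_succ', Module.End.mul_apply]
  have h3 : ∀ i' j : Fin 4, ∃ τ : 𝕜, ((j : ℕ) < i' → τ = 0) ∧ (i' ≠ i → ∀ p,
      T (Pi.single j p) i' = τ • (circleDeriv ^ ((j : ℕ) - i')) p) ∧ (i' = i → ∀ p,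
      circleDeriv (T (Pi.single j p) i') =
        τ • circleDeriv ((circleDeriv ^ ((j : ℕ) - i')) p)) := by
    intro i' j
    by_cases h : i' = i
    · subst h
      obtain ⟨τ, ha, hb⟩ := h2 j
      exact ⟨τ, ha, fun h => absurd rfl h, fun _ => hb⟩
    · obtain ⟨τ, ha, hb⟩ := h1 i' j h
      exact ⟨τ, ha, fun _ => hb, fun h' => absurd h' h⟩
  choose t ht0 ht1 ht2 using h3
  have h4 : ∀ a, circleDeriv ((T - triOp (Matrix.of t)) a i) = 0 := by
    intro a
    conv_lhs => rw [← Finset.univ_sum_single a]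
    rw [map_sum, Finset.sum_apply, map_sum]
    refine Finset.sum_eq_zero fun j _ => ?_
    rw [LinearMap.sub_apply, Pi.sub_apply, map_sub, ht2 i j rfl, triOp_apply,
      Finset.sum_eq_single j]
    · simp
    · intro k _ hk
      rw [Pi.single_eq_of_ne hk]
      simp
    · simp
  refine ⟨Matrix.of t, fun i j hij => ht0 i j hij,
    { toFun := fun a => ((T - triOp (Matrix.of t)) a i).1 0
      map_add' := fun a b => by rw [map_add]; rfl
      map_smul' := fun c a => by rw [map_smul]; rfl }, fun a => funext fun i' => ?_⟩
  by_cases h : i' = i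
  · subst h
    have h5 := eq_smul_one_of_circleDeriv_eq_zero (h4 a)
    rw [Pi.add_apply, Pi.smul_apply, unitCoeff_same]
    refine Eq.trans ?_ (congrArg (fun y => _ + y) h5)
    simp
  · rw [Pi.add_apply, Pi.smul_apply, unitCoeff_of_ne h, smul_zero, add_zero]
    exact eq_triOp_add (t := Matrix.of t) i' (fun j p => ht1 i' j h p) a

theorem invariant_of_triOp_add {i : Fin 4} (hi : HasInvariant l m i)
    {t : Matrix (Fin 4) (Fin 4) 𝕜} (ht : t ∈ upperTri 𝕜)
    {L : (Fin 4 → CircleFun 𝕜) →ₗ[𝕜] 𝕜} (h : ∀ a, T a = triOp t a + L a • unitCoeff i) :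
    SymmRel l m t ∧ ∀ f a, L (coeffAction l m f a) = L a := by
  have h1 : ∀ f a, triOp t (coeffAction l m f a) + L (coeffAction l m f a) • unitCoeff i =
      coeffAction l m f (triOp t a) + L a • unitCoeff i := by
    intro f a
    rw [← h, hT, h, map_add, map_smul, hi.coeffAction_single]
  -- The left side is local in a and the right side is a constant function, so the constant is zero
  -- as soon as a vanishes near a single point.
  have h2 : ∀ f a, jac f (l - m) * jac f 1 ^ (i : ℕ) * defect l m t f a i =
      (L a - L (coeffAction l m f a)) • 1 := by
    intro f a
    have h3 := congrArg (fun b : Fin 4 → CircleFun 𝕜 => compLift f (b i)) (h1 f a)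
    have h4 : compLift f (1 : CircleFun 𝕜) = 1 := jac_zero f
    simp only [Pi.add_apply, Pi.smul_apply, unitCoeff_same, map_add, map_smul, h4] at h3
    rw [compLift_coeffAction, compLift_triOp_coeffAction ht] at h3
    rw [sub_smul]
    linear_combination h3
  have h3 : ∀ f a x, (∀ j, (a j).1 =ᶠ[𝓝 x] 0) → L (coeffAction l m f a) = L a := by
    intro f a x ha
    have h4 := congrArg (fun ψ : CircleFun 𝕜 => ψ.1 x) (h2 f a)
    have h5 : (jac f (l - m) * jac f 1 ^ (i : ℕ) * defect l m t f a i).1 x =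
      (jac f (l - m) * jac f 1 ^ (i : ℕ)).1 x * (defect l m t f a i).1 x := rfl
    have h6 : ((L a - L (coeffAction l m f a)) • (1 : CircleFun 𝕜)).1 x =
      (L a - L (coeffAction l m f a)) * 1 := rfl
    beta_reduce at h4
    rw [h5, defect_apply_eq_zero ha, mul_zero, h6, mul_one] at h4
    exact (sub_eq_zero.1 h4.symm).symm
  -- Every quadruple is the sum of one vanishing near 1/2 and one vanishing near 0.
  have h4 : ∀ f a, L (coeffAction l m f a) = L a := by
    intro f a
    obtain ⟨χ, hχ1, hχ2⟩ := CircleFun.exists_bump_distInt (show (0 : ℝ) < 1 / 4 by norm_num)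
      (by norm_num)
    set χ' : CircleFun 𝕜 := CircleFun.ofReal χ with hχ'
    have h5 : a = (fun j => χ' * a j) + fun j => (1 - χ') * a j := by
      ext1 j
      simp only [Pi.add_apply]
      ring
    have e1 := h3 f (fun j => χ' * a j) (1 / 2) (fun j => by
      have h6 : ∀ᶠ x in 𝓝 (1 / 2 : ℝ), 1 / 4 < distInt x := by
        refine (continuous_distInt.tendsto _).eventually (lt_mem_nhds ?_)
        rw [distInt_eq_abs] <;> norm_num [abs_of_pos]
      filter_upwards [h6] with x hx
      change ((χ.1 x : ℝ) : 𝕜) * (a j).1 x = 0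
      rw [hχ2 x hx.le]
      simp)
    have e2 := h3 f (fun j => (1 - χ') * a j) 0 (fun j => by
      have h6 : ∀ᶠ x in 𝓝 (0 : ℝ), distInt x < 1 / 4 / 2 := by
        refine (continuous_distInt.tendsto _).eventually (gt_mem_nhds ?_)
        rw [distInt_eq_abs] <;> norm_num
      filter_upwards [h6] with x hx
      change (1 - ((χ.1 x : ℝ) : 𝕜)) * (a j).1 x = 0
      rw [hχ1 x hx.le]
      simp)
    rw [h5, map_add, map_add, map_add, e1, e2]
  refine ⟨symmRel_of_defect_eq_zero fun f a => funext fun j => ?_, h4⟩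
  apply defect_eq_zero_of_commute ht
  have h5 := h1 f a
  rw [h4] at h5
  exact congrFun (add_right_cancel h5) j

end

/-! ### Invariant functionals on densities. -/

section

namespace CircleFun

variable (𝕜) in
/-- The integral over the circle. -/
noncomputable def integral : CircleFun 𝕜 →ₗ[𝕜] 𝕜 where
  toFun φ := ∫ x in (0 : ℝ)..1, φ.1 x
  map_add' φ ψ := intervalIntegral.integral_add (φ.2.1.continuous.intervalIntegrable _ _)
    (ψ.2.1.continuous.intervalIntegrable _ _)
  map_smul' c _ := intervalIntegral.integral_smul c _

theorem integral_apply (φ : CircleFun 𝕜) : integral 𝕜 φ = ∫ x in (0 : ℝ)..1, φ.1 x := rfl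

theorem integral_one : integral 𝕜 1 = 1 := by
  change ∫ x in (0 : ℝ)..1, (1 : 𝕜) = 1
  simp

theorem integral_ofReal (φ : CircleFun ℝ) :
    integral 𝕜 (ofReal φ) = ((integral ℝ φ : ℝ) : 𝕜) :=
  RCLike.intervalIntegral_ofReal (𝕜 := 𝕜)

theorem integral_circleDeriv (φ : CircleFun 𝕜) : integral 𝕜 (circleDeriv φ) = 0 := by
  have h := intervalIntegral.integral_eq_sub_of_hasDerivAt (a := 0) (b := 1)
    (fun x _ => (φ.2.1.differentiable (by simp) x).hasDerivAt)
    ((circleDeriv φ).2.1.continuous.intervalIntegrable _ _)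
  have h1 := φ.2.2 0
  rw [zero_add] at h1
  rw [h1, sub_self] at h
  exact h

theorem ofReal_one : (ofReal 1 : CircleFun 𝕜) = 1 := by
  ext x
  exact RCLike.ofReal_one

theorem ofReal_smul (c : ℝ) (φ : CircleFun ℝ) :
    (ofReal (c • φ) : CircleFun 𝕜) = (c : 𝕜) • ofReal φ := by
  ext x
  exact RCLike.ofReal_mul _ _

/-- A linear functional is determined by its values on the real functions. -/
theorem linearMap_ext_ofReal {M M' : CircleFun 𝕜 →ₗ[𝕜] 𝕜}
    (h : ∀ φ : CircleFun ℝ, M (ofReal φ) = M' (ofReal φ)) : M = M' := by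
  ext φ
  rw [← ofReal_rePart_add φ, map_add, map_add, map_smul, map_smul, h, h]

/-- The real powers of a positive periodic function. -/
theorem exists_rpow {φ : CircleFun ℝ} (hφ : ∀ x, 0 < φ.1 x) (r : ℝ) :
    ∃ ψ : CircleFun ℝ, ∀ x, ψ.1 x = φ.1 x ^ r :=
  ⟨⟨fun x => φ.1 x ^ r, φ.2.1.rpow_const_of_ne fun x => (hφ x).ne',
    fun x => by simp only [φ.2.2 x]⟩, fun _ => rfl⟩

theorem integral_lt {φ ψ : CircleFun ℝ} (h : ∀ x, φ.1 x ≤ ψ.1 x) (h0 : φ.1 0 < ψ.1 0) :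
    integral ℝ φ < integral ℝ ψ :=
  intervalIntegral.integral_lt_integral_of_continuousOn_of_le_of_exists_lt one_pos
    φ.2.1.continuous.continuousOn ψ.2.1.continuous.continuousOn (fun x _ => h x)
    ⟨0, by simp, h0⟩

theorem integral_pos {φ : CircleFun ℝ} (h : ∀ x, 0 < φ.1 x) : 0 < integral ℝ φ := by
  have := integral_lt (φ := 0) (ψ := φ) (fun x => (h x).le) (h 0)
  rwa [map_zero] at this

end CircleFun

theorem CircleDiffeo.exists_deriv_eq {g : CircleFun ℝ} (hg : ∀ x, 0 < g.1 x)
    (h1 : CircleFun.integral ℝ g = 1) : ∃ f : CircleDiffeo, ∀ x, deriv f.lift x = g.1 x := by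
  have hc := g.2.1.continuous
  set F : ℝ → ℝ := fun x => ∫ y in (0 : ℝ)..x, g.1 y with hF
  have hd : ∀ x, HasDerivAt F (g.1 x) x := fun x =>
    intervalIntegral.integral_hasDerivAt_right (hc.intervalIntegrable _ _)
      hc.stronglyMeasurable.stronglyMeasurableAtFilter hc.continuousAt
  have hd' : deriv F = g.1 := funext fun x => (hd x).deriv
  have hs : ContDiff ℝ ∞ F := contDiff_infty_iff_deriv.2
    ⟨fun x => (hd x).differentiableAt, hd' ▸ g.2.1⟩
  have hp : ∀ x, F (x + 1) = F x + 1 := by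
    intro x
    have h2 := g.2.2.intervalIntegral_add_eq x 0
    rw [zero_add] at h2
    rw [hF]
    simp only
    rw [← intervalIntegral.integral_add_adjacent_intervals (hc.intervalIntegrable 0 x)
      (hc.intervalIntegrable x (x + 1)), h2]
    exact congrArg _ h1
  exact ⟨ofLift F hs hp fun x => by rw [hd']; exact hg x, fun x => congrFun hd' x⟩

theorem derivPow_ofReal (f : CircleDiffeo) (r x : ℝ) :
    derivPow f ((r : ℝ) : 𝕜) x = ((deriv f.lift x ^ r : ℝ) : 𝕜) := by
  have h := NormedSpace.algebraMap_exp_comm (𝕂 := ℝ) (𝔸 := 𝕜) (r * Real.log (deriv f.lift x))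
  rw [← Real.exp_eq_exp_ℝ] at h
  rw [derivPow, Real.rpow_def_of_pos (f.deriv_pos x), mul_comm (Real.log _)]
  refine Eq.trans ?_ h.symm
  simp

theorem integral_pullback_one (f : CircleDiffeo) (φ : CircleFun 𝕜) :
    CircleFun.integral 𝕜 (pullback f 1 φ) = CircleFun.integral 𝕜 φ := by
  have h1 : ∀ x, (pullback f (1 : 𝕜) φ).1 x = deriv f.lift x • (φ.1 ∘ f.lift) x := fun x => by
    rw [RCLike.real_smul_eq_coe_mul, ← derivPow_one]
    rfl
  have h2 := intervalIntegral.integral_deriv_smul_comp (a := 0) (b := 1) (f := f.lift)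
    (f' := deriv f.lift) (g := φ.1)
    (fun x _ => (f.contDiff_lift.differentiable (by simp) x).hasDerivAt)
    (contDiff_infty_iff_deriv.1 f.contDiff_lift).2.continuous.continuousOn φ.2.1.continuous
  have h3 := φ.2.2.intervalIntegral_add_eq (f.lift 0) 0
  have h4 := f.lift_add_one 0
  rw [zero_add] at h3 h4
  rw [CircleFun.integral_apply, CircleFun.integral_apply]
  simp only [h1]
  rw [h2, h4, h3]

section functionals

/-- A linear functional on the densities of weight `w` which is invariant under diffeomorphisms. -/
def InvariantFunctional (w : 𝕜) (M : CircleFun 𝕜 →ₗ[𝕜] 𝕜) : Prop :=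
  ∀ f φ, M (pullback f w φ) = M φ

variable {M : CircleFun 𝕜 →ₗ[𝕜] 𝕜}

/-- For f(x) = x + εφ(x) and h a function equal to the coordinate near the support of φ, h∘f = h +
εφ. Invariance therefore gives M(φ) = 0. -/
theorem InvariantFunctional.apply_ofReal_of_support (h : InvariantFunctional 0 M)
    {φ : CircleFun ℝ} (hφ : ∀ x, 3 / 8 ≤ distInt x → φ.1 x = 0) : M (CircleFun.ofReal φ) = 0 := by
  obtain ⟨B, hB, hB2⟩ := CircleFun.exists_bound φ
  -- Since 3/8 + 1/40 = 2/5, points of the support stay in the range where `localCoord` is the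
  -- coordinate.
  have e1 : ∀ᶠ ε : ℝ in 𝓝 0, |ε| < 1 / 40 / B :=
    (continuous_abs.tendsto' (0 : ℝ) 0 abs_zero).eventually (gt_mem_nhds (by positivity))
  obtain ⟨ε, ⟨e2, e3⟩, e4⟩ := (((e1.and (CircleFun.eventually_smul_deriv_gt φ)).filter_mono
    nhdsWithin_le_nhds).and (self_mem_nhdsWithin (a := (0 : ℝ)) (s := {0}ᶜ))).exists
  set f := CircleDiffeo.perturb (ε • φ) e3 with hf
  have hfx : ∀ x, f.lift x = x + ε * φ.1 x := fun x => rfl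
  have hsmall : ∀ x, |ε * φ.1 x| ≤ 1 / 40 := fun x => by
    have := hB2 x
    rw [Real.norm_eq_abs] at this
    rw [abs_mul]
    calc |ε| * |φ.1 x| ≤ 1 / 40 / B * B := by gcongr
      _ = 1 / 40 := by field_simp
  have key : ∀ x, |x| ≤ 1 / 2 → CircleFun.localCoord.1 (f.lift x) =
      CircleFun.localCoord.1 x + ε * φ.1 x := by
    intro x hx
    rcases le_or_gt (3 / 8) |x| with h1 | h1
    · rw [hfx, hφ x (by rw [distInt_eq_abs hx]; exact h1)]
      simp
    · rw [hfx, CircleFun.localCoord_apply, CircleFun.localCoord_apply]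
      · linarith
      · exact (abs_add_le _ _).trans (by linarith [hsmall x])
  have key2 : compLift f (CircleFun.ofReal CircleFun.localCoord : CircleFun 𝕜) =
      CircleFun.ofReal CircleFun.localCoord + (ε : 𝕜) • CircleFun.ofReal φ := by
    have e5 : ∀ x, (compLift f CircleFun.localCoord).1 x =
        (CircleFun.localCoord + ε • φ).1 x := by
      intro x
      rw [← CircleFun.apply_sub_round (compLift f CircleFun.localCoord),
        ← CircleFun.apply_sub_round (CircleFun.localCoord + ε • φ), compLift_apply]
      exact key _ (abs_sub_round x)
    ext x
    rw [compLift_apply]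
    have := e5 x
    rw [compLift_apply] at this
    rw [CircleFun.ofReal_apply, this]
    change ((CircleFun.localCoord.1 x + ε * φ.1 x : ℝ) : 𝕜) =
      ((CircleFun.localCoord.1 x : ℝ) : 𝕜) + (ε : 𝕜) * ((φ.1 x : ℝ) : 𝕜)
    push_cast
    rfl
  have h1 := h f (CircleFun.ofReal CircleFun.localCoord)
  change M (compLift f _) = _ at h1
  rw [key2, map_add, map_smul, add_eq_left, smul_eq_mul, mul_eq_zero] at h1
  exact h1.resolve_left (by exact_mod_cast e4)

theorem InvariantFunctional.eq_zero_of_weight_zero (h : InvariantFunctional 0 M) : M = 0 := by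
  refine CircleFun.linearMap_ext_ofReal fun φ => ?_
  obtain ⟨χ, hχ1, hχ2⟩ := CircleFun.exists_bump_distInt (show (0 : ℝ) < 1 / 4 by norm_num)
    (by norm_num)
  have h1 : CircleFun.ofReal φ = (CircleFun.ofReal (χ * φ) : CircleFun 𝕜) +
      CircleFun.ofReal ((1 - χ) * φ) := by
    rw [← map_add]
    congr 1
    ring
  have h2 : M (CircleFun.ofReal (χ * φ)) = 0 := h.apply_ofReal_of_support fun x hx => by
    change χ.1 x * φ.1 x = 0
    rw [hχ2 x (by linarith), zero_mul]
  have h3 : M (CircleFun.ofReal ((1 - χ) * φ)) = 0 := by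
    -- This piece vanishes within 1/8 of the integers, so a half turn brings its support within 3/8
    -- of them.
    rw [← h (CircleDiffeo.rotation (1 / 2))]
    have h4 : pullback (CircleDiffeo.rotation (1 / 2)) (0 : 𝕜) (CircleFun.ofReal ((1 - χ) * φ)) =
        CircleFun.ofReal (compLift (CircleDiffeo.rotation (1 / 2)) ((1 - χ) * φ)) := by
      ext x
      exact Eq.trans (compLift_apply _ _ x) (by rw [CircleFun.ofReal_apply, CircleFun.ofReal_apply,
        compLift_apply])
    rw [h4]
    refine h.apply_ofReal_of_support fun x hx => ?_
    rw [compLift_apply, CircleDiffeo.rotation_lift]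
    change (1 - χ.1 (x + 1 / 2)) * φ.1 (x + 1 / 2) = 0
    rw [hχ1, sub_self, zero_mul]
    rw [distInt] at hx
    have h5 := abs_sub_round x
    rcases le_or_gt 0 (x - round x) with h6 | h6
    · refine (distInt_le _ (round x + 1)).trans ?_
      rw [abs_of_nonneg h6] at hx h5
      push_cast
      rw [abs_le]
      constructor <;> linarith
    · refine (distInt_le _ (round x)).trans ?_
      rw [abs_of_neg h6] at hx h5
      rw [abs_le]
      constructor <;> linarith
  rw [h1, map_add, h2, h3, add_zero, LinearMap.zero_apply]

/-- With c the integral of φ^(-1/r), there is a diffeomorphism with f' = φ^(-1/r)/c. The pull-back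
of 1 is (f')^(-r) = c^r φ, so the value at φ is c^(-r) times the value at 1. -/
theorem InvariantFunctional.apply_ofReal_of_pos {r : ℝ} (hr : 0 < r)
    (h : InvariantFunctional ((-r : ℝ) : 𝕜) M) {φ ψ : CircleFun ℝ} (hφ : ∀ x, 0 < φ.1 x)
    (hψ : ∀ x, ψ.1 x = φ.1 x ^ (-r⁻¹)) :
    M (CircleFun.ofReal φ) = ((CircleFun.integral ℝ ψ ^ (-r) : ℝ) : 𝕜) * M 1 := by
  have hψ0 : ∀ x, 0 < ψ.1 x := fun x => by rw [hψ]; exact Real.rpow_pos_of_pos (hφ x) _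
  set c := CircleFun.integral ℝ ψ with hc
  have hc0 : 0 < c := CircleFun.integral_pos hψ0
  obtain ⟨f, hf⟩ := CircleDiffeo.exists_deriv_eq (g := c⁻¹ • ψ)
    (fun x => mul_pos (inv_pos.2 hc0) (hψ0 x))
    (by rw [map_smul, ← hc, smul_eq_mul, inv_mul_cancel₀ hc0.ne'])
  have h1 : (pullback f ((-r : ℝ) : 𝕜) 1) = ((c ^ r : ℝ) : 𝕜) • CircleFun.ofReal φ := by
    ext x
    refine Eq.trans (jac_apply _ _ x) ?_
    rw [derivPow_ofReal, hf]
    change (((c⁻¹ * ψ.1 x) ^ (-r) : ℝ) : 𝕜) = ((c ^ r : ℝ) : 𝕜) * ((φ.1 x : ℝ) : 𝕜)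
    rw [← RCLike.ofReal_mul]
    congr 1
    rw [Real.mul_rpow (inv_nonneg.2 hc0.le) (hψ0 x).le, hψ, ← Real.rpow_mul (hφ x).le,
      Real.inv_rpow hc0.le, Real.rpow_neg hc0.le, inv_inv]
    congr 1
    rw [neg_mul_neg, inv_mul_cancel₀ hr.ne', Real.rpow_one]
  have h2 := h f 1
  rw [h1, map_smul, smul_eq_mul] at h2
  rw [← h2, ← mul_assoc, ← RCLike.ofReal_mul, ← Real.rpow_add hc0]
  simp

/-- The graph of the strictly convex function y^(-r) lies above its tangent at y = 1. -/
theorem one_sub_lt_rpow_neg {r y : ℝ} (hr : 0 < r) (hy : 0 < y) :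
    (1 - r * (y - 1) ≤ y ^ (-r)) ∧ (y ≠ 1 → 1 - r * (y - 1) < y ^ (-r)) := by
  have h1 : y ^ (-r) = Real.exp (-r * Real.log y) := by
    rw [Real.rpow_def_of_pos hy, mul_comm]
  have h2 := Real.add_one_le_exp (-r * Real.log y)
  rw [h1]
  constructor
  · nlinarith [Real.log_le_sub_one_of_pos hy]
  · intro h
    nlinarith [Real.log_lt_sub_one_of_pos hy h]

/-- By strict convexity the integral of (1 + s')^(-1/r) exceeds 1, so M(1 + s') = c M(1) with c < 1.
Adding this for s and -s gives 2 M(1) = (c + d) M(1) with c + d < 2, whence M(1) = 0. -/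
theorem InvariantFunctional.eq_zero_of_weight_neg {r : ℝ} (hr : 0 < r)
    (h : InvariantFunctional ((-r : ℝ) : 𝕜) M) : M = 0 := by
  have hA : ∀ s : CircleFun ℝ, (∀ x, -1 < (circleDeriv s).1 x) → (circleDeriv s).1 0 ≠ 0 →
      ∃ c < (1 : ℝ), M (CircleFun.ofReal (1 + circleDeriv s)) = (c : 𝕜) * M 1 := by
    intro s hs hs0
    have hpos : ∀ x, 0 < (1 + circleDeriv s).1 x := fun x => by
      change 0 < 1 + (circleDeriv s).1 x
      linarith [hs x]
    obtain ⟨ψ, hψ⟩ := CircleFun.exists_rpow hpos (-r⁻¹)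
    refine ⟨_, ?_, h.apply_ofReal_of_pos hr hpos hψ⟩
    have h1 : 1 < CircleFun.integral ℝ ψ := by
      have h2 : CircleFun.integral ℝ (1 - r⁻¹ • circleDeriv s) = 1 := by
        rw [map_sub, map_smul, CircleFun.integral_circleDeriv, CircleFun.integral_one, smul_zero,
          sub_zero]
      have h3 : ∀ x, (1 - r⁻¹ • circleDeriv s).1 x = 1 - r⁻¹ * ((1 + circleDeriv s).1 x - 1) := by
        intro x
        change 1 - r⁻¹ * (circleDeriv s).1 x = 1 - r⁻¹ * (1 + (circleDeriv s).1 x - 1)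
        ring
      rw [← h2]
      refine CircleFun.integral_lt (fun x => ?_) ?_
      · rw [hψ, h3]
        exact (one_sub_lt_rpow_neg (inv_pos.2 hr) (hpos x)).1
      · rw [hψ, h3]
        refine (one_sub_lt_rpow_neg (inv_pos.2 hr) (hpos 0)).2 fun h4 => hs0 ?_
        have h5 : 1 + (circleDeriv s).1 0 = 1 := h4
        linarith
    exact Real.rpow_lt_one_of_one_lt_of_neg h1 (by linarith)
  have hM1 : M 1 = 0 := by
    have e0 : ∀ᶠ ε : ℝ in 𝓝 0, ∀ x, -1 < deriv (ε • (-CircleFun.localCoord)).1 x :=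
      CircleFun.eventually_smul_deriv_gt _
    obtain ⟨ε, ⟨e1, e2⟩, e3⟩ := (((e0.and (CircleFun.eventually_smul_deriv_gt
      CircleFun.localCoord)).filter_mono nhdsWithin_le_nhds).and
      (self_mem_nhdsWithin (a := (0 : ℝ)) (s := {0}ᶜ))).exists
    have e4 : (circleDeriv CircleFun.localCoord).1 0 = 1 := by
      have := CircleFun.localCoord_eventuallyEq.deriv_eq
      rwa [deriv_id] at this
    obtain ⟨c, hc, hc2⟩ := hA (ε • CircleFun.localCoord) e2 (by
      rw [map_smul]
      change ε * (circleDeriv CircleFun.localCoord).1 0 ≠ 0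
      rw [e4, mul_one]
      exact e3)
    obtain ⟨d, hd, hd2⟩ := hA (ε • (-CircleFun.localCoord)) e1 (by
      rw [map_smul, map_neg]
      change ε * (-(circleDeriv CircleFun.localCoord).1 0) ≠ 0
      rw [e4]
      simpa using e3)
    have e5 := congrArg₂ (· + ·) hc2 hd2
    beta_reduce at e5
    rw [← map_add, ← map_add] at e5
    have e6 : (1 : CircleFun ℝ) + circleDeriv (ε • CircleFun.localCoord) +
        (1 + circleDeriv (ε • (-CircleFun.localCoord))) = (2 : ℝ) • 1 := by
      simp only [map_smul, map_neg, smul_neg]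
      rw [two_smul]
      ring
    rw [e6, CircleFun.ofReal_smul, map_smul, CircleFun.ofReal_one, smul_eq_mul] at e5
    have e7 : ((2 - c - d : ℝ) : 𝕜) * M 1 = 0 := by
      push_cast at e5 ⊢
      linear_combination e5
    refine (mul_eq_zero.1 e7).resolve_left ?_
    have : (2 - c - d : ℝ) ≠ 0 := by linarith
    exact_mod_cast this
  -- Once M(1) = 0, every positive function is killed, and a real function becomes positive after
  -- adding a constant.
  refine CircleFun.linearMap_ext_ofReal fun φ => ?_
  obtain ⟨B, hB, hB2⟩ := CircleFun.exists_bound φ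
  have hpos : ∀ x, 0 < (φ + (B + 1) • 1).1 x := fun x => by
    change 0 < φ.1 x + (B + 1) * 1
    have := (abs_le.1 (hB2 x)).1
    linarith
  obtain ⟨ψ, hψ⟩ := CircleFun.exists_rpow hpos (-r⁻¹)
  have h1 := h.apply_ofReal_of_pos hr hpos hψ
  rw [hM1, mul_zero, map_add, CircleFun.ofReal_smul, map_add, map_smul, CircleFun.ofReal_one, hM1,
    smul_zero, add_zero] at h1
  rw [h1, LinearMap.zero_apply]

/-- A real function of mean zero is a multiple of f' - 1 for some f, and f' is the pull-back of the
density 1; so M kills it. -/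
theorem InvariantFunctional.eq_smul_integral (h : InvariantFunctional 1 M) :
    M = M 1 • CircleFun.integral 𝕜 := by
  have h0 : ∀ φ : CircleFun ℝ, CircleFun.integral ℝ φ = 0 → M (CircleFun.ofReal φ) = 0 := by
    intro φ hφ
    obtain ⟨B, hB, hB2⟩ := CircleFun.exists_bound φ
    obtain ⟨f, hf⟩ := CircleDiffeo.exists_deriv_eq (g := 1 + (2 * B)⁻¹ • φ) (fun x => by
      change 0 < 1 + (2 * B)⁻¹ * φ.1 x
      have := (abs_le.1 (hB2 x)).1
      have h3 : (2 * B)⁻¹ * (-B) ≤ (2 * B)⁻¹ * φ.1 x := by gcongr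
      have h4 : (2 * B)⁻¹ * (-B) = -(1 / 2) := by field_simp
      linarith) (by
      rw [map_add, map_smul, hφ, smul_zero, add_zero, CircleFun.integral_one])
    have h1 : pullback f (1 : 𝕜) 1 = 1 + (((2 * B)⁻¹ : ℝ) : 𝕜) • CircleFun.ofReal φ := by
      ext x
      refine Eq.trans (jac_apply _ _ x) ?_
      rw [derivPow_one, hf]
      change ((1 + (2 * B)⁻¹ * φ.1 x : ℝ) : 𝕜) = 1 + (((2 * B)⁻¹ : ℝ) : 𝕜) * ((φ.1 x : ℝ) : 𝕜)
      push_cast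
      rfl
    have h2 := h f 1
    rw [h1, map_add, map_smul, add_eq_left, smul_eq_mul, mul_eq_zero] at h2
    refine h2.resolve_left ?_
    have : (2 * B)⁻¹ ≠ 0 := by positivity
    exact_mod_cast this
  refine CircleFun.linearMap_ext_ofReal fun φ => ?_
  have h1 := h0 (φ - CircleFun.integral ℝ φ • 1) (by
    rw [map_sub, map_smul, CircleFun.integral_one]
    simp)
  rw [map_sub, CircleFun.ofReal_smul, map_sub, map_smul, CircleFun.ofReal_one, sub_eq_zero] at h1
  rw [h1, LinearMap.smul_apply, CircleFun.integral_ofReal, smul_eq_mul, smul_eq_mul, mul_comm]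

end functionals

end

/-! ### All symmetries: matrices and the nonlocal operator. -/

section

section invariantFunctionals

variable {l m : 𝕜} {L : (Fin 4 → CircleFun 𝕜) →ₗ[𝕜] 𝕜}

/-- The principal symbol of an operator of order i is a density of weight m - l - i, and the order
does not increase. -/
theorem coeffAction_single_pullback (l m : 𝕜) (f : CircleDiffeo) (i : Fin 4) (φ : CircleFun 𝕜) :
    coeffAction l m f (Pi.single i (pullback f (m - l - (i : ℕ)) φ)) i = φ ∧
      ∀ j, i < j → coeffAction l m f (Pi.single i (pullback f (m - l - (i : ℕ)) φ)) j = 0 := by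
  set a : Fin 4 → CircleFun 𝕜 := Pi.single i (pullback f (m - l - (i : ℕ)) φ) with ha
  have h0 : ∀ j, i < j → a j = 0 := fun j hj => Pi.single_eq_of_ne hj.ne' _
  have h1 : ∀ j, i ≤ j → transport l f a j = a j := by
    intro j hj
    have h2 : ∀ k : Fin 4, j < k → a k = 0 := fun k hk => h0 k (hj.trans_lt hk)
    obtain rfl | rfl | rfl | rfl : j = 0 ∨ j = 1 ∨ j = 2 ∨ j = 3 := by fin_cases j <;> simp
    · simp [transport_zero, h2 1 (by decide), h2 2 (by decide), h2 3 (by decide)]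
    · simp [transport_one, h2 2 (by decide), h2 3 (by decide)]
    · simp [transport_two, h2 3 (by decide)]
    · exact transport_three l f a
  constructor
  · apply compLift_injective f
    rw [compLift_coeffAction, h1 i le_rfl, ha, Pi.single_eq_same, pullback_eq]
    have h3 : jac f (l - m) * jac f (1 : 𝕜) ^ (i : ℕ) * jac f (m - l - (i : ℕ)) = 1 := by
      have h4 : ∀ n : ℕ, jac f (1 : 𝕜) ^ n = jac f (n : 𝕜) := by
        intro n
        induction n with
        | zero => simp [jac_zero]
        | succ n ih => rw [pow_succ, ih, ← jac_add, Nat.cast_succ]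
      rw [h4, ← jac_add, ← jac_add, ← jac_zero f]
      congr 1
      ring
    linear_combination (compLift f φ) * h3
  · intro j hj
    apply compLift_injective f
    rw [compLift_coeffAction, h1 j hj.le, h0 j hj, mul_zero, map_zero]

theorem invariantFunctional_single (hL : ∀ f a, L (coeffAction l m f a) = L a) {i : Fin 4}
    (h : ∀ j < i, ∀ φ, L (Pi.single j φ) = 0) :
    InvariantFunctional (m - l - (i : ℕ)) (L ∘ₗ LinearMap.single 𝕜 (fun _ => CircleFun 𝕜) i) := by
  intro f φ
  obtain ⟨h1, h2⟩ := coeffAction_single_pullback l m f i φ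
  have h3 := hL f (Pi.single i (pullback f (m - l - (i : ℕ)) φ))
  change L (Pi.single i (pullback f (m - l - (i : ℕ)) φ)) = L (Pi.single i φ)
  rw [← h3]
  set b := coeffAction l m f (Pi.single i (pullback f (m - l - (i : ℕ)) φ))
  conv_lhs => rw [← Finset.univ_sum_single b]
  rw [map_sum, Finset.sum_eq_single i]
  · rw [h1]
  · intro j _ hj
    rcases lt_or_gt_of_ne hj with h4 | h4
    · exact h j h4 _
    · rw [h2 j h4, Pi.single_zero, map_zero]
  · simp

/-- Induction on the order: order n gives a functional of weight 0, and higher orders i give the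
negative weights n - i. All of these vanish. -/
theorem eq_zero_of_invariant (hL : ∀ f a, L (coeffAction l m f a) = L a) {n : ℕ}
    (hlm : m - l = n) (h : ∀ j : Fin 4, (j : ℕ) < n → ∀ φ, L (Pi.single j φ) = 0) : L = 0 := by
  have h1 : ∀ k : ℕ, ∀ i : Fin 4, (i : ℕ) = k → ∀ φ, L (Pi.single i φ) = 0 := by
    intro k
    induction k using Nat.strong_induction_on with
    | _ k ih =>
    rintro i rfl φ
    by_cases hi : (i : ℕ) < n
    · exact h i hi φ
    have h2 := invariantFunctional_single hL (i := i) fun j hj φ => ih j hj j rfl φ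
    suffices h3 : L ∘ₗ LinearMap.single 𝕜 (fun _ => CircleFun 𝕜) i = 0 from
      LinearMap.congr_fun h3 φ
    rw [hlm] at h2
    rcases Nat.eq_or_lt_of_le (not_lt.1 hi) with h3 | h3
    · rw [h3, sub_self] at h2
      exact h2.eq_zero_of_weight_zero
    · have h4 : ((n : 𝕜) - ((i : ℕ) : 𝕜)) = ((-((i : ℕ) - n : ℝ) : ℝ) : 𝕜) := by
        push_cast
        ring
      rw [h4] at h2
      exact h2.eq_zero_of_weight_neg (sub_pos.2 (by exact_mod_cast h3))
  ext1 i
  exact LinearMap.ext fun φ => h1 i i rfl φ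

/-- For l = 0 the constant 1 is invariant, so a_0 = A(1) is a one-form and has an invariant
integral. -/
theorem integral_coeffAction_zero_one (f : CircleDiffeo) (a : Fin 4 → CircleFun 𝕜) :
    CircleFun.integral 𝕜 (coeffAction 0 1 f a 0) = CircleFun.integral 𝕜 (a 0) := by
  rw [← integral_pullback_one f (coeffAction 0 1 f a 0), pullback_eq, compLift_coeffAction,
    transport_zero]
  have h1 : jac f (1 : 𝕜) * jac f (0 - 1) = 1 := by rw [← jac_add, ← jac_zero f]; simp
  congr 1
  simp only [zero_smul, add_zero, Fin.val_zero, pow_zero, mul_one]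
  rw [← mul_assoc, h1, one_mul]

theorem eq_integral_of_invariant (hL : ∀ f a, L (coeffAction 0 1 f a) = L a) :
    ∃ κ : 𝕜, ∀ a, L a = κ * CircleFun.integral 𝕜 (a 0) := by
  have h1 := invariantFunctional_single hL (i := 0) fun j hj => absurd hj (by simp)
  have h2 : (1 : 𝕜) - 0 - ((0 : Fin 4) : ℕ) = 1 := by simp
  rw [h2] at h1
  have h3 := h1.eq_smul_integral
  set κ := (L ∘ₗ LinearMap.single 𝕜 (fun _ => CircleFun 𝕜) 0) 1
  refine ⟨κ, fun a => ?_⟩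
  have h4 : L - κ • CircleFun.integral 𝕜 ∘ₗ LinearMap.proj 0 = 0 := by
    refine eq_zero_of_invariant (l := 0) (m := 1) (n := 1) (fun f a => ?_) (by simp) ?_
    · simp [hL, integral_coeffAction_zero_one]
    · intro j hj φ
      obtain rfl : j = 0 := Fin.ext (by simpa using hj)
      have h5 := LinearMap.congr_fun h3 φ
      simp only [LinearMap.comp_apply, LinearMap.single_apply, LinearMap.smul_apply] at h5
      simp [h5]
  have h5 := LinearMap.congr_fun h4 a
  exact sub_eq_zero.1 h5

end invariantFunctionals

variable {l m : 𝕜}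

/-- For l = m the residual functional has weights 0, -1, -2, -3 in the successive orders, so it is
zero and l = m needs no separate treatment. -/
theorem commute_triOp_iff {T : Module.End 𝕜 (Fin 4 → CircleFun 𝕜)} (h01 : ¬(l = 0 ∧ m = 1)) :
    (∀ f a, T (coeffAction l m f a) = coeffAction l m f (T a)) ↔
      ∃ t ∈ upperTri 𝕜, SymmRel l m t ∧ T = triOp t := by
  constructor
  · intro hT
    by_cases hlm : l = m
    · subst hlm
      obtain ⟨t, ht, L, h⟩ := exists_triOp_add_of_hasInvariant hT (i := 0) (Or.inl ⟨rfl, rfl⟩)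
      obtain ⟨h1, h2⟩ := invariant_of_triOp_add hT (Or.inl ⟨rfl, rfl⟩) ht h
      have h3 : L = 0 := eq_zero_of_invariant (n := 0) h2 (by simp) fun j hj => absurd hj (by simp)
      refine ⟨t, ht, h1, LinearMap.ext fun a => ?_⟩
      rw [h, h3]
      simp
    · exact exists_triOp_of_generic hT hlm h01
  · rintro ⟨t, ht, h, rfl⟩ f a
    exact triOp_coeffAction ht h f a

variable (𝕜) in
/-- The nonlocal symmetry of the operators from functions to one-forms. -/
noncomputable def nonlocalOp : Module.End 𝕜 (Fin 4 → CircleFun 𝕜) :=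
  (CircleFun.integral 𝕜 ∘ₗ LinearMap.proj 0).smulRight (unitCoeff 1)

theorem nonlocalOp_apply (a : Fin 4 → CircleFun 𝕜) :
    nonlocalOp 𝕜 a = CircleFun.integral 𝕜 (a 0) • unitCoeff 1 := rfl

theorem commute_zero_one_iff {T : Module.End 𝕜 (Fin 4 → CircleFun 𝕜)} :
    (∀ f a, T (coeffAction 0 1 f a) = coeffAction 0 1 f (T a)) ↔
      ∃ t ∈ upperTri 𝕜, SymmRel 0 1 t ∧ ∃ c : 𝕜, T = triOp t + c • nonlocalOp 𝕜 := by
  have hi : HasInvariant (0 : 𝕜) 1 1 := Or.inr ⟨rfl, rfl, rfl⟩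
  constructor
  · intro hT
    obtain ⟨t, ht, L, h⟩ := exists_triOp_add_of_hasInvariant hT hi
    obtain ⟨h1, h2⟩ := invariant_of_triOp_add hT hi ht h
    obtain ⟨κ, hκ⟩ := eq_integral_of_invariant h2
    refine ⟨t, ht, h1, κ, LinearMap.ext fun a => ?_⟩
    rw [h, hκ, mul_smul]
    rfl
  · rintro ⟨t, ht, h, c, rfl⟩ f a
    simp only [LinearMap.add_apply, LinearMap.smul_apply, map_add, map_smul,
      triOp_coeffAction ht h f a, nonlocalOp_apply, integral_coeffAction_zero_one,
      hi.coeffAction_single]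

/-- The image of the nonlocal operator is spanned by d/dx, whose constant coefficient is killed by
every derivation. -/
theorem triOp_mul_nonlocalOp {t : Matrix (Fin 4) (Fin 4) 𝕜} (ht : t ∈ upperTri 𝕜) :
    triOp t * nonlocalOp 𝕜 = t 1 1 • nonlocalOp 𝕜 := by
  have h : triOp t (unitCoeff 1) = t 1 1 • unitCoeff 1 := by
    funext i
    have h0 : (unitCoeff 1 : Fin 4 → CircleFun 𝕜) 0 = 0 := unitCoeff_of_ne (by decide)
    have h1 : (unitCoeff 1 : Fin 4 → CircleFun 𝕜) 1 = 1 := unitCoeff_same 1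
    have h2 : (unitCoeff 1 : Fin 4 → CircleFun 𝕜) 2 = 0 := unitCoeff_of_ne (by decide)
    have h3 : (unitCoeff 1 : Fin 4 → CircleFun 𝕜) 3 = 0 := unitCoeff_of_ne (by decide)
    rw [Pi.smul_apply]
    obtain rfl | rfl | rfl | rfl : i = 0 ∨ i = 1 ∨ i = 2 ∨ i = 3 := by fin_cases i <;> simp
    · simp only [triOp_apply_zero, h0, h1, h2, h3, circleDeriv_one, map_zero, smul_zero, add_zero]
    · simp only [triOp_apply_one ht, h1, h2, h3, map_zero, smul_zero, add_zero]
    · simp only [triOp_apply_two ht, h2, h3, map_zero, smul_zero, add_zero]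
    · simp only [triOp_apply_three ht, h3, smul_zero]
  refine LinearMap.ext fun a => ?_
  rw [Module.End.mul_apply, nonlocalOp_apply, map_smul, h, smul_comm]
  rfl

/-- The integral over the circle kills the derivatives in the zeroth component. -/
theorem nonlocalOp_mul_triOp (t : Matrix (Fin 4) (Fin 4) 𝕜) :
    nonlocalOp 𝕜 * triOp t = t 0 0 • nonlocalOp 𝕜 := by
  refine LinearMap.ext fun a => ?_
  rw [Module.End.mul_apply, nonlocalOp_apply, triOp_apply_zero]
  simp only [map_add, map_smul, CircleFun.integral_circleDeriv, smul_zero, add_zero, smul_assoc]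
  rfl

theorem nonlocalOp_mul_self : nonlocalOp 𝕜 * nonlocalOp 𝕜 = 0 := by
  refine LinearMap.ext fun a => ?_
  rw [Module.End.mul_apply, nonlocalOp_apply, nonlocalOp_apply, Pi.smul_apply,
    unitCoeff_of_ne (by decide)]
  simp

/-- On the identity operator, the component of d/dx sees only the nonlocal part, because t is upper
triangular. Monomial germs then detect each entry of t. -/
theorem triOp_add_eq_zero {t : Matrix (Fin 4) (Fin 4) 𝕜} (ht : t ∈ upperTri 𝕜) {c : 𝕜}
    (h : triOp t + c • nonlocalOp 𝕜 = 0) : t = 0 ∧ c = 0 := by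
  have hc : c = 0 := by
    have h1 := congrArg (fun φ : CircleFun 𝕜 => φ.1 0) (congrFun (LinearMap.congr_fun h (unitCoeff 0)) 1)
    rw [LinearMap.add_apply, Pi.add_apply, triOp_apply_one ht, LinearMap.smul_apply,
      nonlocalOp_apply, unitCoeff_same, CircleFun.integral_one, unitCoeff_of_ne (by decide),
      unitCoeff_of_ne (by decide), unitCoeff_of_ne (by decide), one_smul, Pi.smul_apply,
      unitCoeff_same] at h1
    simpa using h1
  subst hc
  refine ⟨Matrix.ext fun i j => ?_, rfl⟩
  rw [zero_smul, add_zero] at h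
  rcases lt_or_ge j i with hij | hij
  · exact ht i j hij
  have h1 := congrFun (LinearMap.congr_fun h (Pi.single j (monomialGerm ((j : ℕ) - i)))) i
  rw [triOp_apply, Finset.sum_eq_single j, Pi.single_eq_same] at h1
  · have h2 := circleDeriv_pow_monomialGerm (𝕜 := 𝕜) ((j : ℕ) - i) (j - i)
    have h3 := congrArg (fun φ : CircleFun 𝕜 => φ.1 0) h1
    change t i j * ((circleDeriv ^ ((j : ℕ) - i)) (monomialGerm ((j : ℕ) - i) : CircleFun 𝕜)).1 0 =
      0 at h3
    rw [h2, if_pos rfl, mul_eq_zero] at h3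
    exact h3.resolve_right (by exact_mod_cast Nat.factorial_ne_zero _)
  · intro k _ hk
    rw [Pi.single_eq_of_ne hk, map_zero, smul_zero]
  · simp

/-- A presentation of the algebra of symmetries by operators on the coefficients. -/
theorem nonempty_symmetryAlgebra_equiv {B : Type*} [Ring B] [Algebra 𝕜 B]
    (g : B →ₐ[𝕜] Module.End 𝕜 (Fin 4 → CircleFun 𝕜)) (hg : Function.Injective g)
    (h : ∀ T, (∀ f a, T (coeffAction l m f a) = coeffAction l m f (T a)) ↔ ∃ b, g b = T) :
    Nonempty (symmetryAlgebra 3 l m ≃ₐ[𝕜] B) := by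
  obtain ⟨e, he⟩ : ∃ e : Module.End 𝕜 (Fin 4 → CircleFun 𝕜) ≃ₐ[𝕜] Module.End 𝕜 (diffOps 𝕜 3),
      ∀ f, diffOpsAction 3 l m f = e (coeffAction l m f) := by
    refine ⟨(coeffEquiv (𝕜 := 𝕜)).conjAlgEquiv 𝕜, fun f => ?_⟩
    refine LinearMap.ext fun A => ?_
    simp [coeffAction, LinearEquiv.conjAlgEquiv_apply]
  have hr : (AlgHom.comp (e : _ →ₐ[𝕜] Module.End 𝕜 (diffOps 𝕜 3)) g).range = symmetryAlgebra 3 l m := by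
    ext T
    obtain ⟨S, rfl⟩ := e.surjective T
    have h1 : e S ∈ symmetryAlgebra 3 l m ↔
        ∀ f a, S (coeffAction l m f a) = coeffAction l m f (S a) := by
      rw [symmetryAlgebra, Subalgebra.mem_centralizer_iff, Set.forall_mem_range]
      refine forall_congr' fun f => ?_
      rw [he, ← map_mul, ← map_mul, e.injective.eq_iff, eq_comm, LinearMap.ext_iff]
      rfl
    rw [h1, h, AlgHom.mem_range]
    exact exists_congr fun b => e.injective.eq_iff
  have hinj : Function.Injective
      (AlgHom.comp (e : _ →ₐ[𝕜] Module.End 𝕜 (diffOps 𝕜 3)) g) := e.injective.comp hg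
  exact ⟨((AlgEquiv.ofInjective _ hinj).trans
    (Subalgebra.equivOfEq _ _ hr)).symm⟩

variable (l m) in
/-- The algebra of matrices of local symmetries. -/
noncomputable def symmMatrices : Subalgebra 𝕜 (upperTri 𝕜) :=
  (Subalgebra.centralizer 𝕜 (Set.range (coeffAction l m))).comap triHom

/-- The subalgebra is defined by commutation, which makes closure under products automatic; here it
is identified with the solutions of the linear relations. -/
theorem mem_symmMatrices {t : upperTri 𝕜} : t ∈ symmMatrices l m ↔ SymmRel l m t.1 := by
  have h1 : t ∈ symmMatrices l m ↔
      ∀ f a, triOp t.1 (coeffAction l m f a) = coeffAction l m f (triOp t.1 a) := by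
    rw [symmMatrices, Subalgebra.mem_comap, Subalgebra.mem_centralizer_iff, Set.forall_mem_range]
    refine forall_congr' fun f => ?_
    rw [eq_comm, LinearMap.ext_iff]
    rfl
  rw [h1]
  constructor
  · intro h
    refine symmRel_of_defect_eq_zero fun f a => funext fun i => ?_
    apply defect_eq_zero_of_commute t.2
    rw [h]
  · intro h f a
    exact triOp_coeffAction t.2 h f a

/-- To identify the algebra of symmetries, it suffices to identify the algebra of matrices. -/
theorem nonempty_equiv_of_matrix {B : Type*} [Ring B] [Algebra 𝕜 B] (h01 : ¬(l = 0 ∧ m = 1))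
    (π : Matrix (Fin 4) (Fin 4) 𝕜 →ₗ[𝕜] B) (h1 : π 1 = 1)
    (hmul : ∀ s ∈ upperTri 𝕜, ∀ t ∈ upperTri 𝕜, SymmRel l m s → SymmRel l m t →
      π (s * t) = π s * π t)
    (hinj : ∀ t ∈ upperTri 𝕜, SymmRel l m t → π t = 0 → t = 0)
    (hsurj : ∀ b, ∃ t ∈ upperTri 𝕜, SymmRel l m t ∧ π t = b) :
    Nonempty (symmetryAlgebra 3 l m ≃ₐ[𝕜] B) := by
  set p : symmMatrices l m →ₐ[𝕜] B := AlgHom.ofLinearMap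
    (π ∘ₗ (upperTri 𝕜).val.toLinearMap ∘ₗ (symmMatrices l m).val.toLinearMap) h1
    (fun s t => hmul _ s.1.2 _ t.1.2 (mem_symmMatrices.1 s.2) (mem_symmMatrices.1 t.2)) with hp
  have hb : Function.Bijective p := by
    constructor
    · rw [injective_iff_map_eq_zero]
      intro t ht
      exact Subtype.ext (Subtype.ext (hinj _ t.1.2 (mem_symmMatrices.1 t.2) ht))
    · intro b
      obtain ⟨t, ht, h2, h3⟩ := hsurj b
      exact ⟨⟨⟨t, ht⟩, mem_symmMatrices.2 h2⟩, h3⟩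
  obtain ⟨e⟩ := nonempty_symmetryAlgebra_equiv (l := l) (m := m)
    (B := symmMatrices l m)
    (triHom.comp (symmMatrices l m).val)
    (by
      rw [injective_iff_map_eq_zero]
      intro t ht
      refine Subtype.ext (Subtype.ext (triOp_add_eq_zero t.1.2 (c := 0) ?_).1)
      rw [zero_smul, add_zero]
      exact ht)
    (fun T => by
      rw [commute_triOp_iff h01]
      constructor
      · rintro ⟨t, ht, h2, rfl⟩
        exact ⟨⟨⟨t, ht⟩, mem_symmMatrices.2 h2⟩, rfl⟩
      · rintro ⟨t, rfl⟩
        exact ⟨t.1.1, t.1.2, mem_symmMatrices.1 t.2, rfl⟩)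
  exact ⟨e.trans (AlgEquiv.ofBijective p hb)⟩

end

/-! ### Solving the relations for each pair of weights other than (0, 1). -/

section

section upperTri

variable {s t : Matrix (Fin 4) (Fin 4) 𝕜}

theorem upperTri_mul_diag (hs : s ∈ upperTri 𝕜) (ht : t ∈ upperTri 𝕜) (i : Fin 4) :
    (s * t) i i = s i i * t i i := by
  rw [Matrix.mul_apply, Finset.sum_eq_single i]
  · intro j _ hj
    rcases lt_or_gt_of_ne hj with h | h
    · rw [hs i j h, zero_mul]
    · rw [ht j i h, mul_zero]
  · simp

theorem upperTri_mul_superdiag (hs : s ∈ upperTri 𝕜) (ht : t ∈ upperTri 𝕜) {i j : Fin 4}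
    (hij : (j : ℕ) = i + 1) : (s * t) i j = s i i * t i j + s i j * t j j := by
  have hne : i ≠ j := fun h => by simp [h] at hij
  rw [Matrix.mul_apply, Finset.sum_eq_add_of_mem i j (Finset.mem_univ _) (Finset.mem_univ _) hne]
  rintro k - ⟨h1, h2⟩
  rcases lt_or_gt_of_ne h1 with h | h
  · rw [hs i k h, zero_mul]
  · have h3 : j < k := by
      have h4 : (i : ℕ) < k := h
      have h5 : (k : ℕ) ≠ j := fun h => h2 (Fin.ext h)
      exact Fin.lt_def.2 (by omega)
    rw [ht k j h3, mul_zero]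

theorem upperTri_mul_one_three (hs : s ∈ upperTri 𝕜) :
    (s * t) 1 3 = s 1 1 * t 1 3 + s 1 2 * t 2 3 + s 1 3 * t 3 3 := by
  rw [Matrix.mul_apply, Fin.sum_univ_four, hs 1 0 (by decide), zero_mul, zero_add]

theorem upperTri_eq_zero (ht : t ∈ upperTri 𝕜) (h00 : t 0 0 = 0) (h11 : t 1 1 = 0)
    (h22 : t 2 2 = 0) (h33 : t 3 3 = 0) (h01 : t 0 1 = 0) (h02 : t 0 2 = 0) (h03 : t 0 3 = 0)
    (h12 : t 1 2 = 0) (h13 : t 1 3 = 0) (h23 : t 2 3 = 0) : t = 0 := by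
  ext i j
  rcases lt_or_ge j i with hij | hij
  · exact ht i j hij
  · fin_cases i <;> fin_cases j <;> first | assumption | exact absurd hij (by decide)

/-- The upper triangular matrix with given entries. -/
def triMat (x y z u a b c d e f : 𝕜) : Matrix (Fin 4) (Fin 4) 𝕜 :=
  !![x, a, b, c; 0, y, d, e; 0, 0, z, f; 0, 0, 0, u]

theorem triMat_mem (x y z u a b c d e f : 𝕜) : triMat x y z u a b c d e f ∈ upperTri 𝕜 := by
  intro i j hij
  fin_cases i <;> fin_cases j <;> first | rfl | exact absurd hij (by decide)

theorem symmRel_triMat {l m x y z u a b c d e f : 𝕜}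
    (rel23 : 3 * (l + 1) * (z - u) + (3 - (m - l)) * f = 0)
    (rel12 : (2 * l + 1) * (y - z) + (2 - (m - l)) * d = 0)
    (rel13 : 3 * (l + 1) * d + (5 - 2 * (m - l)) * e - (2 * l + 1) * f = 0)
    (rel13' : (3 * l + 1) * (y - u) + 3 * (l + 1) * d + (3 - (m - l)) * e = 0)
    (rel01 : l * (x - y) + (1 - (m - l)) * a = 0)
    (rel02 : (2 * l + 1) * a + (3 - 2 * (m - l)) * b - l * d = 0)
    (rel02' : l * (x - z) + (2 * l + 1) * a + (2 - (m - l)) * b = 0)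
    (rel03 : 3 * (l + 1) * b + (6 - 3 * (m - l)) * c - l * e = 0)
    (rel03' : (3 * l + 1) * a + 6 * (l + 1) * b + (8 - 3 * (m - l)) * c - l * f = 0)
    (rel03'' : l * (x - u) + (3 * l + 1) * a + 3 * (l + 1) * b + (3 - (m - l)) * c = 0) :
    SymmRel l m (triMat x y z u a b c d e f) :=
  ⟨rel23, rel12, rel13, rel13', rel01, rel02, rel02', rel03, rel03', rel03''⟩

end upperTri

section targets

variable {l m : 𝕜}

/-- Diagonal entries are multiplicative on triangular matrices, so it is enough to find diagonal
positions that parametrize the solutions freely. -/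
theorem nonempty_equiv_pi (h01 : ¬(l = 0 ∧ m = 1)) {n : ℕ} (σ : Fin n → Fin 4)
    (hinj : ∀ t ∈ upperTri 𝕜, SymmRel l m t → (∀ k, t (σ k) (σ k) = 0) → t = 0)
    (hsurj : ∀ b : Fin n → 𝕜, ∃ t ∈ upperTri 𝕜, SymmRel l m t ∧ ∀ k, t (σ k) (σ k) = b k) :
    Nonempty (symmetryAlgebra 3 l m ≃ₐ[𝕜] (Fin n → 𝕜)) :=
  nonempty_equiv_of_matrix h01
    { toFun := fun t k => t (σ k) (σ k)
      map_add' := fun _ _ => rfl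
      map_smul' := fun _ _ => rfl }
    (funext fun _ => Matrix.one_apply_eq _)
    (fun _ hs _ ht _ _ => funext fun _ => upperTri_mul_diag hs ht _)
    (fun t ht h h0 => hinj t ht h (congrFun h0))
    (fun b => (hsurj b).imp fun _ h => ⟨h.1, h.2.1, funext h.2.2⟩)

/-- The target is the algebra of dual numbers: the chosen off-diagonal entry has to behave like a
derivation over the character t ↦ t 1 1. -/
theorem nonempty_equiv_algA (h01 : ¬(l = 0 ∧ m = 1)) {i j : Fin 4} (hij : i ≠ j)
    (hmul : ∀ s ∈ upperTri 𝕜, ∀ t ∈ upperTri 𝕜, SymmRel l m s → SymmRel l m t →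
      (s * t) i j = s i j * t 1 1 + s 1 1 * t i j)
    (hinj : ∀ t ∈ upperTri 𝕜, SymmRel l m t → t 1 1 = 0 → t i j = 0 → t = 0)
    (hsurj : ∀ y z : 𝕜, ∃ t ∈ upperTri 𝕜, SymmRel l m t ∧ t 1 1 = y ∧ t i j = z) :
    Nonempty (symmetryAlgebra 3 l m ≃ₐ[𝕜] algA 𝕜) := by
  refine nonempty_equiv_of_matrix h01
    { toFun := fun t => ⟨!![t 1 1, 0; t i j, t 1 1], _, _, rfl⟩
      map_add' := fun s t => Subtype.ext (by simp)
      map_smul' := fun c t => Subtype.ext (by simp) }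
    (Subtype.ext ?_) (fun s hs t ht h1 h2 => Subtype.ext ?_) (fun t ht h h0 => ?_) ?_
  · simp [Matrix.one_apply_ne hij, Matrix.one_fin_two]
  · simp [upperTri_mul_diag hs ht, hmul s hs t ht h1 h2]
  · have h3 : !![t 1 1, 0; t i j, t 1 1] = 0 := congrArg Subtype.val h0
    exact hinj t ht h (congrFun (congrFun h3 0) 0) (congrFun (congrFun h3 1) 0)
  · rintro ⟨_, y, z, rfl⟩
    obtain ⟨t, ht, h, rfl, rfl⟩ := hsurj y z
    exact ⟨t, ht, h, rfl⟩

theorem nonempty_equiv_algA_prod (h01 : ¬(l = 0 ∧ m = 1)) {i j : Fin 4} (hij : i ≠ j)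
    (hmul : ∀ s ∈ upperTri 𝕜, ∀ t ∈ upperTri 𝕜, SymmRel l m s → SymmRel l m t →
      (s * t) i j = s i j * t 1 1 + s 1 1 * t i j)
    (hinj : ∀ t ∈ upperTri 𝕜, SymmRel l m t → t 0 0 = 0 → t 1 1 = 0 → t i j = 0 → t = 0)
    (hsurj : ∀ x y z : 𝕜, ∃ t ∈ upperTri 𝕜, SymmRel l m t ∧ t 0 0 = x ∧ t 1 1 = y ∧ t i j = z) :
    Nonempty (symmetryAlgebra 3 l m ≃ₐ[𝕜] algA 𝕜 × 𝕜) := by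
  refine nonempty_equiv_of_matrix h01
    { toFun := fun t => (⟨!![t 1 1, 0; t i j, t 1 1], _, _, rfl⟩, t 0 0)
      map_add' := fun s t => Prod.ext (Subtype.ext (by simp)) rfl
      map_smul' := fun c t => Prod.ext (Subtype.ext (by simp)) rfl }
    (Prod.ext (Subtype.ext ?_) rfl)
    (fun s hs t ht h1 h2 => Prod.ext (Subtype.ext ?_) (upperTri_mul_diag hs ht 0))
    (fun t ht h h0 => ?_) ?_
  · simp [Matrix.one_apply_ne hij, Matrix.one_fin_two]
  · simp [upperTri_mul_diag hs ht, hmul s hs t ht h1 h2]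
  · have h3 : !![t 1 1, 0; t i j, t 1 1] = 0 :=
      congrArg (fun p : algA 𝕜 × 𝕜 => p.1.1) h0
    exact hinj t ht h (congrArg Prod.snd h0) (congrFun (congrFun h3 0) 0)
      (congrFun (congrFun h3 1) 0)
  · rintro ⟨⟨_, y, z, rfl⟩, x⟩
    obtain ⟨t, ht, h, rfl, rfl, rfl⟩ := hsurj x y z
    exact ⟨t, ht, h, rfl⟩

end targets

theorem symmetryAlgebra_eq_bot {l m : 𝕜} (e1 : l + m ≠ 1) (e2 : (3 * l + 1) * (3 * m - 4) ≠ -1)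
    (e3 : m - l ≠ 2) (e4 : l ≠ 0) (e5 : m ≠ 1) : symmetryAlgebra 3 l m = ⊥ := by
  obtain ⟨e⟩ := nonempty_equiv_pi (l := l) (m := m) (fun h => e4 h.1) (fun _ : Fin 1 => 0)
    (fun t ht ⟨h1, h2, h3, h4, h5, h6, h7, h8, h9, h10⟩ h => by
      have p00 : t 0 0 = 0 := h 0
      -- The relations imply l (m - 1) (t 0 0 - t 2 2) = 0; compare `rel02'` with `SymmRel.sq02`.
      have p22 : t 2 2 = 0 := by grind
      have p11 : t 1 1 = 0 := by
        by_contra hne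
        -- A solution with t 1 1 ≠ t 0 0 is ruled out by the two remaining curves: l + m ≠ 1 forces
        -- t 2 3 = 0, and then being off the hyperbola forces t 0 3 = 0.
        have q23 : t 2 3 = 0 := by clear e2; grind
        have q33 : t 3 3 = 0 := by grind
        have q03 : t 0 3 * ((3 * l + 1) * (3 * m - 4) + 1) = 0 := by clear e2; grind
        have q03' : t 0 3 = 0 := by grind
        have q02 : t 0 2 = 0 := by grind
        grind
      have p12 : t 1 2 = 0 := by grind
      have p01 : t 0 1 = 0 := by grind
      have p02 : t 0 2 = 0 := by grind
      have p33 : t 3 3 = 0 := by grind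
      apply upperTri_eq_zero ht <;> grind)
    (fun b => ⟨b 0 • 1, Subalgebra.smul_mem _ (one_mem _) _, by
      constructor <;> simp, fun k => by simp [Subsingleton.elim k 0]⟩)
  refine eq_bot_iff.2 fun T hT => Algebra.mem_bot.2 ⟨e ⟨T, hT⟩ 0, ?_⟩
  have h : algebraMap 𝕜 (symmetryAlgebra 3 l m) (e ⟨T, hT⟩ 0) = ⟨T, hT⟩ := by
    apply e.injective
    rw [e.commutes]
    funext k
    rw [Subsingleton.elim k 0]
    rfl
  exact congrArg Subtype.val h

theorem nonempty_equiv_of_line {l m : 𝕜} (h : l + m = 1) (e1 : l ≠ 0) (e2 : l ≠ -1 / 2)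
    (e3 : l ≠ -2 / 3) : Nonempty (symmetryAlgebra 3 l m ≃ₐ[𝕜] (Fin 2 → 𝕜)) := by
  obtain rfl : m = 1 - l := by rw [← h]; ring
  refine nonempty_equiv_pi (fun h => e1 h.1) ![0, 1]
    (fun t ht ⟨h1, h2, h3, h4, h5, h6, h7, h8, h9, h10⟩ h => ?_) (fun b => ?_)
  · have p0 : t 0 0 = 0 := h 0
    have p1 : t 1 1 = 0 := h 1
    have p2 : t 2 2 = 0 := by grind
    have p3 : t 3 3 = 0 := by grind
    apply upperTri_eq_zero ht <;> grind
  -- The witness is (b 0 + b 1)/2 times the identity plus (b 0 - b 1)/2 times the formal adjoint A ↦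
  -- A*, which preserves the module when l + m = 1.
  · exact ⟨_, triMat_mem (b 0) (b 1) (b 0) (b 1) (-(b 0 - b 1) / 2) ((b 0 - b 1) / 2)
      (-(b 0 - b 1) / 2) (b 0 - b 1) (-3 / 2 * (b 0 - b 1)) (-3 / 2 * (b 0 - b 1)), by
      apply symmRel_triMat <;> ring, fun k => by fin_cases k <;> rfl⟩

theorem nonempty_equiv_of_hyperbola {l m : 𝕜} (h : (3 * l + 1) * (3 * m - 4) = -1) (e1 : l ≠ 0)
    (e2 : l ≠ -2 / 3) (e3 : m - l ≠ 2) :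
    Nonempty (symmetryAlgebra 3 l m ≃ₐ[𝕜] (Fin 2 → 𝕜)) := by
  have e4 : 1 - (m - l) ≠ 0 := by
    intro h1
    have h2 : m = l + 1 := by linear_combination -h1
    apply e1
    have h3 : l * l = 0 := by rw [h2] at h; linear_combination h / 9
    exact mul_self_eq_zero.1 h3
  have e5 : 2 - (m - l) ≠ 0 := fun h1 => e3 (by linear_combination -h1)
  refine nonempty_equiv_pi (fun h => e1 h.1) ![0, 1]
    (fun t ht ⟨h1, h2, h3, h4, h5, h6, h7, h8, h9, h10⟩ h => ?_) (fun b => ?_)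
  · have p0 : t 0 0 = 0 := h 0
    have p1 : t 1 1 = 0 := h 1
    have p2 : t 2 2 = 0 := by grind
    have p12 : t 1 2 = 0 := by grind
    have p01 : t 0 1 = 0 := by grind
    have p02 : t 0 2 = 0 := by grind
    have p3 : t 3 3 = 0 := by grind
    apply upperTri_eq_zero ht <;> grind
  -- Put d = m - l. On the hyperbola X = (2 - d) a_1 - (2l + 1) a_2' + (3l + 1) a_3'' is an
  -- invariant density; the witness is b 0 times the identity minus v times A ↦ (1 - d) X d/dx + l
  -- X'.
  · set v := (b 0 - b 1) / ((1 - (m - l)) * (2 - (m - l))) with hv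
    have hb : b 1 = b 0 - (1 - (m - l)) * (2 - (m - l)) * v := by
      rw [hv]; field_simp; ring
    refine ⟨_, triMat_mem (b 0) (b 1) (b 0) (b 0) (-l * (2 - (m - l)) * v)
      (l * (2 * l + 1) * v) (-l * (3 * l + 1) * v) ((1 - (m - l)) * (2 * l + 1) * v)
      (-(1 - (m - l)) * (3 * l + 1) * v) 0, ?_, fun k => by fin_cases k <;> rfl⟩
    apply symmRel_triMat <;> try simp only [hb]
    all_goals grind

theorem nonempty_equiv_of_sub_eq_two {l m : 𝕜} (h : m - l = 2) (e1 : l ≠ 0) (e2 : l ≠ -1 / 2)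
    (e3 : l ≠ -1) : Nonempty (symmetryAlgebra 3 l m ≃ₐ[𝕜] algA 𝕜) := by
  obtain rfl : m = l + 2 := by rw [← h]; ring
  have e4 : l + 1 ≠ 0 := fun h1 => e3 (eq_neg_of_add_eq_zero_left h1)
  have key : ∀ t : Matrix (Fin 4) (Fin 4) 𝕜, SymmRel l (l + 2) t → t 2 3 = 0 ∧ t 3 3 = t 1 1 := by
    rintro t ⟨h1, h2, h3, h4, h5, h6, h7, h8, h9, h10⟩
    have p01 : t 0 1 = 0 := by grind
    have p00 : t 0 0 = t 1 1 := by grind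
    have p22 : t 2 2 = t 1 1 := by grind
    constructor <;> grind
  refine nonempty_equiv_algA (i := 1) (j := 3) (fun h => e1 h.1) (by decide)
    (fun s hs t ht r1 r2 => ?_)
    (fun t ht ⟨h1, h2, h3, h4, h5, h6, h7, h8, h9, h10⟩ p1 p13 => ?_) (fun y z => ?_)
  · rw [upperTri_mul_one_three hs, (key t r2).1, (key t r2).2]
    ring
  · have p01 : t 0 1 = 0 := by grind
    have p00 : t 0 0 = t 1 1 := by grind
    have p22 : t 2 2 = t 1 1 := by grind
    apply upperTri_eq_zero ht <;> grind
  -- For m - l = 2 the function h = a_2 - 3(l + 1) a_3' is invariant. The nilpotent part of the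
  -- witness is A ↦ -v (h' d/dx - l h''); it squares to zero since its image has no coefficients of
  -- order 2 and 3.
  · set v := z / (3 * (l + 1)) with hv
    have hz : z = 3 * (l + 1) * v := by rw [hv]; field_simp
    refine ⟨_, triMat_mem y y y y 0 (l * v) (-l * z) (-v) z 0, ?_, rfl, rfl⟩
    rw [hz]
    apply symmRel_triMat <;> ring

theorem nonempty_equiv_of_left_eq_zero {m : 𝕜} (e1 : m ≠ 3) (e2 : m ≠ 2) (e3 : m ≠ 1) :
    Nonempty (symmetryAlgebra 3 0 m ≃ₐ[𝕜] (Fin 3 → 𝕜)) := by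
  have e4 : 2 - m ≠ 0 := fun h => e2 (sub_eq_zero.1 h).symm
  have e5 : 3 - m ≠ 0 := fun h => e1 (sub_eq_zero.1 h).symm
  refine nonempty_equiv_pi (fun h => e3 h.2) ![0, 1, 2]
    (fun t ht ⟨h1, h2, h3, h4, h5, h6, h7, h8, h9, h10⟩ h => ?_) (fun b => ?_)
  · have p0 : t 0 0 = 0 := h 0
    have p1 : t 1 1 = 0 := h 1
    have p2 : t 2 2 = 0 := h 2
    apply upperTri_eq_zero ht <;> grind
  -- The zeroth coefficient splits off. On the rest the witness is b 1 times the identity minus v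
  -- times A ↦ (2 - m) X d²/dx² + X' d/dx, with X = (3 - m) a_2 - 3 a_3'. This map squares to (2 -
  -- m)(3 - m) times itself, so it becomes nilpotent at m = 2 and m = 3.
  · set v := (b 1 - b 2) / ((2 - m) * (3 - m)) with hv
    have hb : b 1 = b 2 + (2 - m) * (3 - m) * v := by
      rw [hv]; field_simp; ring
    refine ⟨_, triMat_mem (b 0) (b 1) (b 2) (b 1) 0 0 0 (-(3 - m) * v) (3 * v)
      (3 * (2 - m) * v), ?_, fun k => by fin_cases k <;> rfl⟩
    rw [hb]
    apply symmRel_triMat <;> ring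

/-- The adjoint exchanges (l, m) with (1 - m, 1 - l), so this mirrors the line l = 0, and the points
(-1, 1), (-2, 1) mirror (0, 2), (0, 3). The relations are nevertheless solved directly. -/
theorem nonempty_equiv_of_right_eq_one {l : 𝕜} (e1 : l ≠ 0) (e2 : l ≠ -1) (e3 : l ≠ -2) :
    Nonempty (symmetryAlgebra 3 l 1 ≃ₐ[𝕜] (Fin 3 → 𝕜)) := by
  have e4 : l + 1 ≠ 0 := fun h1 => e2 (eq_neg_of_add_eq_zero_left h1)
  have e5 : l + 2 ≠ 0 := fun h1 => e3 (eq_neg_of_add_eq_zero_left h1)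
  refine nonempty_equiv_pi (fun h => e1 h.1) ![0, 1, 2]
    (fun t ht ⟨h1, h2, h3, h4, h5, h6, h7, h8, h9, h10⟩ h => ?_) (fun b => ?_)
  · have p0 : t 0 0 = 0 := h 0
    have p1 : t 1 1 = 0 := h 1
    have p2 : t 2 2 = 0 := h 2
    apply upperTri_eq_zero ht <;> grind
  · set v := (b 1 - b 2) / ((l + 1) * (l + 2)) with hv
    have hb : b 1 = b 2 + (l + 1) * (l + 2) * v := by
      rw [hv]; field_simp; ring
    refine ⟨_, triMat_mem (b 0) (b 1) (b 2) (b 1) (b 1 - b 0) (b 0 - b 1 - l * (l + 2) * v)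
      (b 1 - b 0 + 3 * l * (l + 1) * v) (-(2 * l + 1) * (l + 2) * v)
      (3 * (2 * l + 1) * (l + 1) * v) (3 * (l + 1) * (l + 1) * v), ?_,
      fun k => by fin_cases k <;> rfl⟩
    rw [hb]
    apply symmRel_triMat <;> ring

theorem nonempty_equiv_zero_three :
    Nonempty (symmetryAlgebra 3 (0 : 𝕜) 3 ≃ₐ[𝕜] algA 𝕜 × 𝕜) := by
  refine nonempty_equiv_algA_prod (i := 2) (j := 3) (fun h => by norm_num at h) (by decide)
    (fun s hs t ht r1 r2 => ?_)
    (fun t ht ⟨h1, h2, h3, h4, h5, h6, h7, h8, h9, h10⟩ p0 p1 p => ?_) (fun x y z => ?_)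
  · have key : ∀ t : Matrix (Fin 4) (Fin 4) 𝕜, SymmRel 0 3 t → t 2 2 = t 1 1 ∧ t 3 3 = t 1 1 := by
      rintro t ⟨h1, h2, h3, h4, -, -, -, -, -, -⟩
      constructor <;> grind
    rw [upperTri_mul_superdiag hs ht (by decide), (key s r1).1, (key t r2).2]
    ring
  · apply upperTri_eq_zero ht <;> grind
  · exact ⟨_, triMat_mem x y y y 0 0 0 0 (-z) z, by apply symmRel_triMat <;> ring, rfl, rfl, rfl⟩

theorem nonempty_equiv_zero_two :
    Nonempty (symmetryAlgebra 3 (0 : 𝕜) 2 ≃ₐ[𝕜] algA 𝕜 × 𝕜) := by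
  refine nonempty_equiv_algA_prod (i := 1) (j := 3) (fun h => by norm_num at h) (by decide)
    (fun s hs t ht r1 r2 => ?_)
    (fun t ht ⟨h1, h2, h3, h4, h5, h6, h7, h8, h9, h10⟩ p0 p1 p => ?_) (fun x y z => ?_)
  · have key : ∀ t : Matrix (Fin 4) (Fin 4) 𝕜, SymmRel 0 2 t → t 2 3 = 0 ∧ t 3 3 = t 1 1 := by
      rintro t ⟨h1, h2, h3, h4, -, -, -, -, -, -⟩
      constructor <;> grind
    rw [upperTri_mul_one_three hs, (key t r2).1, (key t r2).2]
    ring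
  · apply upperTri_eq_zero ht <;> grind
  · exact ⟨_, triMat_mem x y y y 0 0 0 (-z / 3) z 0, by apply symmRel_triMat <;> ring,
      rfl, rfl, rfl⟩

theorem nonempty_equiv_neg_one_one :
    Nonempty (symmetryAlgebra 3 (-1 : 𝕜) 1 ≃ₐ[𝕜] algA 𝕜 × 𝕜) := by
  refine nonempty_equiv_algA_prod (i := 1) (j := 2) (fun h => by norm_num at h) (by decide)
    (fun s hs t ht r1 r2 => ?_)
    (fun t ht ⟨h1, h2, h3, h4, h5, h6, h7, h8, h9, h10⟩ p0 p1 p => ?_) (fun x y z => ?_)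
  · have key : t 2 2 = t 1 1 := by
      have := r2.rel12
      grind
    rw [upperTri_mul_superdiag hs ht (by decide), key]
    ring
  · apply upperTri_eq_zero ht <;> grind
  · exact ⟨_, triMat_mem x y y y (y - x) (z + x - y) (y - x) z 0 0,
      by apply symmRel_triMat <;> ring, rfl, rfl, rfl⟩

theorem nonempty_equiv_neg_two_one :
    Nonempty (symmetryAlgebra 3 (-2 : 𝕜) 1 ≃ₐ[𝕜] algA 𝕜 × 𝕜) := by
  refine nonempty_equiv_algA_prod (i := 2) (j := 3) (fun h => by norm_num at h) (by decide)
    (fun s hs t ht r1 r2 => ?_)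
    (fun t ht ⟨h1, h2, h3, h4, h5, h6, h7, h8, h9, h10⟩ p0 p1 p => ?_) (fun x y z => ?_)
  · have key : ∀ t : Matrix (Fin 4) (Fin 4) 𝕜, SymmRel (-2) 1 t →
        t 2 2 = t 1 1 ∧ t 3 3 = t 1 1 := by
      rintro t ⟨h1, h2, h3, h4, -, -, -, -, -, -⟩
      constructor <;> grind
    rw [upperTri_mul_superdiag hs ht (by decide), (key s r1).1, (key t r2).2]
    ring
  · apply upperTri_eq_zero ht <;> grind
  · exact ⟨_, triMat_mem x y y y (y - x) (x - y) (y - x + 2 * z) 0 (3 * z) z,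
      by apply symmRel_triMat <;> ring, rfl, rfl, rfl⟩

/-- The lines l + m = 1 and m - l = 2 meet here. The middle 2 × 2 block of t is a free upper
triangular matrix; reversing the order of its basis makes it lower triangular. -/
theorem nonempty_equiv_algT :
    Nonempty (symmetryAlgebra 3 (-1 / 2 : 𝕜) (3 / 2) ≃ₐ[𝕜] algT 𝕜 2) := by
  refine nonempty_equiv_of_matrix (fun h => by norm_num at h)
    { toFun := fun t => ⟨!![t 2 2, 0; t 1 2, t 1 1], fun i j hij => by
        fin_cases i <;> fin_cases j <;> first | rfl | exact absurd hij (by decide)⟩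
      map_add' := fun s t => Subtype.ext (by simp)
      map_smul' := fun c t => Subtype.ext (by simp) }
    (Subtype.ext ?_) (fun s hs t ht h1 h2 => Subtype.ext ?_)
    (fun t ht ⟨h1, h2, h3, h4, h5, h6, h7, h8, h9, h10⟩ h0 => ?_) ?_
  · simp [Matrix.one_fin_two]
  · simp [upperTri_mul_diag hs ht,
      upperTri_mul_superdiag hs ht (show ((2 : Fin 4) : ℕ) = (1 : Fin 4) + 1 by decide), add_comm]
  · have h3 : !![t 2 2, 0; t 1 2, t 1 1] = 0 := congrArg Subtype.val h0
    have p2 : t 2 2 = 0 := congrFun (congrFun h3 0) 0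
    have p12 : t 1 2 = 0 := congrFun (congrFun h3 1) 0
    have p1 : t 1 1 = 0 := congrFun (congrFun h3 1) 1
    clear h0 h3
    apply upperTri_eq_zero ht <;> grind
  · have key : ∀ x y z : 𝕜, ∃ t ∈ upperTri 𝕜, SymmRel (-1 / 2) (3 / 2) t ∧ t 2 2 = x ∧
        t 1 1 = y ∧ t 1 2 = z := fun x y z =>
      ⟨_, triMat_mem x y x y (-(x - y) / 2) (z / 2) ((x - y) / 4 - 3 / 4 * z) z (-3 / 2 * z)
        (-3 / 2 * (x - y)), by apply symmRel_triMat <;> ring, rfl, rfl, rfl⟩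
    rintro ⟨M, hM⟩
    obtain ⟨t, ht, h, h22, h11, h12⟩ := key (M 0 0) (M 1 1) (M 1 0)
    refine ⟨t, ht, h, Subtype.ext ?_⟩
    change !![t 2 2, 0; t 1 2, t 1 1] = M
    rw [h22, h11, h12, ← hM 0 1 (by decide)]
    exact (Matrix.eta_fin_two M).symm

/-- The line l + m = 1 meets the hyperbola here, so the adjoint and the symmetry of the hyperbola
coexist; this makes t 3 3 independent of t 0 0 and t 1 1. -/
theorem nonempty_equiv_neg_two_thirds :
    Nonempty (symmetryAlgebra 3 (-2 / 3 : 𝕜) (5 / 3) ≃ₐ[𝕜] (Fin 3 → 𝕜)) := by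
  refine nonempty_equiv_pi (fun h => by norm_num at h) ![0, 1, 3]
    (fun t ht ⟨h1, h2, h3, h4, h5, h6, h7, h8, h9, h10⟩ h => ?_) (fun b => ?_)
  · have p0 : t 0 0 = 0 := h 0
    have p1 : t 1 1 = 0 := h 1
    have p3 : t 3 3 = 0 := h 2
    apply upperTri_eq_zero ht <;> grind
  · refine ⟨_, triMat_mem (b 0) (b 1) (b 0) (b 2) (-(b 0 - b 1) / 2) ((b 0 - b 1) / 2)
      (-3 / 2 * (b 0 - b 1) + (b 0 - b 2)) (b 0 - b 1)
      (-3 * (b 0 - b 1) + 3 / 2 * (b 0 - b 2)) (-3 / 2 * (b 0 - b 2)), ?_,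
      fun k => by fin_cases k <;> rfl⟩
    apply symmRel_triMat <;> ring

end

/-! ### The weights (0, 1): five local parameters and the nonlocal symmetry. -/

section

/-- The matrices of the local symmetries of the operators from functions to one-forms. -/
noncomputable def zeroOneMat (a b c x y : 𝕜) : Matrix (Fin 4) (Fin 4) 𝕜 :=
  triMat b a x y c (-c) c (x - a) ((2 * a + y - 3 * x) / 2) (-3 / 2 * (x - y))

/-- The last two parameters are independent characters, giving the summand 𝕜². The first three
multiply like the lower triangular part of 𝔟. -/
theorem zeroOneMat_mul (a b c x y a' b' c' x' y' : 𝕜) :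
    zeroOneMat a b c x y * zeroOneMat a' b' c' x' y' =
      zeroOneMat (a * a') (b * b') (c * a' + b * c') (x * x') (y * y') := by
  ext i j
  fin_cases i <;> fin_cases j <;>
    simp [zeroOneMat, triMat, Matrix.mul_apply, Fin.sum_univ_four] <;> ring

theorem zeroOneMat_add (a b c x y a' b' c' x' y' : 𝕜) :
    zeroOneMat (a + a') (b + b') (c + c') (x + x') (y + y') =
      zeroOneMat a b c x y + zeroOneMat a' b' c' x' y' := by
  ext i j
  fin_cases i <;> fin_cases j <;> simp [zeroOneMat, triMat] <;> ring

theorem zeroOneMat_smul (r a b c x y : 𝕜) :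
    zeroOneMat (r * a) (r * b) (r * c) (r * x) (r * y) = r • zeroOneMat a b c x y := by
  ext i j
  fin_cases i <;> fin_cases j <;> simp [zeroOneMat, triMat] <;> ring

theorem zeroOneMat_one : zeroOneMat (1 : 𝕜) 1 0 1 1 = 1 := by
  ext i j
  fin_cases i <;> fin_cases j <;> simp [zeroOneMat, triMat]
  norm_num

theorem zeroOneMat_mem (a b c x y : 𝕜) : zeroOneMat a b c x y ∈ upperTri 𝕜 :=
  triMat_mem _ _ _ _ _ _ _ _ _ _

theorem symmRel_zeroOneMat (a b c x y : 𝕜) : SymmRel 0 1 (zeroOneMat a b c x y) := by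
  apply symmRel_triMat <;> ring

theorem eq_zeroOneMat {t : Matrix (Fin 4) (Fin 4) 𝕜} (ht : t ∈ upperTri 𝕜) (h : SymmRel 0 1 t) :
    t = zeroOneMat (t 1 1) (t 0 0) (t 0 1) (t 2 2) (t 3 3) := by
  obtain ⟨h1, h2, h3, h4, h5, h6, h7, h8, h9, h10⟩ := h
  have e23 : t 2 3 = -3 / 2 * (t 2 2 - t 3 3) := by linear_combination h1 / 2
  have e12 : t 1 2 = t 2 2 - t 1 1 := by linear_combination h2
  have e13 : t 1 3 = (2 * t 1 1 + t 3 3 - 3 * t 2 2) / 2 := by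
    linear_combination h4 / 2 - 3 / 2 * h2
  have e02 : t 0 2 = -t 0 1 := by linear_combination h7
  have e03 : t 0 3 = t 0 1 := by linear_combination h8 / 3 - h7
  ext i j
  rcases lt_or_ge j i with hij | hij
  · rw [ht i j hij, zeroOneMat_mem _ _ _ _ _ i j hij]
  · fin_cases i <;> fin_cases j <;> first | rfl | assumption | exact absurd hij (by decide)

/-- The action of `𝔟 ⊕ 𝕜²` by symmetries of the operators from functions to one-forms. -/
noncomputable def zeroOneHom :
    algB 𝕜 × (Fin 2 → 𝕜) →ₐ[𝕜] Module.End 𝕜 (Fin 4 → CircleFun 𝕜) :=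
  AlgHom.ofLinearMap
    { toFun := fun p => triOp (zeroOneMat (p.1.1 0 0) (p.1.1 2 2) (p.1.1 2 1) (p.2 0) (p.2 1)) +
        p.1.1 0 3 • nonlocalOp 𝕜
      map_add' := fun p q => by
        have h := zeroOneMat_add (p.1.1 0 0) (p.1.1 2 2) (p.1.1 2 1) (p.2 0) (p.2 1)
          (q.1.1 0 0) (q.1.1 2 2) (q.1.1 2 1) (q.2 0) (q.2 1)
        have h' := congrArg triOp h
        rw [map_add] at h'
        refine (congrArg₂ (· + ·) h' (add_smul (p.1.1 0 3) (q.1.1 0 3) (nonlocalOp 𝕜))).trans ?_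
        exact add_add_add_comm _ _ _ _
      map_smul' := fun r p => by
        have h := zeroOneMat_smul r (p.1.1 0 0) (p.1.1 2 2) (p.1.1 2 1) (p.2 0) (p.2 1)
        have h' := congrArg triOp h
        rw [map_smul] at h'
        refine (congrArg₂ (· + ·) h' (mul_smul r (p.1.1 0 3) (nonlocalOp 𝕜))).trans ?_
        exact (smul_add _ _ _).symm }
    (by
      refine (congrArg₂ (· + ·) (congrArg triOp zeroOneMat_one)
        (zero_smul 𝕜 (nonlocalOp 𝕜))).trans ?_
      rw [triOp_one, add_zero])
    (by
      rintro ⟨⟨_, a, b, c, d, rfl⟩, v⟩ ⟨⟨_, a', b', c', d', rfl⟩, v'⟩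
      have h := congrArg triOp (zeroOneMat_mul a b c (v 0) (v 1) a' b' c' (v' 0) (v' 1))
      have h1 := zeroOneMat_mem a b c (v 0) (v 1)
      have h2 := zeroOneMat_mem a' b' c' (v' 0) (v' 1)
      rw [triOp_mul h1 h2] at h
      have e1 : (!![a, 0, 0, d; 0, a, 0, 0; 0, c, b, 0; 0, 0, 0, b] *
          !![a', 0, 0, d'; 0, a', 0, 0; 0, c', b', 0; 0, 0, 0, b'] : Matrix (Fin 4) (Fin 4) 𝕜) =
          !![a * a', 0, 0, a * d' + d * b'; 0, a * a', 0, 0; 0, c * a' + b * c', b * b', 0;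
            0, 0, 0, b * b'] := by
        ext i j
        fin_cases i <;> fin_cases j <;> simp [Matrix.mul_apply, Fin.sum_univ_four]
      have e2 : triOp (zeroOneMat (a * a') (b * b') (c * a' + b * c') (v 0 * v' 0)
          (v 1 * v' 1)) + (a * d' + d * b') • nonlocalOp 𝕜 =
          (triOp (zeroOneMat a b c (v 0) (v 1)) + d • nonlocalOp 𝕜) *
          (triOp (zeroOneMat a' b' c' (v' 0) (v' 1)) + d' • nonlocalOp 𝕜) := by
        -- In the cross terms the nonlocal operator is scaled by a on the left and by b' on the
        -- right, and its square is zero. This yields a d' + d b', the corner entry of the product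
        -- in 𝔟.
        rw [← h, add_mul, mul_add, mul_add, smul_mul_assoc, smul_mul_assoc, mul_smul_comm,
          mul_smul_comm, triOp_mul_nonlocalOp h1, nonlocalOp_mul_triOp, nonlocalOp_mul_self,
          smul_zero, smul_zero, add_zero, add_assoc, smul_smul, smul_smul, ← add_smul]
        congr 2
        change a * d' + d * b' = d' * a + d * b'
        ring
      refine Eq.trans ?_ e2
      have e3 : ((⟨!![a, 0, 0, d; 0, a, 0, 0; 0, c, b, 0; 0, 0, 0, b], a, b, c, d, rfl⟩, v) *
          (⟨!![a', 0, 0, d'; 0, a', 0, 0; 0, c', b', 0; 0, 0, 0, b'], a', b', c', d', rfl⟩, v') :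
          algB 𝕜 × (Fin 2 → 𝕜)) = (⟨!![a * a', 0, 0, a * d' + d * b'; 0, a * a', 0, 0;
            0, c * a' + b * c', b * b', 0; 0, 0, 0, b * b'], _, _, _, _, rfl⟩, v * v') :=
        Prod.ext (Subtype.ext e1) rfl
      rw [e3]
      rfl)

theorem nonempty_equiv_algB :
    Nonempty (symmetryAlgebra 3 (0 : 𝕜) 1 ≃ₐ[𝕜] algB 𝕜 × (Fin 2 → 𝕜)) := by
  refine nonempty_symmetryAlgebra_equiv zeroOneHom ?_ fun T => ?_
  · rw [injective_iff_map_eq_zero]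
    rintro ⟨⟨_, a, b, c, d, rfl⟩, v⟩ h
    obtain ⟨h1, hd⟩ := triOp_add_eq_zero (zeroOneMat_mem _ _ _ _ _) h
    have ha : a = 0 := congrFun (congrFun h1 1) 1
    have hb : b = 0 := congrFun (congrFun h1 0) 0
    have hc : c = 0 := congrFun (congrFun h1 0) 1
    have hv0 : v 0 = 0 := congrFun (congrFun h1 2) 2
    have hv1 : v 1 = 0 := congrFun (congrFun h1 3) 3
    have hd' : d = 0 := hd
    subst ha hb hc hd'
    refine Prod.ext (Subtype.ext ?_) (funext fun k => ?_)
    · ext i j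
      fin_cases i <;> fin_cases j <;> rfl
    · fin_cases k
      · exact hv0
      · exact hv1
  · rw [commute_zero_one_iff]
    constructor
    · rintro ⟨t, ht, h, c, rfl⟩
      refine ⟨(⟨_, t 1 1, t 0 0, t 0 1, c, rfl⟩, ![t 2 2, t 3 3]), ?_⟩
      conv_rhs => rw [eq_zeroOneMat ht h]
      rfl
    · rintro ⟨p, rfl⟩
      exact ⟨_, zeroOneMat_mem _ _ _ _ _, symmRel_zeroOneMat _ _ _ _ _, _, rfl⟩

end

end CircleSymm

/-- Classification of the algebras of symmetries of the modules of third-order operators. For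
`𝕜 = ℝ` the weights are real and densities real-valued, for `𝕜 = ℂ` the weights are complex and
densities complex-valued. Here `l`, `m` are the weights `λ`, `μ`; the condition `m - l ≠ 2` on the hyperbola holds automatically for
`𝕜 = ℝ`. -/
theorem theorem3p4 {𝕜 : Type*} [RCLike 𝕜] :
    -- the trivial algebras
    (∀ l m : 𝕜, l + m ≠ 1 → (3 * l + 1) * (3 * m - 4) ≠ -1 → m - l ≠ 2 → l ≠ 0 → m ≠ 1 →
      CircleSymm.symmetryAlgebra 3 l m = ⊥) ∧
    -- the line `l + m = 1`
    (∀ l m : 𝕜, l + m = 1 → l ≠ 0 → l ≠ -1 / 2 → l ≠ -2 / 3 →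
      Nonempty (CircleSymm.symmetryAlgebra 3 l m ≃ₐ[𝕜] (Fin 2 → 𝕜))) ∧
    -- the hyperbola
    (∀ l m : 𝕜, (3 * l + 1) * (3 * m - 4) = -1 → l ≠ 0 → l ≠ -2 / 3 → m - l ≠ 2 →
      Nonempty (CircleSymm.symmetryAlgebra 3 l m ≃ₐ[𝕜] (Fin 2 → 𝕜))) ∧
    -- the line `m - l = 2`
    (∀ l m : 𝕜, m - l = 2 → l ≠ 0 → l ≠ -1 / 2 → l ≠ -1 →
      Nonempty (CircleSymm.symmetryAlgebra 3 l m ≃ₐ[𝕜] CircleSymm.algA 𝕜)) ∧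
    -- the lines `l = 0` and `m = 1`
    (∀ m : 𝕜, m ≠ 3 → m ≠ 2 → m ≠ 1 →
      Nonempty (CircleSymm.symmetryAlgebra 3 0 m ≃ₐ[𝕜] (Fin 3 → 𝕜))) ∧
    (∀ l : 𝕜, l ≠ 0 → l ≠ -1 → l ≠ -2 →
      Nonempty (CircleSymm.symmetryAlgebra 3 l 1 ≃ₐ[𝕜] (Fin 3 → 𝕜))) ∧
    -- the special points
    Nonempty (CircleSymm.symmetryAlgebra 3 (0 : 𝕜) 3 ≃ₐ[𝕜] CircleSymm.algA 𝕜 × 𝕜) ∧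
    Nonempty (CircleSymm.symmetryAlgebra 3 (0 : 𝕜) 2 ≃ₐ[𝕜] CircleSymm.algA 𝕜 × 𝕜) ∧
    Nonempty (CircleSymm.symmetryAlgebra 3 (-1 : 𝕜) 1 ≃ₐ[𝕜] CircleSymm.algA 𝕜 × 𝕜) ∧
    Nonempty (CircleSymm.symmetryAlgebra 3 (-2 : 𝕜) 1 ≃ₐ[𝕜] CircleSymm.algA 𝕜 × 𝕜) ∧
    Nonempty (CircleSymm.symmetryAlgebra 3 (-1 / 2 : 𝕜) (3 / 2) ≃ₐ[𝕜] CircleSymm.algT 𝕜 2) ∧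
    Nonempty (CircleSymm.symmetryAlgebra 3 (-2 / 3 : 𝕜) (5 / 3) ≃ₐ[𝕜] (Fin 3 → 𝕜)) ∧
    Nonempty (CircleSymm.symmetryAlgebra 3 (0 : 𝕜) 1 ≃ₐ[𝕜]
      CircleSymm.algB 𝕜 × (Fin 2 → 𝕜)) := by
  open CircleSymm in
  exact ⟨fun l m => symmetryAlgebra_eq_bot, fun l m => nonempty_equiv_of_line,
    fun l m => nonempty_equiv_of_hyperbola, fun l m => nonempty_equiv_of_sub_eq_two,
    fun m => nonempty_equiv_of_left_eq_zero, fun l => nonempty_equiv_of_right_eq_one,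
    nonempty_equiv_zero_three, nonempty_equiv_zero_two, nonempty_equiv_neg_one_one,
    nonempty_equiv_neg_two_one, nonempty_equiv_algT, nonempty_equiv_neg_two_thirds,
    nonempty_equiv_algB⟩
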